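/- Let $D,N,I\in\mathbb N$ with $N\le D$, let $\alpha\in(0,1)$, $0<\underline\delta<\overline\delta$ and $a_1,\dots,a_I>0$, and set $\tau_\Sigma:=\sum_{i=1}^I 1/a_i$. Let $C:[0,1]\to\mathbb R^{D\times D}$ be $\alpha$-Hölder continuous with $$\underline\delta|y|^2\le y^TC(t)C(t)^Ty\le\overline\delta|y|^2,\qquad y\in\mathbb R^D,\ t\in[0,1],$$ and let $\bar C(t)\in\mathbb R^{D\times N}$ consist of the first $N$ columns of $C(t)$. Let $g^{(1)},\dots,g^{(I)}\in C^{2+\alpha}(\mathbb R^D)$, that is, each $g^{(i)}$ is twice continuously differentiable, $g^{(i)},\partial_yg^{(i)},\partial_{yy}g^{(i)}$ are bounded, and $\partial_{yy}g^{(i)}$ is $\alpha$-Hölder continuous on $\mathbb R^D$. Then there exists $T_0\in(0,1]$ such that for every $T\in(0,T_0)$ the system, for $i=1,\dots,I$ and $(t,y)\in[0,T]\times\mathbb R^D$, $$\partial_t u^{(i)}+\frac1{2a_i}|\lambda|^2-\lambda^T\bar C^T\partial_yu^{(i)}+\frac{a_i}2\Big(|\bar C^T\partial_yu^{(i)}|^2-|C^T\partial_yu^{(i)}|^2\Big)+\frac12\operatorname{tr}\big(\partial_{yy}u^{(i)}CC^T\big)=0,\qquad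 u^{(i)}(T,y)=g^{(i)}(y),$$ where $$\lambda(t,y):=\frac1{\tau_\Sigma}\bar C(t)^T\sum_{j=1}^I\partial_yu^{(j)}(t,y),$$ has a unique solution $(u^{(i)})_{i=1}^I$ with every $u^{(i)}\in C^{2+\alpha}([0,T]\times\mathbb R^D)$. Here $u\in C^{2+\alpha}([0,T]\times\mathbb R^D)$ means that $u,\partial_tu,\partial_yu,\partial_{yy}u$ exist, are continuous and bounded on $[0,T]\times\mathbb R^D$ (time derivatives at $t=0,T$ being one-sided), and that $h=\partial_tu$ and every entry $h$ of $\partial_{yy}u$ satisfy $$\sup_{(t,x)\ne(s,y)}\frac{|h(t,x)-h(s,y)|}{(\sqrt{|t-s|}+|x-y|)^\alpha}<\infty .$$ -/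

import Mathlib

open scoped ENNReal Matrix

namespace RadnerPDE

/-- The state space `ℝ^D` with the Euclidean norm. -/
abbrev State (D : ℕ) : Type := EuclideanSpace ℝ (Fin D)

/-! ### Derivatives -/

/-- The partial derivative `∂_{y_d} g (y)`. -/
noncomputable def partialDeriv {D : ℕ} (d : Fin D) (g : State D → ℝ) (y : State D) : ℝ :=
  fderiv ℝ g y (EuclideanSpace.single d 1)

/-- The gradient `∂_y g (y)`, as a column vector. -/
noncomputable def grad {D : ℕ} (g : State D → ℝ) (y : State D) : Fin D → ℝ :=
  fun d => partialDeriv d g y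

/-- The Hessian `∂_{yy} g (y)`, as a `D × D` matrix. -/
noncomputable def hess {D : ℕ} (g : State D → ℝ) (y : State D) : Matrix (Fin D) (Fin D) ℝ :=
  Matrix.of fun d e => partialDeriv e (partialDeriv d g) y

/-- The time derivative `∂_t u (t, y)` on the interval `[0, T]` (one-sided at the end points). -/
noncomputable def timeDeriv {D : ℕ} (T : ℝ) (u : ℝ → State D → ℝ) (t : ℝ) (y : State D) : ℝ :=
  derivWithin (fun s => u s y) (Set.Icc 0 T) t

/-! ### Hölder spaces on `ℝ^D` -/

/-- `|g|_0`, the supremum of `|g|` over `ℝ^D`, with values in `[0, ∞]`. -/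
noncomputable def supNorm {D : ℕ} (g : State D → ℝ) : ℝ≥0∞ :=
  ⨆ x : State D, ENNReal.ofReal |g x|

/-- `[g]_α`, the `α`-Hölder semi-norm over `ℝ^D`, with values in `[0, ∞]`. -/
noncomputable def holderSeminorm {D : ℕ} (α : ℝ) (g : State D → ℝ) : ℝ≥0∞ :=
  ⨆ (x : State D) (y : State D) (_ : x ≠ y), ENNReal.ofReal (|g x - g y| / ‖x - y‖ ^ α)

/-- `|g|_{2+α}`; vector- and matrix-valued terms are summed over their components. -/
noncomputable def holderNorm₂ {D : ℕ} (α : ℝ) (g : State D → ℝ) : ℝ≥0∞ :=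
  supNorm g + ∑ d, supNorm (partialDeriv d g)
    + ∑ d, ∑ e, supNorm (fun y => hess g y d e)
    + ∑ d, ∑ e, holderSeminorm α (fun y => hess g y d e)

/-- `g ∈ C^{2+α}(ℝ^D)`. -/
def MemHolder₂ {D : ℕ} (α : ℝ) (g : State D → ℝ) : Prop :=
  ContDiff ℝ 2 g ∧ holderNorm₂ α g < ∞

/-! ### Parabolic Hölder spaces on `[0, T] × ℝ^D`

A function on `[0, T] × ℝ^D` is represented by a function on `ℝ × ℝ^D` of which only the values
at times in `[0, T]` are used. -/

/-- `|h|_0`, the supremum of `|h|` over `[0, T] × ℝ^D`, with values in `[0, ∞]`. -/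
noncomputable def parSupNorm {D : ℕ} (T : ℝ) (h : ℝ → State D → ℝ) : ℝ≥0∞ :=
  ⨆ (t : ℝ) (_ : t ∈ Set.Icc 0 T) (x : State D), ENNReal.ofReal |h t x|

/-- `[h]_α`, the parabolic `α`-Hölder semi-norm over `[0, T] × ℝ^D`, with values in `[0, ∞]`. -/
noncomputable def parHolderSeminorm {D : ℕ} (T α : ℝ) (h : ℝ → State D → ℝ) : ℝ≥0∞ :=
  ⨆ (t : ℝ) (_ : t ∈ Set.Icc 0 T) (s : ℝ) (_ : s ∈ Set.Icc 0 T) (x : State D) (y : State D)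
    (_ : (t, x) ≠ (s, y)),
    ENNReal.ofReal (|h t x - h s y| / (√|t - s| + ‖x - y‖) ^ α)

/-- The parabolic norm `|u|_{2+α}` over `[0, T] × ℝ^D`. -/
noncomputable def parHolderNorm₂ {D : ℕ} (T α : ℝ) (u : ℝ → State D → ℝ) : ℝ≥0∞ :=
  parSupNorm T (timeDeriv T u) + parHolderSeminorm T α (timeDeriv T u)
    + parSupNorm T u + ∑ d, parSupNorm T (fun t => partialDeriv d (u t))
    + ∑ d, ∑ e, parSupNorm T (fun t y => hess (u t) y d e)
    + ∑ d, ∑ e, parHolderSeminorm T α (fun t y => hess (u t) y d e)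

/-- `u ∈ C^{1,2}([0, T] × ℝ^D)`: the derivatives `∂_t u`, `∂_y u`, `∂_{yy} u` exist on
`[0, T] × ℝ^D`, and they and `u` are jointly continuous there. -/
structure IsC12 {D : ℕ} (T : ℝ) (u : ℝ → State D → ℝ) : Prop where
  differentiable_time : ∀ t ∈ Set.Icc 0 T, ∀ y,
    DifferentiableWithinAt ℝ (fun s => u s y) (Set.Icc 0 T) t
  contDiff_space : ∀ t ∈ Set.Icc 0 T, ContDiff ℝ 2 (u t)
  continuousOn : ContinuousOn (fun p : ℝ × State D => u p.1 p.2) (Set.Icc 0 T ×ˢ Set.univ)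
  continuousOn_time :
    ContinuousOn (fun p : ℝ × State D => timeDeriv T u p.1 p.2) (Set.Icc 0 T ×ˢ Set.univ)
  continuousOn_grad :
    ContinuousOn (fun p : ℝ × State D => grad (u p.1) p.2) (Set.Icc 0 T ×ˢ Set.univ)
  continuousOn_hess :
    ContinuousOn (fun p : ℝ × State D => hess (u p.1) p.2) (Set.Icc 0 T ×ˢ Set.univ)

/-- `u ∈ C^{2+α}([0, T] × ℝ^D)`. -/
def MemParHolder₂ {D : ℕ} (T α : ℝ) (u : ℝ → State D → ℝ) : Prop :=
  IsC12 T u ∧ parHolderNorm₂ T α u < ∞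

/-! ### The volatility matrix -/

/-- The assumptions on `C : [0, 1] → ℝ^{D × D}`: it is `α`-Hölder continuous on `[0, 1]` and
`δlo |y|² ≤ yᵀ C(t) C(t)ᵀ y ≤ δhi |y|²` there. -/
structure IsVolatility {D : ℕ} (α δlo δhi : ℝ) (C : ℝ → Matrix (Fin D) (Fin D) ℝ) : Prop where
  holder : ∃ K : ℝ, ∀ s ∈ Set.Icc (0 : ℝ) 1, ∀ t ∈ Set.Icc (0 : ℝ) 1, ∀ i j,
    |C s i j - C t i j| ≤ K * |s - t| ^ α
  lower : ∀ t ∈ Set.Icc (0 : ℝ) 1, ∀ y : Fin D → ℝ,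
    δlo * (y ⬝ᵥ y) ≤ y ⬝ᵥ ((C t * (C t)ᵀ) *ᵥ y)
  upper : ∀ t ∈ Set.Icc (0 : ℝ) 1, ∀ y : Fin D → ℝ,
    y ⬝ᵥ ((C t * (C t)ᵀ) *ᵥ y) ≤ δhi * (y ⬝ᵥ y)

/-- `C̄`, the `D × N` matrix formed by the first `N` columns of `C`. -/
def firstColumns {D N : ℕ} (hN : N ≤ D) (C : Matrix (Fin D) (Fin D) ℝ) :
    Matrix (Fin D) (Fin N) ℝ :=
  C.submatrix id (Fin.castLE hN)

/-! ### The system -/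

/-- `τ_Σ = ∑ᵢ 1 / aᵢ`, the aggregate risk tolerance. -/
noncomputable def totalTolerance {I : ℕ} (a : Fin I → ℝ) : ℝ := ∑ i, 1 / a i

/-- The coupling function `λ(t, y) = τ_Σ⁻¹ C̄(t)ᵀ ∑ⱼ ∂_y u⁽ʲ⁾(t, y)`. -/
noncomputable def marketPriceOfRisk {D N I : ℕ} (hN : N ≤ D) (a : Fin I → ℝ)
    (C : ℝ → Matrix (Fin D) (Fin D) ℝ) (u : Fin I → ℝ → State D → ℝ) (t : ℝ) (y : State D) :
    Fin N → ℝ :=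
  (1 / totalTolerance a) • ((firstColumns hN (C t))ᵀ *ᵥ ∑ j, grad (u j t) y)

/-- The left-hand side of the `i`-th equation of the system, at the point `(t, y)`. -/
noncomputable def pdeOperator {D N I : ℕ} (hN : N ≤ D) (T : ℝ) (a : Fin I → ℝ)
    (C : ℝ → Matrix (Fin D) (Fin D) ℝ) (u : Fin I → ℝ → State D → ℝ) (i : Fin I)
    (t : ℝ) (y : State D) : ℝ :=
  let lam : Fin N → ℝ := marketPriceOfRisk hN a C u t y
  let p : Fin N → ℝ := (firstColumns hN (C t))ᵀ *ᵥ grad (u i t) y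
  let q : Fin D → ℝ := (C t)ᵀ *ᵥ grad (u i t) y
  timeDeriv T (u i) t y + 1 / (2 * a i) * (lam ⬝ᵥ lam) - lam ⬝ᵥ p
    + a i / 2 * (p ⬝ᵥ p - q ⬝ᵥ q)
    + 1 / 2 * (hess (u i t) y * (C t * (C t)ᵀ)).trace

/-- `u = (u⁽¹⁾, …, u⁽ᴵ⁾)` is a solution, of class `C^{2+α}([0, T] × ℝ^D)`, of the system with
terminal data `g`. -/
structure IsSolution {D N I : ℕ} (hN : N ≤ D) (T α : ℝ) (a : Fin I → ℝ)
    (C : ℝ → Matrix (Fin D) (Fin D) ℝ) (g : Fin I → State D → ℝ)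
    (u : Fin I → ℝ → State D → ℝ) : Prop where
  mem : ∀ i, MemParHolder₂ T α (u i)
  equation : ∀ i, ∀ t ∈ Set.Icc 0 T, ∀ y, pdeOperator hN T a C u i t y = 0
  terminal : ∀ i y, u i T y = g i y

end RadnerPDE

/-! Reversing time, w(s) = u(T − s), turns the system into a vector-valued forward equation ∂ₛw = ½
tr(A ∂²w) + B(∂w, ∂w) with A = CCᵀ: every term involving λ or a gradient is quadratic in the first
derivatives, with coefficients depending on time only (`pdeOperator_eq`, `quadForm_apply`). Since A
also depends on time only, the linear part is solved by convolution with the centred Gaussian law of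
covariance ∫ A. These operators U(r,s) are contractions for the sup norm, compose (`U_comp`) and
commute with spatial differentiation (`U_G`). By ellipticity their laws have, in every direction, a
Gaussian factor of variance lo·(s − r), whence ‖∂U(r,s)h‖ ≤ c (s − r)^(−1/2) ‖h‖ (`norm_G_le`).

Existence. The gradient p of a solution satisfies the closed equation p(s) = U(0,s)g' + ∫₀ˢ ∂U(r,s)
B(p,p) dr. For small T its right-hand side is a contraction on the curves bounded by ‖g'‖ + 1 with
spatial Lipschitz constant at most L₀ + 1, where L₀ is a Lipschitz constant of g'
(`exists_mildGrad_eq`). Carrying the Lipschitz bound replaces Schauder theory: the source B(p,p) is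
then Lipschitz in space, so ∂²U(r,s)B(p,p) is of order (s − r)^(−1/2) and its α-Hölder constant of
order (s − r)^(−1/2−α/2), both integrable because α < 1 (`norm_G₂_le_of_isHolder_one`,
`G₂_isHolder`). Hence the Duhamel integral can be differentiated twice and its Hessian is Hölder. A
Taylor expansion under the Gaussian law gives the right time derivative (`U_sub_gen_le`), and its
continuity makes it a two-sided one (`hasDerivWithinAt_mild`).

Uniqueness. For a solution in C^{2+α}, Hölder continuity of ∂ₜu makes the first-order time remainder
uniform in space, so the reversed solution is differentiable in time for the sup norm
(`IsSolution.isForwardSol`). Differentiating r ↦ U(r,s)w(r) shows that it is mild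
(`eq_mild_of_hasDerivWithinAt`). Two such gradients solve the same integral equation and agree on
successive short intervals (`mildGrad_unique`); this half needs no smallness of T. -/

namespace RadnerPDE

open MeasureTheory ProbabilityTheory

/-! ### Gaussian laws: additivity of covariances, moments, splitting off a one-dimensional factor.
-/

section Gaussian

open scoped MatrixOrder

variable {D : ℕ}

/-- The centred Gaussian law with covariance matrix `S`. -/
noncomputable def gaussLaw (S : Matrix (Fin D) (Fin D) ℝ) : Measure (State D) :=
  multivariateGaussian 0 S

instance (S : Matrix (Fin D) (Fin D) ℝ) : IsGaussian (gaussLaw S) := by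
  unfold gaussLaw; infer_instance

/-- Characteristic functions multiply and their quadratic exponents add. This is the source of the
evolution property `U_comp`. -/
lemma gaussLaw_conv {S R : Matrix (Fin D) (Fin D) ℝ} (hS : S.PosSemidef) (hR : R.PosSemidef) :
    gaussLaw S ∗ gaussLaw R = gaussLaw (S + R) := by
  refine Measure.ext_of_charFun ?_
  ext t
  simp only [gaussLaw]
  rw [charFun_conv, charFun_multivariateGaussian hS, charFun_multivariateGaussian hR,
    charFun_multivariateGaussian (hS.add hR), ← Complex.exp_add]
  congr 1
  simp [Matrix.add_mulVec]
  ring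

lemma gaussLaw_zero : gaussLaw (0 : Matrix (Fin D) (Fin D) ℝ) = Measure.dirac 0 := by
  refine Measure.ext_of_charFun ?_
  ext t
  simp only [gaussLaw]
  rw [charFun_multivariateGaussian Matrix.PosSemidef.zero]
  simp [charFun_apply]

lemma integral_coord_gaussLaw (S : Matrix (Fin D) (Fin D) ℝ) (i : Fin D) :
    ∫ z, z i ∂(gaussLaw S) = 0 := by
  have h := (EuclideanSpace.proj (𝕜 := ℝ) i).integral_comp_id_comm
    (μ := gaussLaw S) IsGaussian.integrable_id
  simpa [gaussLaw] using h

lemma integral_mul_coord_gaussLaw {S : Matrix (Fin D) (Fin D) ℝ} (hS : S.PosSemidef)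
    (i j : Fin D) : ∫ z, z i * z j ∂(gaussLaw S) = S i j := by
  rw [← covariance_eval_multivariateGaussian (μ := 0) hS i j, covariance]
  have h := integral_coord_gaussLaw S
  simp only [gaussLaw] at h ⊢
  simp [h]

/-- The absolute moment of order `β` of the standard Gaussian law. -/
noncomputable def stdMoment (D : ℕ) (β : ℝ) : ℝ := ∫ z, ‖z‖ ^ β ∂(stdGaussian (State D))

lemma stdMoment_nonneg (D : ℕ) (β : ℝ) : 0 ≤ stdMoment D β :=
  integral_nonneg fun _ => by positivity

lemma integrable_norm_rpow (μ : Measure (State D)) [IsGaussian μ] {β : ℝ} (hβ : 0 ≤ β) :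
    Integrable (fun z => ‖z‖ ^ β) μ := by
  have h := (IsGaussian.memLp_id μ (ENNReal.ofReal β) ENNReal.ofReal_ne_top)
  have h2 := h.integrable_norm_rpow'
  simpa [ENNReal.toReal_ofReal hβ] using h2

/-- The square root is self-adjoint, so ‖√S x‖² = xᵀSx. -/
lemma norm_sqrt_apply_le {S : Matrix (Fin D) (Fin D) ℝ} (hS : S.PosSemidef) {K : ℝ}
    (hK : ∀ y : Fin D → ℝ, y ⬝ᵥ (S *ᵥ y) ≤ K * (y ⬝ᵥ y)) (x : State D) :
    ‖Matrix.toEuclideanCLM (𝕜 := ℝ) (CFC.sqrt S) x‖ ^ 2 ≤ K * ‖x‖ ^ 2 := by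
  have h1 : ‖Matrix.toEuclideanCLM (𝕜 := ℝ) (CFC.sqrt S) x‖ ^ 2 = x.ofLp ⬝ᵥ (S *ᵥ x.ofLp) := by
    rw [← real_inner_self_eq_norm_sq, ← ContinuousLinearMap.adjoint_inner_right,
      IsSelfAdjoint.adjoint_eq ((CFC.sqrt_nonneg S).isSelfAdjoint.map _),
      ← ContinuousLinearMap.comp_apply, ← ContinuousLinearMap.mul_def, ← map_mul,
      CFC.sqrt_mul_sqrt_self _ hS.nonneg, Matrix.inner_toEuclideanCLM]
  rw [h1, EuclideanSpace.real_norm_sq_eq]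
  simpa [dotProduct, sq] using hK x.ofLp

/-- The law is the image of the standard Gaussian under √S, whose norm is at most √K. With K
proportional to s − r this gives the parabolic scaling of all moments. -/
lemma integral_norm_rpow_gaussLaw_le {S : Matrix (Fin D) (Fin D) ℝ} (hS : S.PosSemidef) {K : ℝ}
    (hK0 : 0 ≤ K)
    (hK : ∀ y : Fin D → ℝ, y ⬝ᵥ (S *ᵥ y) ≤ K * (y ⬝ᵥ y)) {β : ℝ} (hβ : 0 ≤ β) :
    ∫ z, ‖z‖ ^ β ∂(gaussLaw S) ≤ K ^ (β / 2) * stdMoment D β := by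
  rw [gaussLaw, multivariateGaussian, integral_map (by fun_prop)
    (Measurable.aestronglyMeasurable (by fun_prop)), stdMoment, ← integral_const_mul]
  simp only [zero_add]
  refine integral_mono_of_nonneg (.of_forall fun _ => by positivity)
    ((integrable_norm_rpow _ hβ).const_mul _) (.of_forall fun x => ?_)
  have h1 := norm_sqrt_apply_le hS hK x
  have h2 : ‖Matrix.toEuclideanCLM (𝕜 := ℝ) (CFC.sqrt S) x‖ ≤ K ^ (1 / 2 : ℝ) * ‖x‖ := by
    rw [← Real.sqrt_eq_rpow]
    refine le_of_sq_le_sq ?_ (by positivity)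
    rwa [mul_pow, Real.sq_sqrt hK0]
  calc _ ≤ (K ^ (1 / 2 : ℝ) * ‖x‖) ^ β := Real.rpow_le_rpow (norm_nonneg _) h2 hβ
    _ = _ := by
      rw [Real.mul_rpow (by positivity) (by positivity), ← Real.rpow_mul hK0]
      congr 2; ring

lemma posSemidef_vecMulVec (v : Fin D → ℝ) : (Matrix.vecMulVec v v).PosSemidef := by
  simpa using Matrix.posSemidef_vecMulVec_self_star v

lemma gaussLaw_vecMulVec (σ : ℝ) (v : State D) :
    gaussLaw (σ ^ 2 • Matrix.vecMulVec v.ofLp v.ofLp) =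
      (gaussianReal 0 1).map (fun t : ℝ => (σ * t) • v) := by
  have : IsProbabilityMeasure ((gaussianReal 0 1).map (fun t : ℝ => (σ * t) • v)) :=
    Measure.isProbabilityMeasure_map (by fun_prop)
  refine Measure.ext_of_charFun ?_
  ext t
  rw [gaussLaw, charFun_multivariateGaussian ((posSemidef_vecMulVec _).smul (sq_nonneg σ)),
    charFun_apply, integral_map (by fun_prop) (Measurable.aestronglyMeasurable (by fun_prop))]
  have h := charFun_gaussianReal (μ := 0) (v := 1) (σ * inner ℝ v t)
  rw [charFun_apply_real] at h
  simp only [inner_smul_left]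
  simp only [conj_trivial]
  have e : ∀ x : ℝ, ((σ * x * inner ℝ v t : ℝ) : ℂ) = ((σ * inner ℝ v t : ℝ) : ℂ) * (x : ℂ) := by
    intro x; push_cast; ring
  simp only [e]
  rw [h]
  congr 1
  have e2 : (inner ℝ v t : ℝ) = t.ofLp ⬝ᵥ v.ofLp := by
    simp [PiLp.inner_apply, dotProduct, mul_comm]
  rw [e2]
  simp [Matrix.smul_mulVec, Matrix.vecMulVec_mulVec, dotProduct_comm]
  ring

/-- By Cauchy–Schwarz σ² vvᵀ ≤ σ² Id ≤ S, so S − σ² vvᵀ is still a covariance and additivity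
applies. Smoothing in direction v thereby becomes a one-dimensional matter. -/
lemma gaussLaw_eq_conv {S : Matrix (Fin D) (Fin D) ℝ} (hS : S.PosSemidef) {σ : ℝ}
    (hσ : ∀ y : Fin D → ℝ, σ ^ 2 * (y ⬝ᵥ y) ≤ y ⬝ᵥ (S *ᵥ y)) {v : State D} (hv : ‖v‖ = 1) :
    gaussLaw S = gaussLaw (S - σ ^ 2 • Matrix.vecMulVec v.ofLp v.ofLp) ∗
      (gaussianReal 0 1).map (fun t : ℝ => (σ * t) • v) := by
  have h1 : (S - σ ^ 2 • Matrix.vecMulVec v.ofLp v.ofLp).PosSemidef := by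
    refine Matrix.PosSemidef.of_dotProduct_mulVec_nonneg ?_ fun y => ?_
    · exact hS.1.sub ((posSemidef_vecMulVec _).smul (sq_nonneg σ)).1
    · have h2 := hσ y
      have h3 : (v.ofLp ⬝ᵥ y) ^ 2 ≤ y ⬝ᵥ y := by
        have := abs_real_inner_le_norm v (WithLp.toLp 2 y)
        rw [hv, one_mul] at this
        have h4 := (sq_le_sq₀ (abs_nonneg _) (norm_nonneg _)).2 this
        rw [sq_abs, EuclideanSpace.real_norm_sq_eq] at h4
        simpa [PiLp.inner_apply, dotProduct, mul_comm, sq] using h4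
      simp [Matrix.sub_mulVec, Matrix.smul_mulVec, Matrix.vecMulVec_mulVec, dotProduct_sub]
      rw [dotProduct_comm y v.ofLp]
      nlinarith [mul_le_mul_of_nonneg_left h3 (sq_nonneg σ)]
  rw [← gaussLaw_vecMulVec, gaussLaw_conv h1 ((posSemidef_vecMulVec _).smul (sq_nonneg σ)),
    sub_add_cancel]

end Gaussian

end RadnerPDE

namespace RadnerPDE

open MeasureTheory ProbabilityTheory Filter Topology
open scoped BoundedContinuousFunction

set_option linter.unusedSectionVars false

/-! ### Averaging a bounded continuous function against a probability measure. -/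

section Averaging

variable {D : ℕ} {W : Type*} [NormedAddCommGroup W] [NormedSpace ℝ W]

/-- `h` is `α`-Hölder continuous with constant `K`. -/
def IsHolder (α K : ℝ) (h : State D → W) : Prop :=
  ∀ x y, ‖h x - h y‖ ≤ K * ‖x - y‖ ^ α

lemma IsHolder.mono {α K L : ℝ} {h : State D → W} (hh : IsHolder α K h) (hKL : K ≤ L) :
    IsHolder α L h := fun x y => (hh x y).trans (by gcongr)

lemma isHolder_one_iff {K : ℝ} {h : State D → W} :
    IsHolder 1 K h ↔ ∀ x y, ‖h x - h y‖ ≤ K * ‖x - y‖ := by simp [IsHolder]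

lemma IsHolder.add {α K L : ℝ} {h k : State D → W} (hh : IsHolder α K h) (hk : IsHolder α L k) :
    IsHolder α (K + L) (fun x => h x + k x) := fun x y => by
  rw [add_sub_add_comm, add_mul]
  exact (norm_add_le _ _).trans (add_le_add (hh x y) (hk x y))

/-- A function bounded by `M` and Lipschitz with constant `L` is `α`-Hölder. -/
lemma isHolder_of_bound_of_lipschitz {α M L : ℝ} (hα0 : 0 ≤ α) (hα1 : α ≤ 1) (hM : 0 ≤ M)
    (hL : 0 ≤ L) {h : State D → W} (hb : ∀ x, ‖h x‖ ≤ M) (hh : IsHolder 1 L h) :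
    IsHolder α ((2 * M) ^ (1 - α) * L ^ α) h := fun x y => by
  have h1 : ‖h x - h y‖ ≤ 2 * M := (norm_sub_le _ _).trans (by linarith [hb x, hb y])
  have h2 : ‖h x - h y‖ ≤ L * ‖x - y‖ := isHolder_one_iff.1 hh x y
  calc ‖h x - h y‖ = ‖h x - h y‖ ^ ((1 - α) + α) := by simp
    _ = ‖h x - h y‖ ^ (1 - α) * ‖h x - h y‖ ^ α :=
      Real.rpow_add_of_nonneg (norm_nonneg _) (by linarith) hα0
    _ ≤ (2 * M) ^ (1 - α) * (L * ‖x - y‖) ^ α :=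
      mul_le_mul (Real.rpow_le_rpow (norm_nonneg _) h1 (by linarith))
        (Real.rpow_le_rpow (norm_nonneg _) h2 hα0) (by positivity) (by positivity)
    _ = _ := by rw [Real.mul_rpow hL (norm_nonneg _), mul_assoc]

variable (D W) in
/-- The space of continuous linear maps `ℝ^D → W`, the values of first derivatives. -/
def Jet : Type _ := State D →L[ℝ] W

noncomputable instance : NormedAddCommGroup (Jet D W) :=
  inferInstanceAs (NormedAddCommGroup (State D →L[ℝ] W))

noncomputable instance : NormedSpace ℝ (Jet D W) :=
  inferInstanceAs (NormedSpace ℝ (State D →L[ℝ] W))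

instance [CompleteSpace W] : CompleteSpace (Jet D W) :=
  inferInstanceAs (CompleteSpace (State D →L[ℝ] W))

instance : FunLike (Jet D W) (State D) W := inferInstanceAs (FunLike (State D →L[ℝ] W) (State D) W)

variable (μ : Measure (State D)) [IsProbabilityMeasure μ]

lemma integrable_bcf_add (h : State D →ᵇ W) (x : State D) :
    Integrable (fun z => h (x + z)) μ :=
  ⟨(h.continuous.comp (continuous_const.add continuous_id)).aestronglyMeasurable,
    HasFiniteIntegral.of_bounded (C := ‖h‖) (.of_forall fun _ => h.norm_coe_le_norm _)⟩

lemma norm_integral_bcf_add_le (h : State D →ᵇ W) (x : State D) :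
    ‖∫ z, h (x + z) ∂μ‖ ≤ ‖h‖ := by
  have := norm_integral_le_of_norm_le_const (μ := μ) (f := fun z => h (x + z)) (C := ‖h‖)
    (.of_forall fun _ => h.norm_coe_le_norm _)
  simpa using this

lemma continuous_integral_bcf_add (h : State D →ᵇ W) :
    Continuous fun x => ∫ z, h (x + z) ∂μ :=
  continuous_of_dominated (bound := fun _ => ‖h‖)
    (fun x => (integrable_bcf_add μ h x).1)
    (fun _ => .of_forall fun _ => h.norm_coe_le_norm _) (integrable_const _)
    (.of_forall fun _ => h.continuous.comp (continuous_id.add continuous_const))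

/-- The averaging operator `h ↦ (x ↦ ∫ h (x + z) dμ(z))` on bounded continuous functions. -/
noncomputable def avg : (State D →ᵇ W) →L[ℝ] (State D →ᵇ W) :=
  LinearMap.mkContinuous
    { toFun := fun h => BoundedContinuousFunction.ofNormedAddCommGroup
        (fun x => ∫ z, h (x + z) ∂μ) (continuous_integral_bcf_add μ h) ‖h‖
        (norm_integral_bcf_add_le μ h)
      map_add' := fun h k => by
        ext x
        simpa using integral_add (integrable_bcf_add μ h x) (integrable_bcf_add μ k x)
      map_smul' := fun c h => by
        ext x
        simpa using integral_smul c fun z => h (x + z) }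
    1 fun h => by
      rw [one_mul]
      exact (BoundedContinuousFunction.norm_le (norm_nonneg _)).2 (norm_integral_bcf_add_le μ h)

lemma avg_apply (h : State D →ᵇ W) (x : State D) : avg μ h x = ∫ z, h (x + z) ∂μ := rfl

lemma norm_avg_le (h : State D →ᵇ W) : ‖avg μ h‖ ≤ ‖h‖ :=
  (BoundedContinuousFunction.norm_le (norm_nonneg _)).2 (norm_integral_bcf_add_le μ h)

lemma avg_conv (ν : Measure (State D)) [IsProbabilityMeasure ν] (h : State D →ᵇ W) :
    avg (μ ∗ ν) h = avg μ (avg ν h) := by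
  ext x
  simp only [avg_apply]
  rw [integral_conv (integrable_bcf_add _ h x)]
  simp only [add_assoc]

lemma avg_dirac_zero [CompleteSpace W] (h : State D →ᵇ W) : avg (Measure.dirac 0) h = h := by
  ext x
  simp [avg_apply]

lemma avg_isHolder {α K : ℝ} {h : State D →ᵇ W} (hh : IsHolder α K h) :
    IsHolder α K (avg μ h) := fun x y => by
  rw [avg_apply, avg_apply, ← integral_sub (integrable_bcf_add _ h x) (integrable_bcf_add _ h y)]
  have := norm_integral_le_of_norm_le_const (μ := μ) (f := fun z => h (x + z) - h (y + z))
    (C := K * ‖x - y‖ ^ α) (.of_forall fun z => by simpa using hh (x + z) (y + z))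
  simpa using this

/-- The difference at x is the mean of h(x + z) − h(x), each of norm at most K‖z‖^α. -/
lemma norm_avg_sub_le [CompleteSpace W] {α K : ℝ} (hK : 0 ≤ K) {h : State D →ᵇ W}
    (hh : IsHolder α K h) (hμ : Integrable (fun z => ‖z‖ ^ α) μ) :
    ‖avg μ h - h‖ ≤ K * ∫ z, ‖z‖ ^ α ∂μ := by
  refine (BoundedContinuousFunction.norm_le
    (mul_nonneg hK (integral_nonneg fun _ => by positivity))).2 fun x => ?_
  have h1 : (avg μ h - h) x = ∫ z, (h (x + z) - h x) ∂μ := by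
    rw [integral_sub (integrable_bcf_add _ h x) (integrable_const _)]
    simp [avg_apply]
  rw [h1, ← integral_const_mul]
  exact norm_integral_le_of_norm_le (hμ.const_mul K) (.of_forall fun z => by
    simpa using hh (x + z) x)

lemma avg_hasFDerivAt {h : State D →ᵇ W} {h' : State D →ᵇ Jet D W}
    (hh : ∀ x, HasFDerivAt h (h' x) x) (x : State D) :
    HasFDerivAt (avg μ h) (avg μ h' x) x := by
  refine hasFDerivAt_integral_of_dominated_of_fderiv_le (μ := μ) (s := Set.univ)
    (F := fun x z => h (x + z)) (F' := fun x z => h' (x + z)) (bound := fun _ => ‖h'‖)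
    univ_mem (.of_forall fun x => (integrable_bcf_add μ h x).1) (integrable_bcf_add μ h x)
    (integrable_bcf_add μ h' x).1 (.of_forall fun _ _ _ => h'.norm_coe_le_norm _)
    (integrable_const _) (.of_forall fun z y _ => ?_)
  exact (hasFDerivAt_comp_add_right z).2 (hh (y + z))

end Averaging

/-! ### Smoothing by a one-dimensional Gaussian. -/

section OneDim

variable {W : Type*} [NormedAddCommGroup W] [NormedSpace ℝ W] [CompleteSpace W]

lemma hasDerivAt_gaussianPDFReal (t : ℝ) :
    HasDerivAt (gaussianPDFReal 0 1) (-(t * gaussianPDFReal 0 1 t)) t := by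
  have h : gaussianPDFReal 0 1 = fun x : ℝ => (√(2 * Real.pi))⁻¹ * Real.exp (-x ^ 2 / 2) := by
    ext x; simp [gaussianPDFReal]
  rw [h]
  have h1 : HasDerivAt (fun x : ℝ => -x ^ 2 / 2) (-t) t :=
    (((hasDerivAt_pow 2 t).neg).div_const 2).congr_deriv (by simp; ring)
  exact ((h1.exp).const_mul ((√(2 * Real.pi))⁻¹)).congr_deriv (by ring)

lemma integrable_smul_gaussianPDFReal {φ : ℝ → W} {M : ℝ} (hφ : Continuous φ)
    (hM : ∀ t, ‖φ t‖ ≤ M) : Integrable (fun t => gaussianPDFReal 0 1 t • φ t) := by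
  refine Integrable.mono' ((integrable_gaussianPDFReal 0 1).mul_const M)
    ((integrable_gaussianPDFReal 0 1).1.smul hφ.aestronglyMeasurable) (.of_forall fun t => ?_)
  rw [norm_smul, Real.norm_of_nonneg (gaussianPDFReal_nonneg _ _ _)]
  exact mul_le_mul_of_nonneg_left (hM t) (gaussianPDFReal_nonneg _ _ _)

lemma integrable_id_mul_gaussianPDFReal :
    Integrable (fun t : ℝ => t * gaussianPDFReal 0 1 t) := by
  have h := (integrable_mul_exp_neg_mul_sq (b := 1 / 2) (by norm_num)).const_mul
    ((√(2 * Real.pi))⁻¹)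
  refine h.congr (.of_forall fun t => ?_)
  simp only [gaussianPDFReal]
  simp
  ring_nf

/-- Gaussian integration by parts. -/
lemma integral_deriv_gaussianReal {φ φ' : ℝ → W} {M M' : ℝ}
    (hφ : ∀ t, HasDerivAt φ (φ' t) t) (hφ' : Continuous φ') (hM : ∀ t, ‖φ t‖ ≤ M)
    (hM' : ∀ t, ‖φ' t‖ ≤ M') :
    ∫ t, φ' t ∂(gaussianReal 0 1) = ∫ t, t • φ t ∂(gaussianReal 0 1) := by
  have hc : Continuous φ := continuous_iff_continuousAt.2 fun t => (hφ t).continuousAt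
  rw [integral_gaussianReal_eq_integral_smul one_ne_zero,
    integral_gaussianReal_eq_integral_smul one_ne_zero]
  have hi : Integrable (fun t : ℝ => (-(t * gaussianPDFReal 0 1 t)) • φ t) := by
    refine Integrable.mono' (integrable_id_mul_gaussianPDFReal.norm.mul_const M)
      (integrable_id_mul_gaussianPDFReal.1.neg.smul hc.aestronglyMeasurable)
      (.of_forall fun t => ?_)
    rw [norm_smul, norm_neg]
    exact mul_le_mul_of_nonneg_left (hM t) (norm_nonneg _)
  have := integral_bilinear_hasDerivAt_right_eq_neg_left_of_integrable
    (L := ContinuousLinearMap.lsmul ℝ ℝ) (u := gaussianPDFReal 0 1) (v := φ) (v' := φ')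
    (fun t _ => hasDerivAt_gaussianPDFReal t) (fun t _ => hφ t)
    (integrable_smul_gaussianPDFReal hφ' hM') hi (integrable_smul_gaussianPDFReal hc hM)
  simp only [ContinuousLinearMap.lsmul_apply] at this
  rw [this, ← integral_neg]
  refine integral_congr_ae (.of_forall fun t => ?_)
  simp [smul_smul, mul_comm]

lemma integral_abs_gaussianReal_le : ∫ t, |t| ∂(gaussianReal 0 1) ≤ 1 := by
  have h2 : ∫ t, t ^ 2 ∂(gaussianReal 0 1) = 1 := by
    have := variance_fun_id_gaussianReal (μ := 0) (v := 1)
    rw [variance_eq_integral (by fun_prop)] at this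
    simpa using this
  have hi : Integrable (fun t : ℝ => t ^ 2) (gaussianReal 0 1) :=
    (memLp_id_gaussianReal (μ := 0) (v := 1) 2).integrable_sq
  calc ∫ t, |t| ∂(gaussianReal 0 1) ≤ ∫ t, (1 + t ^ 2) / 2 ∂(gaussianReal 0 1) := by
        refine integral_mono_of_nonneg (.of_forall fun _ => abs_nonneg _)
          (((integrable_const _).add hi).div_const 2) (.of_forall fun t => ?_)
        have := sq_nonneg (|t| - 1)
        simp only
        nlinarith [sq_abs t]
    _ = 1 := by
        rw [integral_div, integral_add (integrable_const _) hi, h2]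
        simp

/-- Integration by parts trades the derivative for the weight t, and E|t| ≤ 1. The point is that M'
is absent from the bound, which therefore survives approximation. -/
lemma norm_integral_deriv_gaussianReal_le {φ φ' : ℝ → W} {M M' : ℝ}
    (hφ : ∀ t, HasDerivAt φ (φ' t) t) (hφ' : Continuous φ') (hM : ∀ t, ‖φ t‖ ≤ M)
    (hM' : ∀ t, ‖φ' t‖ ≤ M') : ‖∫ t, φ' t ∂(gaussianReal 0 1)‖ ≤ M := by
  have hM0 : 0 ≤ M := (norm_nonneg _).trans (hM 0)
  have hi : Integrable (fun t : ℝ => |t|) (gaussianReal 0 1) :=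
    ((memLp_id_gaussianReal (μ := 0) (v := 1) 1).integrable le_rfl).abs
  rw [integral_deriv_gaussianReal hφ hφ' hM hM']
  calc _ ≤ ∫ t, M * |t| ∂(gaussianReal 0 1) :=
        norm_integral_le_of_norm_le (hi.const_mul M) (.of_forall fun t => by
          rw [norm_smul, mul_comm, Real.norm_eq_abs]
          exact mul_le_mul_of_nonneg_right (hM t) (abs_nonneg _))
    _ ≤ M := by
        rw [integral_const_mul]
        exact mul_le_of_le_one_right hM0 integral_abs_gaussianReal_le

lemma integrable_comp_gaussianReal {H : ℝ → W} {M : ℝ} (hH : Continuous H)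
    (hM : ∀ t, ‖H t‖ ≤ M) (a σ : ℝ) :
    Integrable (fun t => H (a + σ * t)) (gaussianReal 0 1) :=
  ⟨(hH.comp (by fun_prop)).aestronglyMeasurable,
    HasFiniteIntegral.of_bounded (C := M) (.of_forall fun _ => hM _)⟩

/-- The derivative in x of the average of H(x + σt) is the average of H'(x + σt), and σH'(x + σt) is
a derivative in t; so it is at most M/σ, and the mean value inequality finishes. -/
lemma norm_integral_sub_le_of_hasDerivAt {H H' : ℝ → W} {M M' σ : ℝ} (hσ : 0 < σ)
    (hH : ∀ t, HasDerivAt H (H' t) t) (hH' : Continuous H') (hM : ∀ t, ‖H t‖ ≤ M)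
    (hM' : ∀ t, ‖H' t‖ ≤ M') (a b : ℝ) :
    ‖∫ t, H (a + σ * t) ∂(gaussianReal 0 1) - ∫ t, H (b + σ * t) ∂(gaussianReal 0 1)‖
      ≤ M / σ * |a - b| := by
  have hc : Continuous H := continuous_iff_continuousAt.2 fun t => (hH t).continuousAt
  have hd : ∀ x, HasDerivAt (fun x => ∫ t, H (x + σ * t) ∂(gaussianReal 0 1))
      (∫ t, H' (x + σ * t) ∂(gaussianReal 0 1)) x := fun x =>
    (hasDerivAt_integral_of_dominated_loc_of_deriv_le (F := fun x t => H (x + σ * t))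
      (F' := fun x t => H' (x + σ * t)) (bound := fun _ => M') (s := Set.univ) univ_mem
      (.of_forall fun x => (integrable_comp_gaussianReal hc hM x σ).1)
      (integrable_comp_gaussianReal hc hM x σ) (integrable_comp_gaussianReal hH' hM' x σ).1
      (.of_forall fun t y _ => hM' _) (integrable_const _)
      (.of_forall fun t y _ => (hH (y + σ * t)).comp_add_const y (σ * t))).2
  have hb : ∀ x, ‖∫ t, H' (x + σ * t) ∂(gaussianReal 0 1)‖ ≤ M / σ := fun x => by
    have h1 : ∀ t, HasDerivAt (fun t => H (x + σ * t)) (σ • H' (x + σ * t)) t := fun t => by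
      have h2 : HasDerivAt (fun t => x + σ * t) σ t := by
        simpa using ((hasDerivAt_id t).const_mul σ).const_add x
      exact (hH (x + σ * t)).scomp t h2
    have h3 := norm_integral_deriv_gaussianReal_le (M := M) (M' := σ * M') h1
      ((hH'.comp (by fun_prop)).const_smul σ) (fun _ => hM _) (fun t => by
        rw [norm_smul, Real.norm_of_nonneg hσ.le]
        exact mul_le_mul_of_nonneg_left (hM' _) hσ.le)
    rw [integral_smul, norm_smul, Real.norm_of_nonneg hσ.le] at h3
    rwa [le_div_iff₀' hσ]
  have := convex_univ.norm_image_sub_le_of_norm_hasDerivWithin_le (f := fun x =>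
    ∫ t, H (x + σ * t) ∂(gaussianReal 0 1)) (fun x _ => (hd x).hasDerivWithinAt)
    (fun x _ => hb x) (Set.mem_univ b) (Set.mem_univ a)
  simpa using this

/-- Gaussian averages of a bounded continuous function are Lipschitz in the mean. -/
lemma norm_integral_gaussianReal_sub_le {H : ℝ → W} {M σ : ℝ} (hσ : 0 < σ)
    (hH : Continuous H) (hM : ∀ t, ‖H t‖ ≤ M) (a b : ℝ) :
    ‖∫ t, H (a + σ * t) ∂(gaussianReal 0 1) - ∫ t, H (b + σ * t) ∂(gaussianReal 0 1)‖
      ≤ M / σ * |a - b| := by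
  -- Moving averages of H over intervals of length 1/(n + 1): continuously differentiable, still
  -- bounded by M, and pointwise convergent to H. Their derivatives grow with n, which is harmless
  -- because the differentiable case has a bound free of M'.
  set S : ℕ → ℝ → W := fun n y => ((n : ℝ) + 1) • ∫ u in y..(y + ((n : ℝ) + 1)⁻¹), H u with hS
  have hprim : ∀ y, HasDerivAt (fun y => ∫ u in (0 : ℝ)..y, H u) (H y) y := fun y =>
    intervalIntegral.integral_hasDerivAt_right (hH.intervalIntegrable _ _)
      hH.stronglyMeasurable.stronglyMeasurableAtFilter hH.continuousAt
  have hSeq : ∀ n y, S n y = ((n : ℝ) + 1) •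
      ((∫ u in (0 : ℝ)..(y + ((n : ℝ) + 1)⁻¹), H u) - ∫ u in (0 : ℝ)..y, H u) := fun n y => by
    rw [intervalIntegral.integral_interval_sub_left (hH.intervalIntegrable _ _)
      (hH.intervalIntegrable _ _)]
  have hSd : ∀ n y, HasDerivAt (S n)
      (((n : ℝ) + 1) • (H (y + ((n : ℝ) + 1)⁻¹) - H y)) y := fun n y => by
    rw [funext (hSeq n)]
    exact (((hprim _).comp_add_const y _).sub (hprim y)).const_smul _
  have hpos : ∀ n : ℕ, (0 : ℝ) < (n : ℝ) + 1 := fun n => by positivity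
  have hSb : ∀ n y, ‖S n y‖ ≤ M := fun n y => by
    have := intervalIntegral.norm_integral_le_of_norm_le_const (f := H) (C := M)
      (a := y) (b := y + ((n : ℝ) + 1)⁻¹) fun u _ => hM u
    rw [hS, norm_smul, Real.norm_of_nonneg (hpos n).le]
    calc _ ≤ ((n : ℝ) + 1) * (M * |y + ((n : ℝ) + 1)⁻¹ - y|) := by gcongr
      _ = M := by
        rw [add_sub_cancel_left, abs_of_pos (inv_pos.2 (hpos n))]
        field_simp
  have hSt : ∀ y, Tendsto (fun n => S n y) atTop (𝓝 (H y)) := fun y => by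
    have h1 := (hprim y).tendsto_slope_zero_right
    have h2 : Tendsto (fun n : ℕ => ((n : ℝ) + 1)⁻¹) atTop (𝓝[>] 0) := by
      refine tendsto_nhdsWithin_iff.2 ⟨?_, .of_forall fun n => inv_pos.2 (hpos n)⟩
      simpa [one_div] using tendsto_one_div_add_atTop_nhds_zero_nat (𝕜 := ℝ)
    refine (h1.comp h2).congr fun n => ?_
    simp [hSeq]
  have hc : ∀ n, Continuous (S n) := fun n =>
    continuous_iff_continuousAt.2 fun t => (hSd n t).continuousAt
  have hlim : ∀ x, Tendsto (fun n => ∫ t, S n (x + σ * t) ∂(gaussianReal 0 1)) atTop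
      (𝓝 (∫ t, H (x + σ * t) ∂(gaussianReal 0 1))) := fun x =>
    tendsto_integral_of_dominated_convergence (fun _ => M)
      (fun n => (integrable_comp_gaussianReal (hc n) (hSb n) x σ).1) (integrable_const _)
      (fun n => .of_forall fun t => hSb n _) (.of_forall fun t => hSt _)
  refine le_of_tendsto ((hlim a).sub (hlim b)).norm (.of_forall fun n => ?_)
  refine norm_integral_sub_le_of_hasDerivAt (M' := ((n : ℝ) + 1) * (2 * M)) hσ (hSd n)
    (by fun_prop) (hSb n) (fun t => ?_) a b
  rw [norm_smul, Real.norm_of_nonneg (hpos n).le]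
  gcongr
  exact (norm_sub_le _ _).trans (by linarith [hM (t + ((n : ℝ) + 1)⁻¹), hM t])

end OneDim

/-! ### Smoothing by measures with a Gaussian factor in every direction. -/

section Smoothing

variable {D : ℕ} {W : Type*} [NormedAddCommGroup W] [NormedSpace ℝ W] [CompleteSpace W]

/-- In each direction, `μ` has a Gaussian factor with standard deviation `σ`. -/
def HasGaussianFactor (σ : ℝ) (μ : Measure (State D)) : Prop :=
  ∀ v : State D, ‖v‖ = 1 → ∃ ν : Measure (State D), IsProbabilityMeasure ν ∧
    μ = ν ∗ (gaussianReal 0 1).map (fun t : ℝ => (σ * t) • v)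

/-- Split off the Gaussian factor in the direction of x − y: its average already satisfies the
one-dimensional Lipschitz bound between translates of x and y, and averaging over the remaining
factor ν preserves it. -/
lemma avg_isHolder_one {σ : ℝ} (hσ : 0 < σ) {μ : Measure (State D)} [IsProbabilityMeasure μ]
    (hμ : HasGaussianFactor σ μ) (h : State D →ᵇ W) : IsHolder 1 (‖h‖ / σ) (avg μ h) := by
  refine isHolder_one_iff.2 fun x y => ?_
  rcases eq_or_ne x y with rfl | hxy
  · simp
  have hn : ‖x - y‖ ≠ 0 := norm_ne_zero_iff.2 (sub_ne_zero.2 hxy)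
  set v : State D := ‖x - y‖⁻¹ • (x - y) with hv
  have hv1 : ‖v‖ = 1 := by rw [hv, norm_smul, norm_inv, norm_norm, inv_mul_cancel₀ hn]
  have hxv : x = y + ‖x - y‖ • v := by rw [hv, smul_smul, mul_inv_cancel₀ hn]; simp
  obtain ⟨ν, hν, e⟩ := hμ v hv1
  set γ := (gaussianReal 0 1).map (fun t : ℝ => (σ * t) • v) with hγ
  have : IsProbabilityMeasure γ := Measure.isProbabilityMeasure_map (by fun_prop)
  have hγm : ∀ x, avg γ h x = ∫ t, h (x + (σ * t) • v) ∂(gaussianReal 0 1) := fun x => by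
    rw [avg_apply, hγ]
    exact integral_map (f := fun z => h (x + z)) (by fun_prop)
      (h.continuous.comp (by fun_prop)).aestronglyMeasurable
  have hkey : ∀ z, ‖avg γ h (x + z) - avg γ h (y + z)‖ ≤ ‖h‖ / σ * ‖x - y‖ := fun z => by
    have h1 := norm_integral_gaussianReal_sub_le (H := fun u : ℝ => h (y + z + u • v))
      (M := ‖h‖) hσ (h.continuous.comp (by fun_prop)) (fun t => h.norm_coe_le_norm _) ‖x - y‖ 0
    rw [sub_zero, abs_norm] at h1
    convert h1 using 3
    · rw [hγm]
      refine integral_congr_ae (.of_forall fun t => ?_)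
      have : x + z + (σ * t) • v = y + z + (‖x - y‖ + σ * t) • v := by
        conv_lhs => rw [hxv]
        rw [add_smul]; abel
      simp only [this]
    · simp [hγm]
  have h2 : ∀ x, avg μ h x = ∫ z, avg γ h (x + z) ∂ν := fun x => by
    have : avg μ h x = avg (ν ∗ γ) h x := by simp only [avg_apply, e]
    rw [this, avg_conv, avg_apply]
  rw [h2, h2, ← integral_sub (integrable_bcf_add _ _ x) (integrable_bcf_add _ _ y)]
  have := norm_integral_le_of_norm_le_const (μ := ν)
    (f := fun z => avg γ h (x + z) - avg γ h (y + z)) (.of_forall hkey)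
  simpa using this

lemma norm_le_of_isHolder_one {h : State D → W} {h' : State D →ᵇ Jet D W} {L : ℝ}
    (hL : 0 ≤ L) (hh : ∀ x, HasFDerivAt h (h' x) x) (hLip : IsHolder 1 L h) : ‖h'‖ ≤ L := by
  refine (BoundedContinuousFunction.norm_le hL).2 fun x => ?_
  have : LipschitzWith ⟨L, hL⟩ h := LipschitzWith.of_dist_le_mul fun x y => by
    rw [dist_eq_norm, dist_eq_norm]
    exact isHolder_one_iff.1 hLip x y
  rw [← (hh x).fderiv]
  exact norm_fderiv_le_of_lipschitz ℝ this

/-- Lipschitz functions are uniform limits of `C¹` functions with bounded derivative. -/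
lemma exists_hasFDerivAt_norm_sub_le (h : State D →ᵇ W) {L : ℝ} (hL : 0 ≤ L)
    (hh : IsHolder 1 L h) {ε : ℝ} (hε : 0 < ε) :
    ∃ (k : State D →ᵇ W) (k' : State D →ᵇ Jet D W),
      (∀ x, HasFDerivAt k (k' x) x) ∧ ‖k - h‖ ≤ ε := by
  have hL1 : 0 < L + 1 := by linarith
  have hr : 0 < ε / (L + 1) := by positivity
  -- On the support of the bump h varies by at most L·ε/(L + 1) ≤ ε; the summand 1 allows L = 0.
  let φ : ContDiffBump (0 : State D) := ⟨ε / (L + 1) / 2, ε / (L + 1), by positivity, by linarith⟩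
  set f : State D → ℝ := φ.normed volume with hf
  set k : State D → W := convolution f h (ContinuousLinearMap.lsmul ℝ ℝ) volume with hk
  have hfc : Continuous f := φ.continuous_normed
  have hfs : HasCompactSupport f := φ.hasCompactSupport_normed
  have hfi : Integrable f volume := φ.integrable_normed
  have hf0 : ∀ x, 0 ≤ f x := fun x => φ.nonneg_normed x
  have hki : ∀ x, Integrable (fun t => f t • h (x - t)) volume := fun x =>
    Integrable.mono' (hfi.mul_const ‖h‖)
      (hfc.smul (h.continuous.comp (by fun_prop))).aestronglyMeasurable
      (.of_forall fun t => by
        rw [norm_smul, Real.norm_of_nonneg (hf0 t)]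
        exact mul_le_mul_of_nonneg_left (h.norm_coe_le_norm _) (hf0 t))
  have hka : ∀ x, k x = ∫ t, f t • h (x - t) := fun x => rfl
  have hkC : ContDiff ℝ 1 k := hfs.contDiff_convolution_left _ (φ.contDiff_normed)
    (h.continuous.locallyIntegrable)
  have hf1 : ∫ t, f t = 1 := φ.integral_normed
  have hkL : IsHolder 1 L k := isHolder_one_iff.2 fun x y => by
    rw [hka, hka, ← integral_sub (hki x) (hki y)]
    calc _ ≤ ∫ t, f t * (L * ‖x - y‖) :=
          norm_integral_le_of_norm_le (hfi.mul_const _) (.of_forall fun t => by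
            rw [← smul_sub, norm_smul, Real.norm_of_nonneg (hf0 t)]
            exact mul_le_mul_of_nonneg_left
              (by simpa using isHolder_one_iff.1 hh (x - t) (y - t)) (hf0 t))
      _ = L * ‖x - y‖ := by rw [integral_mul_const, hf1, one_mul]
  have hclose : ∀ x, ‖k x - h x‖ ≤ ε := fun x => by
    rw [← dist_eq_norm]
    refine φ.dist_normed_convolution_le h.continuous.aestronglyMeasurable fun y hy => ?_
    rw [dist_eq_norm]
    have h1 := isHolder_one_iff.1 hh y x
    have h2 : ‖y - x‖ < ε / (L + 1) := by simpa [dist_eq_norm] using hy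
    calc _ ≤ L * (ε / (L + 1)) := h1.trans (by gcongr)
      _ ≤ (L + 1) * (ε / (L + 1)) := by gcongr; linarith
      _ = ε := by field_simp
  have hkd : ∀ x, HasFDerivAt k (fderiv ℝ k x) x := fun x =>
    (hkC.differentiable one_ne_zero x).hasFDerivAt
  have hLW : LipschitzWith ⟨L, hL⟩ k := LipschitzWith.of_dist_le_mul fun x y => by
    rw [dist_eq_norm, dist_eq_norm]
    exact isHolder_one_iff.1 hkL x y
  refine ⟨.ofNormedAddCommGroup k hkC.continuous (ε + ‖h‖) fun x => ?_,
    .ofNormedAddCommGroup (fderiv ℝ k) (hkC.continuous_fderiv one_ne_zero) L fun x =>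
      norm_fderiv_le_of_lipschitz ℝ hLW, hkd,
    (BoundedContinuousFunction.norm_le hε.le).2 hclose⟩
  calc ‖k x‖ = ‖(k x - h x) + h x‖ := by simp
    _ ≤ _ := (norm_add_le _ _).trans (add_le_add (hclose x) (h.norm_coe_le_norm x))

/-- Approximate h uniformly by functions with bounded continuous derivative. The gradient bound for
averages sees only sup norms, so the gradients of the averaged approximants are Cauchy and converge
uniformly; uniform convergence of derivatives passes to the limit. The Lipschitz hypothesis provides
the uniform approximation. -/
lemma exists_hasFDerivAt_avg_of_isHolder_one {σ : ℝ} (hσ : 0 < σ) {μ : Measure (State D)}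
    [IsProbabilityMeasure μ] (hμ : HasGaussianFactor σ μ) (h : State D →ᵇ W) {L : ℝ}
    (hL : 0 ≤ L) (hh : IsHolder 1 L h) :
    ∃ k' : State D →ᵇ Jet D W, ∀ x, HasFDerivAt (avg μ h) (k' x) x := by
  have hpos : ∀ n : ℕ, (0 : ℝ) < 1 / ((n : ℝ) + 1) := fun n => Nat.one_div_pos_of_nat
  choose k k' hk hkh using fun n : ℕ => exists_hasFDerivAt_norm_sub_le h hL hh (hpos n)
  have hkt : Tendsto k atTop (𝓝 h) := by
    rw [tendsto_iff_norm_sub_tendsto_zero]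
    exact squeeze_zero (fun _ => norm_nonneg _) hkh tendsto_one_div_add_atTop_nhds_zero_nat
  have hgd : ∀ n x, HasFDerivAt (avg μ (k n)) (avg μ (k' n) x) x := fun n x =>
    avg_hasFDerivAt μ (hk n) x
  have hb : ∀ n m, ‖avg μ (k' n) - avg μ (k' m)‖ ≤ ‖k n - k m‖ / σ := fun n m => by
    refine norm_le_of_isHolder_one (h := avg μ (k n - k m)) (by positivity) (fun x => ?_)
      (avg_isHolder_one hσ hμ _)
    rw [map_sub]
    exact (hgd n x).sub (hgd m x)
  have hC : CauchySeq fun n => avg μ (k' n) := by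
    have h1 := hkt.cauchySeq
    rw [Metric.cauchySeq_iff] at h1 ⊢
    intro ε hε
    obtain ⟨N, hN⟩ := h1 (ε * σ) (by positivity)
    refine ⟨N, fun m hm n hn => ?_⟩
    have h2 := hN m hm n hn
    rw [dist_eq_norm] at h2 ⊢
    exact (hb m n).trans_lt ((div_lt_iff₀ hσ).2 h2)
  obtain ⟨G, hG⟩ := cauchySeq_tendsto_of_complete hC
  refine ⟨G, hasFDerivAt_of_tendstoUniformly (l := atTop)
    (BoundedContinuousFunction.tendsto_iff_tendstoUniformly.1 hG) hgd fun x => ?_⟩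
  exact ((BoundedContinuousFunction.evalCLM ℝ x).continuous.comp
    (avg μ).continuous).continuousAt.tendsto.comp hkt

end Smoothing

/-! ### Evolution operators of a time-dependent diffusion and their derivative bounds. -/

/-- A continuous, uniformly elliptic, time-dependent diffusion matrix. -/
structure Diffusion (D : ℕ) where
  /-- the diffusion matrix -/
  A : ℝ → Matrix (Fin D) (Fin D) ℝ
  /-- the ellipticity constant -/
  lo : ℝ
  /-- the upper bound -/
  hi : ℝ
  lo_pos : 0 < lo
  hi_pos : 0 < hi
  cont : ∀ i j, Continuous fun t => A t i j
  symm : ∀ t, (A t)ᵀ = A t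
  lower : ∀ t (y : Fin D → ℝ), lo * (y ⬝ᵥ y) ≤ y ⬝ᵥ (A t *ᵥ y)
  upper : ∀ t (y : Fin D → ℝ), y ⬝ᵥ (A t *ᵥ y) ≤ hi * (y ⬝ᵥ y)

namespace Diffusion

variable {D : ℕ} (F : Diffusion D) {W : Type*} [NormedAddCommGroup W] [NormedSpace ℝ W]

/-- The covariance matrix accumulated over `[r, s]`. -/
noncomputable def cov (r s : ℝ) : Matrix (Fin D) (Fin D) ℝ :=
  Matrix.of fun i j => ∫ t in r..s, F.A t i j

lemma cov_self (r : ℝ) : F.cov r r = 0 := by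
  ext i j; simp [cov]

lemma cov_add (r s t : ℝ) : F.cov r s + F.cov s t = F.cov r t := by
  ext i j
  exact intervalIntegral.integral_add_adjacent_intervals
    ((F.cont i j).intervalIntegrable _ _) ((F.cont i j).intervalIntegrable _ _)

lemma continuous_quad (y : Fin D → ℝ) : Continuous fun t => y ⬝ᵥ (F.A t *ᵥ y) := by
  have := F.cont
  simp only [dotProduct, Matrix.mulVec]
  fun_prop

lemma quad_cov (r s : ℝ) (y : Fin D → ℝ) :
    y ⬝ᵥ (F.cov r s *ᵥ y) = ∫ t in r..s, y ⬝ᵥ (F.A t *ᵥ y) := by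
  simp only [dotProduct, Matrix.mulVec, cov, Matrix.of_apply]
  have h1 : ∀ i j, IntervalIntegrable (fun t => F.A t i j * y j) volume r s := fun i j =>
    ((F.cont i j).mul continuous_const).intervalIntegrable _ _
  have h2 : ∀ i, IntervalIntegrable (fun t => y i * ∑ j, F.A t i j * y j) volume r s := fun i =>
    (continuous_const.mul (continuous_finsetSum _ fun j _ =>
      (F.cont i j).mul continuous_const)).intervalIntegrable _ _
  rw [intervalIntegral.integral_finsetSum fun i _ => h2 i]
  refine Finset.sum_congr rfl fun i _ => ?_
  rw [intervalIntegral.integral_const_mul, intervalIntegral.integral_finsetSum fun j _ => h1 i j]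
  simp only [intervalIntegral.integral_mul_const]

lemma lower_cov {r s : ℝ} (hrs : r ≤ s) (y : Fin D → ℝ) :
    F.lo * (s - r) * (y ⬝ᵥ y) ≤ y ⬝ᵥ (F.cov r s *ᵥ y) := by
  rw [quad_cov]
  have := intervalIntegral.integral_mono_on (μ := volume) hrs
    (intervalIntegrable_const (c := F.lo * (y ⬝ᵥ y)))
    ((F.continuous_quad y).intervalIntegrable _ _) fun t _ => F.lower t y
  rw [intervalIntegral.integral_const, smul_eq_mul] at this
  linarith

lemma upper_cov {r s : ℝ} (hrs : r ≤ s) (y : Fin D → ℝ) :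
    y ⬝ᵥ (F.cov r s *ᵥ y) ≤ F.hi * (s - r) * (y ⬝ᵥ y) := by
  rw [quad_cov]
  have := intervalIntegral.integral_mono_on (μ := volume) hrs
    ((F.continuous_quad y).intervalIntegrable _ _)
    (intervalIntegrable_const (c := F.hi * (y ⬝ᵥ y))) fun t _ => F.upper t y
  rw [intervalIntegral.integral_const, smul_eq_mul] at this
  linarith

lemma cov_posSemidef {r s : ℝ} (hrs : r ≤ s) : (F.cov r s).PosSemidef := by
  refine Matrix.PosSemidef.of_dotProduct_mulVec_nonneg ?_ fun y => ?_
  · ext i j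
    simp only [Matrix.conjTranspose_apply, cov, Matrix.of_apply, star_trivial]
    congr 1
    ext t
    rw [← F.symm t, Matrix.transpose_apply, F.symm t]
  · have h1 := F.lower_cov hrs y
    have h2 : 0 ≤ y ⬝ᵥ y := by
      simp only [dotProduct]; exact Finset.sum_nonneg fun i _ => mul_self_nonneg _
    have h3 : 0 ≤ F.lo * (s - r) * (y ⬝ᵥ y) :=
      mul_nonneg (mul_nonneg F.lo_pos.le (by linarith)) h2
    simpa using h3.trans h1

/-- The transition law from time `r` to time `s`. -/
noncomputable def law (r s : ℝ) : Measure (State D) := gaussLaw (F.cov r s)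

instance (r s : ℝ) : IsGaussian (F.law r s) := by unfold law; infer_instance

lemma law_conv {r m s : ℝ} (hrm : r ≤ m) (hms : m ≤ s) : F.law m s ∗ F.law r m = F.law r s := by
  rw [law, law, gaussLaw_conv (F.cov_posSemidef hms) (F.cov_posSemidef hrm), add_comm, cov_add, law]

lemma law_self (r : ℝ) : F.law r r = Measure.dirac 0 := by
  rw [law, cov_self, gaussLaw_zero]

/-- The constant in the moment bound of order `β`. -/
noncomputable def mom (β : ℝ) : ℝ := F.hi ^ (β / 2) * stdMoment D β

lemma mom_nonneg (β : ℝ) : 0 ≤ F.mom β :=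
  mul_nonneg (Real.rpow_nonneg F.hi_pos.le _) (stdMoment_nonneg D β)

lemma integral_norm_rpow_law_le {r s : ℝ} (hrs : r ≤ s) {β : ℝ} (hβ : 0 ≤ β) :
    ∫ z, ‖z‖ ^ β ∂(F.law r s) ≤ F.mom β * (s - r) ^ (β / 2) := by
  have := integral_norm_rpow_gaussLaw_le (F.cov_posSemidef hrs)
    (mul_nonneg F.hi_pos.le (sub_nonneg.2 hrs)) (F.upper_cov hrs) hβ
  rw [Real.mul_rpow F.hi_pos.le (sub_nonneg.2 hrs)] at this
  rw [mom, law]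
  linarith

lemma hasGaussianFactor_law {r s : ℝ} (hrs : r < s) :
    HasGaussianFactor (√(F.lo * (s - r))) (F.law r s) := fun v hv => by
  refine ⟨_, ?_, gaussLaw_eq_conv (F.cov_posSemidef hrs.le) (fun y => ?_) hv⟩
  · infer_instance
  · rw [Real.sq_sqrt (mul_nonneg F.lo_pos.le (by linarith))]
    exact F.lower_cov hrs.le y

/-- The evolution operator from time `r` to time `s`. -/
noncomputable def U (r s : ℝ) : (State D →ᵇ W) →L[ℝ] (State D →ᵇ W) := avg (F.law r s)

lemma norm_U_le (r s : ℝ) (h : State D →ᵇ W) : ‖F.U r s h‖ ≤ ‖h‖ := norm_avg_le _ h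

lemma U_isHolder {α K : ℝ} {h : State D →ᵇ W} (hh : IsHolder α K h) (r s : ℝ) :
    IsHolder α K (F.U r s h) := avg_isHolder _ hh

lemma U_hasFDerivAt (r s : ℝ) {h : State D →ᵇ W} {h' : State D →ᵇ Jet D W}
    (hh : ∀ x, HasFDerivAt h (h' x) x) (x : State D) :
    HasFDerivAt (F.U r s h) (F.U r s h' x) x := avg_hasFDerivAt _ hh x

lemma U_comp {r m s : ℝ} (hrm : r ≤ m) (hms : m ≤ s) (h : State D →ᵇ W) :
    F.U m s (F.U r m h) = F.U r s h := by
  ext x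
  rw [U, U, ← avg_conv, U, avg_apply, avg_apply, F.law_conv hrm hms]

/-- The constant in the gradient bound. -/
noncomputable def gradC : ℝ := F.lo ^ (-(1 / 2) : ℝ)

lemma gradC_nonneg : 0 ≤ F.gradC := Real.rpow_nonneg F.lo_pos.le _

variable [CompleteSpace W]

lemma U_self (r : ℝ) (h : State D →ᵇ W) : F.U r r h = h := by
  ext x
  rw [U, avg_apply, law_self, ← avg_apply, avg_dirac_zero]

lemma norm_U_sub_le {α K : ℝ} (hα : 0 ≤ α) (hK : 0 ≤ K) {h : State D →ᵇ W}
    (hh : IsHolder α K h) {r s : ℝ} (hrs : r ≤ s) :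
    ‖F.U r s h - h‖ ≤ K * (F.mom α * (s - r) ^ (α / 2)) :=
  (norm_avg_sub_le _ hK hh (integrable_norm_rpow _ hα)).trans
    (mul_le_mul_of_nonneg_left (F.integral_norm_rpow_law_le hrs hα) hK)

lemma U_isHolder_one {r s : ℝ} (hrs : r < s) (h : State D →ᵇ W) :
    IsHolder 1 (F.gradC * (s - r) ^ (-(1 / 2) : ℝ) * ‖h‖) (F.U r s h) := by
  have hp : 0 < F.lo * (s - r) := mul_pos F.lo_pos (by linarith)
  have h1 := avg_isHolder_one (Real.sqrt_pos.2 hp) (F.hasGaussianFactor_law hrs) h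
  convert h1 using 2
  rw [gradC, ← Real.mul_rpow F.lo_pos.le (by linarith), Real.sqrt_eq_rpow, Real.rpow_neg hp.le,
    ← div_eq_inv_mul]
  rfl

/-- Smooth twice: the evolution over [r, m] makes h Lipschitz, and the evolution over [m, s] makes a
Lipschitz function differentiable. -/
lemma exists_hasFDerivAt_U {r s : ℝ} (hrs : r < s) (h : State D →ᵇ W) :
    ∃ k' : State D →ᵇ Jet D W, ∀ x, HasFDerivAt (F.U r s h) (k' x) x := by
  obtain ⟨m, hrm, hms⟩ := exists_between hrs
  rw [← F.U_comp hrm.le hms.le]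
  have hp : 0 < F.lo * (s - m) := mul_pos F.lo_pos (by linarith)
  refine exists_hasFDerivAt_avg_of_isHolder_one (Real.sqrt_pos.2 hp) (F.hasGaussianFactor_law hms) _
    ?_ (F.U_isHolder_one hrm h)
  exact mul_nonneg (mul_nonneg F.gradC_nonneg (Real.rpow_nonneg (by linarith) _)) (norm_nonneg _)

open Classical in
/-- The gradient of `F.U r s h`, for `r < s`. -/
noncomputable def gradFun (r s : ℝ) (h : State D →ᵇ W) : State D →ᵇ Jet D W :=
  if hrs : r < s then (F.exists_hasFDerivAt_U hrs h).choose else 0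

lemma hasFDerivAt_gradFun {r s : ℝ} (hrs : r < s) (h : State D →ᵇ W) (x : State D) :
    HasFDerivAt (F.U r s h) (F.gradFun r s h x) x := by
  rw [gradFun, dif_pos hrs]
  exact (F.exists_hasFDerivAt_U hrs h).choose_spec x

lemma norm_gradFun_le (r s : ℝ) (h : State D →ᵇ W) :
    ‖F.gradFun r s h‖ ≤ F.gradC * (s - r) ^ (-(1 / 2) : ℝ) * ‖h‖ := by
  by_cases hrs : r < s
  · exact norm_le_of_isHolder_one (mul_nonneg (mul_nonneg F.gradC_nonneg
      (Real.rpow_nonneg (by linarith) _)) (norm_nonneg _)) (F.hasFDerivAt_gradFun hrs h)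
      (F.U_isHolder_one hrs h)
  -- For r ≥ s the gradient is the default value 0, so only nonnegativity of the bound is at stake.
  -- For r > s the base s − r is negative, and its real power of exponent −1/2 carries the factor
  -- cos(−π/2) = 0.
  · rw [gradFun, dif_neg hrs, norm_zero]
    refine mul_nonneg (mul_nonneg F.gradC_nonneg ?_) (norm_nonneg _)
    rcases (not_lt.1 hrs).eq_or_lt with h1 | h1
    · rw [h1, sub_self]; positivity
    · rw [Real.rpow_def_of_neg (by linarith)]
      refine mul_nonneg (Real.exp_pos _).le ?_
      rw [show -(1 / 2 : ℝ) * Real.pi = -(Real.pi / 2) by ring, Real.cos_neg, Real.cos_pi_div_two]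

/-- The gradient operator `h ↦ ∂(F.U r s h)`, for `r < s`. -/
noncomputable def G (r s : ℝ) : (State D →ᵇ W) →L[ℝ] (State D →ᵇ Jet D W) :=
  LinearMap.mkContinuous
    { toFun := F.gradFun r s
      map_add' := fun h k => by
        by_cases hrs : r < s
        · ext1 x
          refine (F.hasFDerivAt_gradFun hrs (h + k) x).unique ?_
          rw [map_add]
          exact (F.hasFDerivAt_gradFun hrs h x).add (F.hasFDerivAt_gradFun hrs k x)
        · simp [gradFun, hrs]
      map_smul' := fun c h => by
        by_cases hrs : r < s
        · ext1 x
          refine (F.hasFDerivAt_gradFun hrs (c • h) x).unique ?_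
          rw [map_smul]
          exact (F.hasFDerivAt_gradFun hrs h x).const_smul c
        · simp [gradFun, hrs] }
    (F.gradC * (s - r) ^ (-(1 / 2) : ℝ)) (F.norm_gradFun_le r s)

lemma hasFDerivAt_G {r s : ℝ} (hrs : r < s) (h : State D →ᵇ W) (x : State D) :
    HasFDerivAt (F.U r s h) (F.G r s h x) x := F.hasFDerivAt_gradFun hrs h x

lemma norm_G_le (r s : ℝ) (h : State D →ᵇ W) :
    ‖F.G r s h‖ ≤ F.gradC * (s - r) ^ (-(1 / 2) : ℝ) * ‖h‖ := F.norm_gradFun_le r s h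

/-- Averaging commutes with differentiation, so both sides are derivatives of the same function `F.U
r s h`. -/
lemma U_G {r m s : ℝ} (hrm : r < m) (hms : m ≤ s) (h : State D →ᵇ W) :
    F.U m s (F.G r m h) = F.G r s h := by
  ext1 x
  refine HasFDerivAt.unique ?_ (F.hasFDerivAt_G (hrm.trans_le hms) h x)
  rw [← F.U_comp hrm.le hms]
  exact F.U_hasFDerivAt m s (F.hasFDerivAt_G hrm h) x

lemma G_U {r m s : ℝ} (hrm : r ≤ m) (hms : m < s) (h : State D →ᵇ W) :
    F.G m s (F.U r m h) = F.G r s h := by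
  ext1 x
  refine (F.hasFDerivAt_G hms _ x).unique ?_
  rw [F.U_comp hrm hms.le]
  exact F.hasFDerivAt_G (hrm.trans_lt hms) h x

/-- Averaging keeps the Lipschitz constant, so for Lipschitz data the first derivative costs no
power of s − r. -/
lemma norm_G_le_of_isHolder_one {L : ℝ} (hL : 0 ≤ L) {h : State D →ᵇ W} (hh : IsHolder 1 L h)
    {r s : ℝ} (hrs : r < s) : ‖F.G r s h‖ ≤ L :=
  norm_le_of_isHolder_one hL (F.hasFDerivAt_G hrs h) (F.U_isHolder hh r s)

/-- The Hessian operator `h ↦ ∂²(F.U r s h)`, for `r < s`. -/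
noncomputable def G₂ (r s : ℝ) :
    (State D →ᵇ W) →L[ℝ] (State D →ᵇ Jet D (Jet D W)) :=
  (F.G ((r + s) / 2) s).comp (F.G r ((r + s) / 2))

lemma hasFDerivAt_G₂ {r s : ℝ} (hrs : r < s) (h : State D →ᵇ W) (x : State D) :
    HasFDerivAt (F.G r s h) (F.G₂ r s h x) x := by
  have h1 := F.hasFDerivAt_G (r := (r + s) / 2) (s := s) (by linarith) (F.G r ((r + s) / 2) h) x
  rwa [F.U_G (by linarith) (by linarith)] at h1

lemma G₂_U {r m s : ℝ} (hrm : r ≤ m) (hms : m < s) (h : State D →ᵇ W) :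
    F.G₂ m s (F.U r m h) = F.G₂ r s h := by
  ext1 x
  refine (F.hasFDerivAt_G₂ hms _ x).unique ?_
  rw [F.G_U hrm hms]
  exact F.hasFDerivAt_G₂ (hrm.trans_lt hms) h x

lemma U_G₂ {r m s : ℝ} (hrm : r < m) (hms : m ≤ s) (h : State D →ᵇ W) :
    F.U m s (F.G₂ r m h) = F.G₂ r s h := by
  ext1 x
  refine HasFDerivAt.unique ?_ (F.hasFDerivAt_G₂ (hrm.trans_le hms) h x)
  rw [← F.U_G hrm hms]
  exact F.U_hasFDerivAt m s (F.hasFDerivAt_G₂ hrm h) x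

/-- The derivative taken on the first half interval is absorbed by the Lipschitz constant; only the
one on the second half is paid for by smoothing. The result is an integrable singularity, instead of
the (s − r)^(−1) that bounded data would give. -/
lemma norm_G₂_le_of_isHolder_one {L : ℝ} (hL : 0 ≤ L) {h : State D →ᵇ W} (hh : IsHolder 1 L h)
    {r s : ℝ} (hrs : r < s) :
    ‖F.G₂ r s h‖ ≤ 2 * F.gradC * L * (s - r) ^ (-(1 / 2) : ℝ) := by
  have h1 := F.norm_G_le ((r + s) / 2) s (F.G r ((r + s) / 2) h)
  have h2 : ‖F.G r ((r + s) / 2) h‖ ≤ L := F.norm_G_le_of_isHolder_one hL hh (by linarith)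
  have h3 : (s - (r + s) / 2) ^ (-(1 / 2) : ℝ) ≤ 2 * (s - r) ^ (-(1 / 2) : ℝ) := by
    rw [show s - (r + s) / 2 = (1 / 2) * (s - r) by ring,
      Real.mul_rpow (by norm_num) (by linarith)]
    refine mul_le_mul_of_nonneg_right ?_ (Real.rpow_nonneg (by linarith) _)
    rw [one_div, Real.inv_rpow (by norm_num), Real.rpow_neg (by norm_num), inv_inv]
    calc (2 : ℝ) ^ (2⁻¹ : ℝ) ≤ 2 ^ (1 : ℝ) :=
          Real.rpow_le_rpow_of_exponent_le (by norm_num) (by norm_num)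
      _ = 2 := Real.rpow_one 2
  have hc := F.gradC_nonneg
  have h0 : 0 ≤ (s - (r + s) / 2) ^ (-(1 / 2) : ℝ) := Real.rpow_nonneg (by linarith) _
  calc ‖F.G₂ r s h‖ ≤ F.gradC * (s - (r + s) / 2) ^ (-(1 / 2) : ℝ) *
        ‖F.G r ((r + s) / 2) h‖ := h1
    _ ≤ F.gradC * (2 * (s - r) ^ (-(1 / 2) : ℝ)) * L := by gcongr
    _ = _ := by ring

/-- Passing from a half interval to the whole one costs at most a factor 2, since all exponents used
are at least −1. -/
lemma half_rpow_le {τ β : ℝ} (hτ : 0 ≤ τ) (hβ : -1 ≤ β) :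
    (1 / 2 * τ) ^ β ≤ 2 * τ ^ β := by
  rw [Real.mul_rpow (by norm_num) hτ]
  refine mul_le_mul_of_nonneg_right ?_ (Real.rpow_nonneg hτ _)
  calc (1 / 2 : ℝ) ^ β ≤ (1 / 2 : ℝ) ^ (-1 : ℝ) :=
        Real.rpow_le_rpow_of_exponent_ge (by norm_num) (by norm_num) hβ
    _ = 2 := by rw [Real.rpow_neg_one]; norm_num

/-- Interpolation between the sup bound and the Lipschitz bound of order (s − r)^(−1/2). -/
lemma U_isHolder_of_bound {α : ℝ} (hα0 : 0 ≤ α) (hα1 : α ≤ 1) {r s : ℝ} (hrs : r < s)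
    (h : State D →ᵇ W) :
    IsHolder α (2 * (1 + F.gradC) * (s - r) ^ (-(α / 2)) * ‖h‖) (F.U r s h) := by
  have hc := F.gradC_nonneg
  have hτ : 0 < s - r := by linarith
  have h1 := isHolder_of_bound_of_lipschitz hα0 hα1 (norm_nonneg h) (by positivity)
    (fun x => ((F.U r s h).norm_coe_le_norm x).trans (F.norm_U_le r s h)) (F.U_isHolder_one hrs h)
  refine h1.mono ?_
  have e1 : ‖h‖ ^ (1 - α) * ‖h‖ ^ α = ‖h‖ := by
    rw [← Real.rpow_add_of_nonneg (norm_nonneg _) (by linarith) hα0]; simp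
  have e2 : ((s - r) ^ (-(1 / 2) : ℝ)) ^ α = (s - r) ^ (-(α / 2)) := by
    rw [← Real.rpow_mul hτ.le]; congr 1; ring
  have e3 : (2 : ℝ) ^ (1 - α) ≤ 2 := by
    calc (2 : ℝ) ^ (1 - α) ≤ 2 ^ (1 : ℝ) :=
          Real.rpow_le_rpow_of_exponent_le (by norm_num) (by linarith)
      _ = 2 := Real.rpow_one 2
  have e4 : F.gradC ^ α ≤ 1 + F.gradC := by
    calc F.gradC ^ α ≤ (1 + F.gradC) ^ α := Real.rpow_le_rpow hc (by linarith) hα0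
      _ ≤ (1 + F.gradC) ^ (1 : ℝ) := Real.rpow_le_rpow_of_exponent_le (by linarith) hα1
      _ = _ := Real.rpow_one _
  rw [Real.mul_rpow (by norm_num) (norm_nonneg _), Real.mul_rpow (by positivity) (norm_nonneg _),
    Real.mul_rpow hc (by positivity), e2]
  calc 2 ^ (1 - α) * ‖h‖ ^ (1 - α) * (F.gradC ^ α * (s - r) ^ (-(α / 2)) * ‖h‖ ^ α)
      = 2 ^ (1 - α) * F.gradC ^ α * (s - r) ^ (-(α / 2)) * (‖h‖ ^ (1 - α) * ‖h‖ ^ α) := by ring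
    _ ≤ 2 * (1 + F.gradC) * (s - r) ^ (-(α / 2)) * (‖h‖ ^ (1 - α) * ‖h‖ ^ α) := by gcongr
    _ = _ := by rw [e1]

lemma G_isHolder {α : ℝ} (hα0 : 0 ≤ α) (hα1 : α ≤ 1) {r s : ℝ} (hrs : r < s)
    (h : State D →ᵇ W) :
    IsHolder α (4 * (1 + F.gradC) ^ 2 * (s - r) ^ (-(1 / 2) - α / 2) * ‖h‖) (F.G r s h) := by
  have hc := F.gradC_nonneg
  have hτ : 0 < s - r := by linarith
  have h1 := F.U_isHolder_of_bound hα0 hα1 (r := (r + s) / 2) (s := s) (by linarith)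
    (F.G r ((r + s) / 2) h)
  rw [F.U_G (by linarith) (by linarith)] at h1
  refine h1.mono ?_
  have h2 := F.norm_G_le r ((r + s) / 2) h
  rw [show s - (r + s) / 2 = 1 / 2 * (s - r) by ring]
  rw [show (r + s) / 2 - r = 1 / 2 * (s - r) by ring] at h2
  have h3 : (1 / 2 * (s - r)) ^ (-(α / 2)) * (1 / 2 * (s - r)) ^ (-(1 / 2) : ℝ) ≤
      2 * (s - r) ^ (-(1 / 2) - α / 2) := by
    rw [← Real.rpow_add (by linarith), show -(α / 2) + -(1 / 2) = -(1 / 2) - α / 2 by ring]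
    exact half_rpow_le hτ.le (by linarith)
  calc 2 * (1 + F.gradC) * (1 / 2 * (s - r)) ^ (-(α / 2)) * ‖F.G r ((r + s) / 2) h‖
      ≤ 2 * (1 + F.gradC) * (1 / 2 * (s - r)) ^ (-(α / 2)) *
        ((1 + F.gradC) * (1 / 2 * (s - r)) ^ (-(1 / 2) : ℝ) * ‖h‖) := by
        refine mul_le_mul_of_nonneg_left (h2.trans ?_) (by positivity)
        gcongr
        linarith
    _ = 2 * (1 + F.gradC) ^ 2 * ((1 / 2 * (s - r)) ^ (-(α / 2)) *
        (1 / 2 * (s - r)) ^ (-(1 / 2) : ℝ)) * ‖h‖ := by ring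
    _ ≤ 2 * (1 + F.gradC) ^ 2 * (2 * (s - r) ^ (-(1 / 2) - α / 2)) * ‖h‖ := by gcongr
    _ = _ := by ring

/-- Again the first half interval spends the Lipschitz constant, and `G_isHolder` is applied on the
second. The exponent exceeds −1 exactly when α < 1, which is where that restriction enters the
Hessian estimate. -/
lemma G₂_isHolder {α L : ℝ} (hα0 : 0 ≤ α) (hα1 : α ≤ 1) (hL : 0 ≤ L) {h : State D →ᵇ W}
    (hh : IsHolder 1 L h) {r s : ℝ} (hrs : r < s) :
    IsHolder α (8 * (1 + F.gradC) ^ 2 * L * (s - r) ^ (-(1 / 2) - α / 2)) (F.G₂ r s h) := by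
  have hτ : 0 < s - r := by linarith
  refine (F.G_isHolder hα0 hα1 (r := (r + s) / 2) (s := s) (by linarith)
    (F.G r ((r + s) / 2) h)).mono ?_
  have h2 : ‖F.G r ((r + s) / 2) h‖ ≤ L := F.norm_G_le_of_isHolder_one hL hh (by linarith)
  rw [show s - (r + s) / 2 = 1 / 2 * (s - r) by ring]
  have h3 := half_rpow_le hτ.le (β := -(1 / 2) - α / 2) (by linarith)
  calc 4 * (1 + F.gradC) ^ 2 * (1 / 2 * (s - r)) ^ (-(1 / 2) - α / 2) *
        ‖F.G r ((r + s) / 2) h‖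
      ≤ 4 * (1 + F.gradC) ^ 2 * (2 * (s - r) ^ (-(1 / 2) - α / 2)) * L := by gcongr
    _ = _ := by ring

end Diffusion

/-! ### Time integrals with an integrable singularity at the upper end point. -/

section SingularIntegrals

variable {V : Type*} [NormedAddCommGroup V] [NormedSpace ℝ V]

lemma intervalIntegrable_sub_rpow {a s β : ℝ} (hβ : -1 < β) :
    IntervalIntegrable (fun r => (s - r) ^ β) volume a s := by
  have h := (intervalIntegral.intervalIntegrable_rpow' (a := s - a) (b := 0) hβ).comp_sub_left s
  simpa using h

lemma integral_sub_rpow {a s β : ℝ} (hβ : -1 < β) :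
    ∫ r in a..s, (s - r) ^ β = (s - a) ^ (β + 1) / (β + 1) := by
  rw [intervalIntegral.integral_comp_sub_left (fun x => x ^ β) s, sub_self,
    integral_rpow (Or.inl hβ), Real.zero_rpow (by linarith), sub_zero]

lemma intervalIntegrable_of_singular {f : ℝ → V} {a s C β : ℝ} (has : a ≤ s) (hβ : -1 < β)
    (hf : ContinuousOn f (Set.Ioo a s)) (hb : ∀ r ∈ Set.Ioo a s, ‖f r‖ ≤ C * (s - r) ^ β) :
    IntervalIntegrable f volume a s := by
  rw [intervalIntegrable_iff_integrableOn_Ioo_of_le has]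
  have h1 := ((intervalIntegrable_sub_rpow (a := a) (s := s) hβ).const_mul C)
  rw [intervalIntegrable_iff_integrableOn_Ioo_of_le has] at h1
  exact Integrable.mono' h1 (hf.aestronglyMeasurable measurableSet_Ioo)
    ((ae_restrict_iff' measurableSet_Ioo).2 (.of_forall hb))

lemma norm_integral_le_of_singular {f : ℝ → V} {a s C β : ℝ} (has : a ≤ s) (hβ : -1 < β)
    (hb : ∀ r ∈ Set.Ioo a s, ‖f r‖ ≤ C * (s - r) ^ β) :
    ‖∫ r in a..s, f r‖ ≤ C * ((s - a) ^ (β + 1) / (β + 1)) := by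
  rw [← integral_sub_rpow hβ, ← intervalIntegral.integral_const_mul]
  refine intervalIntegral.norm_integral_le_of_norm_le has ?_
    ((intervalIntegrable_sub_rpow hβ).const_mul C)
  filter_upwards [compl_mem_ae_iff.2 (measure_singleton s)] with r hr hr2
  exact hb r ⟨hr2.1, lt_of_le_of_ne hr2.2 hr⟩

variable {D : ℕ} {W : Type*} [NormedAddCommGroup W] [NormedSpace ℝ W] [CompleteSpace W]

lemma intervalIntegral_apply {f : ℝ → State D →ᵇ W} {a s : ℝ}
    (hf : IntervalIntegrable f volume a s) (x : State D) :
    (∫ r in a..s, f r) x = ∫ r in a..s, f r x :=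
  ((BoundedContinuousFunction.evalCLM ℝ x).intervalIntegral_comp_comm hf).symm

lemma intervalIntegrable_apply {f : ℝ → State D →ᵇ W} {a s : ℝ}
    (hf : IntervalIntegrable f volume a s) (x : State D) :
    IntervalIntegrable (fun r => f r x) volume a s :=
  ⟨(BoundedContinuousFunction.evalCLM (β := W) ℝ x).integrable_comp hf.1,
    (BoundedContinuousFunction.evalCLM (β := W) ℝ x).integrable_comp hf.2⟩

/-- Differentiation under the integral, dominated by r ↦ ‖f' r‖. Derivatives are required only on
the open interval, because at r = s the evolution no longer smooths. -/
lemma hasFDerivAt_intervalIntegral {f : ℝ → State D →ᵇ W} {f' : ℝ → State D →ᵇ Jet D W} {a s : ℝ}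
    (has : a ≤ s) (hf : IntervalIntegrable f volume a s) (hf' : IntervalIntegrable f' volume a s)
    (hd : ∀ r ∈ Set.Ioo a s, ∀ x, HasFDerivAt (f r) (f' r x) x) (x : State D) :
    HasFDerivAt ⇑(∫ r in a..s, f r : State D →ᵇ W) ((∫ r in a..s, f' r) x) x := by
  rw [intervalIntegral_apply hf', show ⇑(∫ r in a..s, f r : State D →ᵇ W) =
    fun x => ∫ r in a..s, f r x from funext fun x => intervalIntegral_apply hf x]
  refine intervalIntegral.hasFDerivAt_integral_of_dominated_of_fderiv_le (s := Set.univ)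
    (F := fun x r => f r x) (F' := fun x r => f' r x) (bound := fun r => ‖f' r‖) univ_mem
    (.of_forall fun y => ?_) (intervalIntegrable_apply hf x) ?_
    (.of_forall fun r _ y _ => (f' r).norm_coe_le_norm y) hf'.norm ?_
  · rw [Set.uIoc_of_le has]; exact (intervalIntegrable_apply hf y).1.1
  · rw [Set.uIoc_of_le has]; exact (intervalIntegrable_apply hf' x).1.1
  · filter_upwards [compl_mem_ae_iff.2 (measure_singleton s)] with r hr hr2 y _
    rw [Set.uIoc_of_le has] at hr2
    exact hd r ⟨hr2.1, lt_of_le_of_ne hr2.2 hr⟩ y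

lemma isHolder_intervalIntegral {f : ℝ → State D →ᵇ W} {a s C β α : ℝ} (has : a ≤ s) (hβ : -1 < β)
    (hf : IntervalIntegrable f volume a s)
    (hb : ∀ r ∈ Set.Ioo a s, IsHolder α (C * (s - r) ^ β) (f r)) :
    IsHolder α (C * ((s - a) ^ (β + 1) / (β + 1))) ⇑(∫ r in a..s, f r : State D →ᵇ W) :=
  fun x y => by
  rw [intervalIntegral_apply hf, intervalIntegral_apply hf,
    ← intervalIntegral.integral_sub (intervalIntegrable_apply hf x) (intervalIntegrable_apply hf y)]
  have := norm_integral_le_of_singular (f := fun r => f r x - f r y) (C := C * ‖x - y‖ ^ α) has hβ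
    fun r hr => (hb r hr x y).trans (le_of_eq (by ring))
  exact this.trans (le_of_eq (by ring))

end SingularIntegrals

/-! ### Mild solutions of the linear equation with a source. -/

namespace Diffusion

variable {D : ℕ} (F : Diffusion D) {W : Type*} [NormedAddCommGroup W] [NormedSpace ℝ W]
  [CompleteSpace W]

/-- For r ≤ r' factor both evolutions through time r'. The common operator is a contraction, and
what remains is the short-time displacement of h over [r, r']. -/
lemma norm_U_sub_U_le {L : ℝ} (hL0 : 0 ≤ L) {h k : State D →ᵇ W} (hh : IsHolder 1 L h)
    (hk : IsHolder 1 L k) {r r' s : ℝ} (hr : r ≤ s) (hr' : r' ≤ s) :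
    ‖F.U r s h - F.U r' s k‖ ≤ ‖h - k‖ + L * (F.mom 1 * |r - r'| ^ (1 / 2 : ℝ)) := by
  wlog hrr : r ≤ r' generalizing r r' h k
  · have := this hk hh hr' hr (by linarith)
    rwa [norm_sub_rev, norm_sub_rev k h, abs_sub_comm] at this
  rw [← F.U_comp hrr hr', ← map_sub, abs_sub_comm, abs_of_nonneg (sub_nonneg.2 hrr)]
  refine (F.norm_U_le _ _ _).trans ?_
  calc ‖F.U r r' h - k‖ = ‖(h - k) + (F.U r r' h - h)‖ := by congr 1; abel
    _ ≤ _ := (norm_add_le _ _).trans (add_le_add le_rfl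
      (F.norm_U_sub_le zero_le_one hL0 hh hrr))

lemma continuousOn_U {L : ℝ} (hL0 : 0 ≤ L) {h : ℝ → State D →ᵇ W} (hc : Continuous h)
    (hL : ∀ r, IsHolder 1 L (h r)) (s : ℝ) :
    ContinuousOn (fun r => F.U r s (h r)) (Set.Iic s) := by
  intro r₀ hr₀
  rw [ContinuousWithinAt, tendsto_iff_norm_sub_tendsto_zero]
  refine squeeze_zero' (g := fun r => ‖h r - h r₀‖ + L * (F.mom 1 * |r - r₀| ^ (1 / 2 : ℝ)))
    (.of_forall fun _ => norm_nonneg _)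
    (eventually_nhdsWithin_of_forall fun r hr => F.norm_U_sub_U_le hL0 (hL r) (hL r₀) hr hr₀) ?_
  have h1 : Continuous fun r => ‖h r - h r₀‖ + L * (F.mom 1 * |r - r₀| ^ (1 / 2 : ℝ)) := by
    have : Continuous fun r => |r - r₀| ^ (1 / 2 : ℝ) :=
      (continuous_abs.comp (continuous_id.sub continuous_const)).rpow_const
        fun _ => Or.inr (by norm_num)
    fun_prop
  have h2 := h1.tendsto r₀
  simp only [sub_self, norm_zero, abs_zero] at h2
  rw [Real.zero_rpow (by norm_num)] at h2
  simpa using h2.mono_left nhdsWithin_le_nhds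

/-- Near r₀ < n < s one has G(r,s) = G(n,s) U(r,n): a fixed bounded operator applied to a continuous
curve. -/
lemma continuousOn_G {L : ℝ} (hL0 : 0 ≤ L) {h : ℝ → State D →ᵇ W} (hc : Continuous h)
    (hL : ∀ r, IsHolder 1 L (h r)) (s : ℝ) :
    ContinuousOn (fun r => F.G r s (h r)) (Set.Iio s) := fun r₀ hr₀ => by
  obtain ⟨n, h1, h2⟩ := exists_between (Set.mem_Iio.1 hr₀)
  have h3 := ((F.G n s).continuous.comp_continuousOn
    (F.continuousOn_U hL0 hc hL n)).continuousAt (Iic_mem_nhds h1)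
  refine (h3.congr ?_).continuousWithinAt
  filter_upwards [Iic_mem_nhds h1] with r hr
  exact F.G_U hr h2 (h r)

lemma continuousOn_G₂ {L : ℝ} (hL0 : 0 ≤ L) {h : ℝ → State D →ᵇ W} (hc : Continuous h)
    (hL : ∀ r, IsHolder 1 L (h r)) (s : ℝ) :
    ContinuousOn (fun r => F.G₂ r s (h r)) (Set.Iio s) := fun r₀ hr₀ => by
  obtain ⟨n, h1, h2⟩ := exists_between (Set.mem_Iio.1 hr₀)
  have h3 := ((F.G₂ n s).continuous.comp_continuousOn
    (F.continuousOn_U hL0 hc hL n)).continuousAt (Iic_mem_nhds h1)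
  refine (h3.congr ?_).continuousWithinAt
  filter_upwards [Iic_mem_nhds h1] with r hr
  exact F.G₂_U hr h2 (h r)

/-- A time-dependent source, continuous in time and uniformly Lipschitz in space. -/
structure IsSource (M L : ℝ) (h : ℝ → State D →ᵇ W) : Prop where
  bound_nonneg : 0 ≤ M
  lip_nonneg : 0 ≤ L
  continuous : Continuous h
  bound : ∀ r, ‖h r‖ ≤ M
  lipschitz : ∀ r, IsHolder 1 L (h r)

variable {M L : ℝ} {h : ℝ → State D →ᵇ W}

lemma intervalIntegrable_U (hh : IsSource M L h) {a s : ℝ} (has : a ≤ s) :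
    IntervalIntegrable (fun r => F.U r s (h r)) volume a s :=
  ((F.continuousOn_U hh.lip_nonneg hh.continuous hh.lipschitz s).mono (by
    rw [Set.uIcc_of_le has]; exact fun _ h => h.2)).intervalIntegrable

lemma norm_G_source_le (hh : IsSource M L h) {r s : ℝ} (hrs : r < s) :
    ‖F.G r s (h r)‖ ≤ F.gradC * M * (s - r) ^ (-(1 / 2) : ℝ) := by
  have := F.gradC_nonneg
  have h0 : 0 ≤ (s - r) ^ (-(1 / 2) : ℝ) := Real.rpow_nonneg (by linarith) _
  calc _ ≤ F.gradC * (s - r) ^ (-(1 / 2) : ℝ) * ‖h r‖ := F.norm_G_le r s (h r)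
    _ ≤ F.gradC * (s - r) ^ (-(1 / 2) : ℝ) * M := by gcongr; exact hh.bound r
    _ = _ := by ring

lemma intervalIntegrable_G (hh : IsSource M L h) {a s : ℝ} (has : a ≤ s) :
    IntervalIntegrable (fun r => F.G r s (h r)) volume a s :=
  intervalIntegrable_of_singular has (by norm_num : (-1 : ℝ) < -(1 / 2))
    ((F.continuousOn_G hh.lip_nonneg hh.continuous hh.lipschitz s).mono fun _ h => h.2)
    fun _ hr => F.norm_G_source_le hh hr.2

lemma intervalIntegrable_G₂ (hh : IsSource M L h) {a s : ℝ} (has : a ≤ s) :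
    IntervalIntegrable (fun r => F.G₂ r s (h r)) volume a s :=
  intervalIntegrable_of_singular has (by norm_num : (-1 : ℝ) < -(1 / 2))
    ((F.continuousOn_G₂ hh.lip_nonneg hh.continuous hh.lipschitz s).mono fun _ h => h.2)
    fun r hr => F.norm_G₂_le_of_isHolder_one hh.lip_nonneg (hh.lipschitz r) hr.2

/-- The mild solution with initial value `g` and source `h`. -/
noncomputable def mild (g : State D →ᵇ W) (h : ℝ → State D →ᵇ W) (s : ℝ) : State D →ᵇ W :=
  F.U 0 s g + ∫ r in (0 : ℝ)..s, F.U r s (h r)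

/-- The gradient of the mild solution; `g'` is the gradient of the initial value. -/
noncomputable def mildGrad (g' : State D →ᵇ Jet D W) (h : ℝ → State D →ᵇ W) (s : ℝ) :
    State D →ᵇ Jet D W :=
  F.U 0 s g' + ∫ r in (0 : ℝ)..s, F.G r s (h r)

/-- The Hessian of the mild solution; `g''` is the Hessian of the initial value. -/
noncomputable def mildHess (g'' : State D →ᵇ Jet D (Jet D W)) (h : ℝ → State D →ᵇ W) (s : ℝ) :
    State D →ᵇ Jet D (Jet D W) :=
  F.U 0 s g'' + ∫ r in (0 : ℝ)..s, F.G₂ r s (h r)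

lemma hasFDerivAt_mild (hh : IsSource M L h) {g : State D →ᵇ W} {g' : State D →ᵇ Jet D W}
    (hg : ∀ x, HasFDerivAt g (g' x) x) {s : ℝ} (hs : 0 ≤ s) (x : State D) :
    HasFDerivAt (F.mild g h s) (F.mildGrad g' h s x) x :=
  (F.U_hasFDerivAt 0 s hg x).add (hasFDerivAt_intervalIntegral hs (F.intervalIntegrable_U hh hs)
    (F.intervalIntegrable_G hh hs) (fun r hr => F.hasFDerivAt_G hr.2 (h r)) x)

lemma hasFDerivAt_mildGrad (hh : IsSource M L h) {g' : State D →ᵇ Jet D W}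
    {g'' : State D →ᵇ Jet D (Jet D W)}
    (hg : ∀ x, HasFDerivAt g' (g'' x) x) {s : ℝ} (hs : 0 ≤ s) (x : State D) :
    HasFDerivAt (F.mildGrad g' h s) (F.mildHess g'' h s x) x :=
  (F.U_hasFDerivAt 0 s hg x).add (hasFDerivAt_intervalIntegral hs (F.intervalIntegrable_G hh hs)
    (F.intervalIntegrable_G₂ hh hs) (fun r hr => F.hasFDerivAt_G₂ hr.2 (h r)) x)

/-- The bounded operator U(s,t) passes through the integral over [0, s]. This common form yields the
restart identities for the mild solution, its gradient and its Hessian, from which all increments in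
time are estimated. -/
lemma integral_split {V : Type*} [NormedAddCommGroup V] [NormedSpace ℝ V] [CompleteSpace V]
    {f f' : ℝ → State D →ᵇ V} {s t : ℝ} (hs : 0 ≤ s)
    (hf : IntervalIntegrable f volume 0 s) (hf0 : IntervalIntegrable f' volume 0 s)
    (hf1 : IntervalIntegrable f' volume s t)
    (hU : ∀ r ∈ Set.Ioo 0 s, F.U s t (f r) = f' r) :
    ∫ r in (0 : ℝ)..t, f' r = F.U s t (∫ r in (0 : ℝ)..s, f r) + ∫ r in s..t, f' r := by
  rw [← intervalIntegral.integral_add_adjacent_intervals hf0 hf1,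
    ← (F.U s t).intervalIntegral_comp_comm hf]
  congr 1
  refine intervalIntegral.integral_congr_ae ?_
  filter_upwards [compl_mem_ae_iff.2 (measure_singleton s)] with r hr hr2
  rw [Set.uIoc_of_le hs] at hr2
  exact (hU r ⟨hr2.1, lt_of_le_of_ne hr2.2 hr⟩).symm

lemma intervalIntegrable_sub_of_le {V : Type*} [NormedAddCommGroup V] {f : ℝ → V} {s t : ℝ}
    (hs : 0 ≤ s) (hst : s ≤ t) (hf : IntervalIntegrable f volume 0 t) :
    IntervalIntegrable f volume 0 s :=
  hf.mono_set (by rw [Set.uIcc_of_le hs, Set.uIcc_of_le (hs.trans hst)]; gcongr)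

lemma mild_eq (hh : IsSource M L h) (g : State D →ᵇ W) {s t : ℝ} (hs : 0 ≤ s) (hst : s ≤ t) :
    F.mild g h t = F.U s t (F.mild g h s) + ∫ r in s..t, F.U r t (h r) := by
  rw [mild, mild, map_add, F.U_comp hs hst, F.integral_split (f := fun r => F.U r s (h r)) hs
    (F.intervalIntegrable_U hh hs) (intervalIntegrable_sub_of_le hs hst
      (F.intervalIntegrable_U hh (hs.trans hst))) (F.intervalIntegrable_U hh hst)
    fun r hr => F.U_comp hr.2.le hst (h r), add_assoc]

lemma mildGrad_eq (hh : IsSource M L h) (g' : State D →ᵇ Jet D W) {s t : ℝ} (hs : 0 ≤ s)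
    (hst : s ≤ t) :
    F.mildGrad g' h t = F.U s t (F.mildGrad g' h s) + ∫ r in s..t, F.G r t (h r) := by
  rw [mildGrad, mildGrad, map_add, F.U_comp hs hst,
    F.integral_split (f := fun r => F.G r s (h r)) hs
    (F.intervalIntegrable_G hh hs) (intervalIntegrable_sub_of_le hs hst
      (F.intervalIntegrable_G hh (hs.trans hst))) (F.intervalIntegrable_G hh hst)
    fun r hr => F.U_G hr.2 hst (h r), add_assoc]

lemma mildHess_eq (hh : IsSource M L h) (g'' : State D →ᵇ Jet D (Jet D W)) {s t : ℝ} (hs : 0 ≤ s)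
    (hst : s ≤ t) :
    F.mildHess g'' h t = F.U s t (F.mildHess g'' h s) + ∫ r in s..t, F.G₂ r t (h r) := by
  rw [mildHess, mildHess, map_add, F.U_comp hs hst,
    F.integral_split (f := fun r => F.G₂ r s (h r)) hs
    (F.intervalIntegrable_G₂ hh hs) (intervalIntegrable_sub_of_le hs hst
      (F.intervalIntegrable_G₂ hh (hs.trans hst))) (F.intervalIntegrable_G₂ hh hst)
    fun r hr => F.U_G₂ hr.2 hst (h r), add_assoc]

end Diffusion

/-! ### Second-order Taylor expansion and the generator. -/

section Generator

variable {D : ℕ} {W : Type*} [NormedAddCommGroup W] [NormedSpace ℝ W]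

lemma isHolder_one_of_hasFDerivAt {h : State D → W} {h' : State D → Jet D W} {L : ℝ}
    (hd : ∀ x, HasFDerivAt h (h' x) x) (hb : ∀ x, ‖h' x‖ ≤ L) : IsHolder 1 L h :=
  isHolder_one_iff.2 fun x y =>
    convex_univ.norm_image_sub_le_of_norm_hasFDerivWithin_le
      (fun x _ => (hd x).hasFDerivWithinAt) (fun x _ => hb x) (Set.mem_univ y) (Set.mem_univ x)

variable (D W) in
/-- Evaluation of a second derivative at a pair of basis vectors. -/
noncomputable def evalPair (i j : Fin D) : Jet D (Jet D W) →L[ℝ] W :=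
  (ContinuousLinearMap.apply ℝ W (EuclideanSpace.single j (1 : ℝ) : State D)).comp
    (ContinuousLinearMap.apply ℝ (State D →L[ℝ] W) (EuclideanSpace.single i (1 : ℝ) : State D))

lemma evalPair_apply (i j : Fin D) (B : Jet D (Jet D W)) :
    evalPair D W i j B = B (EuclideanSpace.single i 1) (EuclideanSpace.single j 1) := rfl

lemma norm_jet_apply_le (B : Jet D W) (z : State D) : ‖B z‖ ≤ ‖B‖ * ‖z‖ :=
  ContinuousLinearMap.le_opNorm (show State D →L[ℝ] W from B) z

lemma norm_jet_apply_apply_le (B : Jet D (Jet D W)) (z : State D) :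
    ‖B z z‖ ≤ ‖B‖ * ‖z‖ ^ 2 := by
  calc ‖B z z‖ ≤ ‖B z‖ * ‖z‖ := norm_jet_apply_le _ _
    _ ≤ ‖B‖ * ‖z‖ * ‖z‖ := by gcongr; exact norm_jet_apply_le _ _
    _ = _ := by ring

lemma jet_apply_apply_eq_sum (B : Jet D (Jet D W)) (z : State D) :
    B z z = ∑ i, ∑ j, (z i * z j) • evalPair D W i j B := by
  have hz : z = ∑ i, z i • (EuclideanSpace.single i (1 : ℝ) : State D) := by
    conv_lhs => rw [← (EuclideanSpace.basisFun (Fin D) ℝ).sum_repr z]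
    simp
  have h1 : ∀ (V : Type _) [NormedAddCommGroup V] [NormedSpace ℝ V] (C : Jet D V),
      C z = ∑ i, z i • C (EuclideanSpace.single i 1) := fun V _ _ C => by
    conv_lhs => rw [hz]
    exact (map_sum (show State D →L[ℝ] V from C) _ _).trans
      (Finset.sum_congr rfl fun i _ => map_smul (show State D →L[ℝ] V from C) _ _)
  rw [h1 W (B z)]
  rw [Finset.sum_comm]
  refine Finset.sum_congr rfl fun j _ => ?_
  rw [h1 (Jet D W) B]
  have h2 : (∑ i, z i • B (EuclideanSpace.single i 1)) (EuclideanSpace.single j 1 : State D) =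
      ∑ i, z i • B (EuclideanSpace.single i 1) (EuclideanSpace.single j 1) := by
    exact map_sum (ContinuousLinearMap.apply ℝ W (EuclideanSpace.single j 1 : State D))
      (fun i => (z i • B (EuclideanSpace.single i 1) : State D →L[ℝ] W)) _
  rw [h2, Finset.smul_sum]
  refine Finset.sum_congr rfl fun i _ => ?_
  rw [smul_smul, evalPair_apply, mul_comm]

/-- The second-order operator `q ↦ ½ ∑ S i j q(eᵢ, eⱼ)`. -/
noncomputable def gen (S : Matrix (Fin D) (Fin D) ℝ) (q : State D →ᵇ Jet D (Jet D W)) :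
    State D →ᵇ W :=
  (1 / 2 : ℝ) • ∑ i, ∑ j, S i j • (evalPair D W i j).compLeftContinuousBounded (State D) q

lemma gen_apply (S : Matrix (Fin D) (Fin D) ℝ) (q : State D →ᵇ Jet D (Jet D W)) (x : State D) :
    gen S q x = (1 / 2 : ℝ) • ∑ i, ∑ j, S i j • evalPair D W i j (q x) := by
  simp [gen]

/-- Along the segment t ↦ x + tz, the second derivative of the remainder is at most K‖z‖^(2+α);
apply the mean value inequality twice on [0, 1]. No attempt is made at the optimal constant. -/
lemma taylor_bound {φ : State D → W} {φ' : State D → Jet D W} {φ'' : State D → Jet D (Jet D W)}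
    (h1 : ∀ x, HasFDerivAt φ (φ' x) x) (h2 : ∀ x, HasFDerivAt φ' (φ'' x) x) {α K : ℝ}
    (hα : 0 ≤ α) (hK : 0 ≤ K) (hH : IsHolder α K φ'') (x z : State D) :
    ‖φ (x + z) - φ x - φ' x z - (1 / 2 : ℝ) • φ'' x z z‖ ≤ K * ‖z‖ ^ (2 + α) := by
  have hline : ∀ t : ℝ, HasDerivAt (fun t : ℝ => x + t • z) z t := fun t => by
    simpa using ((hasDerivAt_id t).smul_const z).const_add x
  have d1 : ∀ t : ℝ, HasDerivAt (fun t : ℝ => φ (x + t • z)) (φ' (x + t • z) z) t := fun t =>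
    (h1 (x + t • z)).comp_hasDerivAt t (hline t)
  have d2 : ∀ t : ℝ, HasDerivAt (fun t : ℝ => φ' (x + t • z) z) (φ'' (x + t • z) z z) t :=
    fun t => ((ContinuousLinearMap.apply ℝ W z).hasFDerivAt.comp_hasDerivAt t
      ((h2 (x + t • z)).comp_hasDerivAt t (hline t)))
  set B := φ'' x z z with hB
  have d3 : ∀ t : ℝ, HasDerivAt (fun t : ℝ => φ' (x + t • z) z - t • B)
      (φ'' (x + t • z) z z - B) t := fun t =>
    ((d2 t).sub ((hasDerivAt_id t).smul_const B)).congr_deriv (by simp)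
  have d4 : ∀ t : ℝ, HasDerivAt
      (fun t : ℝ => φ (x + t • z) - t • φ' x z - (t ^ 2 / 2) • B)
      (φ' (x + t • z) z - φ' x z - t • B) t := fun t => by
    have e1 : HasDerivAt (fun t : ℝ => t ^ 2 / 2) t t :=
      ((hasDerivAt_pow 2 t).div_const 2).congr_deriv (by simp)
    exact (((d1 t).sub ((hasDerivAt_id t).smul_const (φ' x z))).sub (e1.smul_const B)).congr_deriv
      (by simp)
  have b3 : ∀ t ∈ Set.Icc (0 : ℝ) 1, ‖φ'' (x + t • z) z z - B‖ ≤ K * ‖z‖ ^ (2 + α) := fun t ht => by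
    have e1 : φ'' (x + t • z) z z - B = (φ'' (x + t • z) - φ'' x) z z := rfl
    rw [e1]
    refine (norm_jet_apply_apply_le _ _).trans ?_
    have e2 := hH (x + t • z) x
    rw [add_sub_cancel_left, norm_smul, Real.norm_of_nonneg ht.1] at e2
    have e3 : (t * ‖z‖) ^ α ≤ ‖z‖ ^ α :=
      Real.rpow_le_rpow (mul_nonneg ht.1 (norm_nonneg _))
        (mul_le_of_le_one_left (norm_nonneg _) ht.2) hα
    calc _ ≤ K * ‖z‖ ^ α * ‖z‖ ^ 2 := by gcongr; exact e2.trans (by gcongr)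
      _ = _ := by
        rw [add_comm (2 : ℝ), Real.rpow_add_of_nonneg (norm_nonneg _) hα (by norm_num)]
        norm_num [mul_assoc]
  have b2 : ∀ t ∈ Set.Icc (0 : ℝ) 1,
      ‖φ' (x + t • z) z - φ' x z - t • B‖ ≤ K * ‖z‖ ^ (2 + α) := fun t ht => by
    have := norm_image_sub_le_of_norm_deriv_le_segment'
      (fun t _ => (d3 t).hasDerivWithinAt) (fun t ht => b3 t ⟨ht.1, ht.2.le⟩) t ht
    simp only [zero_smul, add_zero, sub_zero] at this
    rw [sub_right_comm]
    exact this.trans (mul_le_of_le_one_right (by positivity) ht.2)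
  have := norm_image_sub_le_of_norm_deriv_le_segment_01'
    (fun t _ => (d4 t).hasDerivWithinAt) (fun t ht => b2 t ⟨ht.1, ht.2.le⟩)
  simp only [one_smul, zero_smul, add_zero, sub_zero] at this
  refine (le_of_eq ?_).trans this
  congr 1
  norm_num
  abel

end Generator

/-! ### One-sided derivatives in time. -/

section RightDerivative

variable {V : Type*} [NormedAddCommGroup V] [NormedSpace ℝ V]

lemma hasDerivWithinAt_zero_of_norm_le {f : ℝ → V} {s C β : ℝ} (hβ : 1 < β) {S : Set ℝ}
    (hf : ∀ᶠ t in 𝓝[S] s, ‖f t‖ ≤ C * |t - s| ^ β) (hfs : f s = 0) :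
    HasDerivWithinAt f 0 S s := by
  rw [hasDerivWithinAt_iff_isLittleO]
  simp only [smul_zero, sub_zero, hfs]
  have h1 : (fun t => |t - s| ^ β) =o[𝓝[S] s] fun t => t - s := by
    have h2 : (fun t => |t - s| ^ (β - 1)) =o[𝓝[S] s] fun _ => (1 : ℝ) := by
      rw [Asymptotics.isLittleO_one_iff]
      have : Continuous fun t => |t - s| ^ (β - 1) :=
        (continuous_abs.comp (continuous_id.sub continuous_const)).rpow_const
          fun _ => Or.inr (by linarith)
      have h3 := this.tendsto s
      rw [sub_self, abs_zero, Real.zero_rpow (by linarith)] at h3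
      exact h3.mono_left nhdsWithin_le_nhds
    have h4 := h2.mul_isBigO (Asymptotics.isBigO_refl (fun t => |t - s|) (𝓝[S] s))
    refine (h4.congr (fun t => ?_) (fun t => one_mul _)).trans_isBigO
      (Asymptotics.isBigO_abs_left.2 (Asymptotics.isBigO_refl _ _))
    rw [← Real.rpow_add_one' (abs_nonneg _) (by linarith), sub_add_cancel]
  exact (Asymptotics.IsBigO.of_bound C (hf.mono fun t ht => by
    rwa [Real.norm_of_nonneg (by positivity)])).trans_isLittleO h1

lemma continuousOn_of_holder_time {f : ℝ → V} {T C β : ℝ} (hβ : 0 < β)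
    (hf : ∀ s t, 0 ≤ s → s ≤ t → t ≤ T → ‖f t - f s‖ ≤ C * (t - s) ^ β) :
    ContinuousOn f (Set.Icc 0 T) := fun s hs => by
  rw [ContinuousWithinAt, tendsto_iff_norm_sub_tendsto_zero]
  refine squeeze_zero' (g := fun t => C * |t - s| ^ β) (.of_forall fun _ => norm_nonneg _)
    (eventually_nhdsWithin_of_forall fun t ht => ?_) ?_
  · rcases le_total s t with h | h
    · rw [abs_of_nonneg (sub_nonneg.2 h)]
      exact hf s t hs.1 h ht.2
    · rw [abs_sub_comm, abs_of_nonneg (sub_nonneg.2 h), norm_sub_rev]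
      exact hf t s ht.1 h hs.2
  · have : Continuous fun t => C * |t - s| ^ β :=
      continuous_const.mul ((continuous_abs.comp (continuous_id.sub continuous_const)).rpow_const
          fun _ => Or.inr hβ.le)
    have h3 := this.tendsto s
    rw [sub_self, abs_zero, Real.zero_rpow (by linarith), mul_zero] at h3
    exact h3.mono_left nhdsWithin_le_nhds

/-- A continuous function with continuous right derivative is differentiable. -/
lemma hasDerivWithinAt_Icc_of_right [CompleteSpace V] {f f' : ℝ → V} {T : ℝ} (hT : 0 ≤ T)
    (hf : ContinuousOn f (Set.Icc 0 T)) (hf' : ContinuousOn f' (Set.Icc 0 T))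
    (hd : ∀ t ∈ Set.Ioo 0 T, HasDerivWithinAt f (f' t) (Set.Ici t) t) {t : ℝ}
    (ht : t ∈ Set.Icc 0 T) : HasDerivWithinAt f (f' t) (Set.Icc 0 T) t := by
  -- Extending f' by constants gives a function continuous on the line. Then f is f 0 plus the
  -- integral of k, and the fundamental theorem gives a two-sided derivative, also at the end
  -- points.
  set k : ℝ → V := Set.IccExtend hT (Set.domRestrict (Set.Icc 0 T) f') with hk
  have hkc : Continuous k := (continuousOn_iff_continuous_domRestrict.1 hf').Icc_extend'
  have hke : ∀ r ∈ Set.Icc 0 T, k r = f' r := fun r hr => Set.IccExtend_of_mem hT _ hr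
  have h1 : ∀ r ∈ Set.Icc 0 T, f r = f 0 + ∫ u in (0 : ℝ)..r, k u := fun r hr => by
    rw [intervalIntegral.integral_eq_sub_of_hasDeriv_right_of_le hr.1
      (hf.mono (Set.Icc_subset_Icc_right hr.2)) (fun u hu => ?_) (hkc.intervalIntegrable _ _)]
    · abel
    · have hu' : u ∈ Set.Ioo 0 T := ⟨hu.1, hu.2.trans_le hr.2⟩
      rw [hke u ⟨hu'.1.le, hu'.2.le⟩]
      exact (hd u hu').mono Set.Ioi_subset_Ici_self
  have h2 : HasDerivAt (fun r => f 0 + ∫ u in (0 : ℝ)..r, k u) (k t) t :=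
    (intervalIntegral.integral_hasDerivAt_right (hkc.intervalIntegrable _ _)
      hkc.stronglyMeasurable.stronglyMeasurableAtFilter hkc.continuousAt).const_add _
  rw [hke t ht] at h2
  exact h2.hasDerivWithinAt.congr h1 (h1 t ht)

end RightDerivative

/-! ### Right time derivatives of the evolution and of the Duhamel integral. -/

namespace Diffusion

variable {D : ℕ} (F : Diffusion D) {W : Type*} [NormedAddCommGroup W] [NormedSpace ℝ W]
  [CompleteSpace W]

/-- Integrate the Taylor expansion against the law: the linear term vanishes by centring, the
quadratic one produces the covariance, and the remainder is a moment of order 2 + α, hence of order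
(s − r)^(1+α/2). -/
lemma U_sub_gen_le {φ : State D →ᵇ W} {φ' : State D →ᵇ Jet D W}
    {φ'' : State D →ᵇ Jet D (Jet D W)}
    (h1 : ∀ x, HasFDerivAt φ (φ' x) x) (h2 : ∀ x, HasFDerivAt φ' (φ'' x) x) {α K : ℝ}
    (hα : 0 ≤ α) (hK : 0 ≤ K) (hH : IsHolder α K φ'') {r s : ℝ} (hrs : r ≤ s) :
    ‖F.U r s φ - φ - gen (F.cov r s) φ''‖ ≤ K * (F.mom (2 + α) * (s - r) ^ (1 + α / 2)) := by
  have hα2 : 0 ≤ 2 + α := by linarith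
  have hmom := F.integral_norm_rpow_law_le hrs hα2
  rw [show (2 + α) / 2 = 1 + α / 2 by ring] at hmom
  refine (BoundedContinuousFunction.norm_le (mul_nonneg hK (mul_nonneg (F.mom_nonneg _)
    (Real.rpow_nonneg (sub_nonneg.2 hrs) _)))).2 fun x => ?_
  have hid : Integrable (fun z : State D => z) (F.law r s) := IsGaussian.integrable_id
  have hi1 : Integrable (fun z : State D => φ' x z) (F.law r s) :=
    ContinuousLinearMap.integrable_comp (show State D →L[ℝ] W from φ' x) hid
  have e1 : ∫ z, φ' x z ∂(F.law r s) = 0 := by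
    have e2 := ContinuousLinearMap.integral_comp_comm (show State D →L[ℝ] W from φ' x) hid
    refine e2.trans ?_
    have e3 : ∫ z, z ∂(F.law r s) = 0 := by simp [law, gaussLaw]
    rw [e3]; exact map_zero (show State D →L[ℝ] W from φ' x)
  have hij : ∀ i j, Integrable (fun z : State D => z i * z j) (F.law r s) := fun i j =>
    MemLp.integrable_mul (p := 2) (q := 2)
      ((EuclideanSpace.proj (𝕜 := ℝ) i).comp_memLp' (IsGaussian.memLp_id _ 2 (by simp)))
      ((EuclideanSpace.proj (𝕜 := ℝ) j).comp_memLp' (IsGaussian.memLp_id _ 2 (by simp)))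
  have hij' : ∀ i j, Integrable (fun z : State D => (z i * z j) • evalPair D W i j (φ'' x))
      (F.law r s) := fun i j => (hij i j).smul_const _
  have hi2 : Integrable (fun z : State D => φ'' x z z) (F.law r s) := by
    simp only [jet_apply_apply_eq_sum]
    exact integrable_finsetSum _ fun i _ => integrable_finsetSum _ fun j _ => hij' i j
  have e4 : ∫ z, φ'' x z z ∂(F.law r s) =
      ∑ i, ∑ j, F.cov r s i j • evalPair D W i j (φ'' x) := by
    simp only [jet_apply_apply_eq_sum]
    rw [integral_finsetSum _ fun i _ => integrable_finsetSum _ fun j _ => hij' i j]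
    refine Finset.sum_congr rfl fun i _ => ?_
    rw [integral_finsetSum _ fun j _ => hij' i j]
    refine Finset.sum_congr rfl fun j _ => ?_
    rw [integral_smul_const, law, integral_mul_coord_gaussLaw (F.cov_posSemidef hrs)]
  have e5 : (F.U r s φ - φ - gen (F.cov r s) φ'') x =
      ∫ z, (φ (x + z) - φ x - φ' x z - (1 / 2 : ℝ) • φ'' x z z) ∂(F.law r s) := by
    have i1 := integrable_bcf_add (F.law r s) φ x
    have i2 : Integrable (fun z => φ (x + z) - φ x) (F.law r s) := i1.sub (integrable_const _)
    have i3 : Integrable (fun z => φ (x + z) - φ x - φ' x z) (F.law r s) := i2.sub hi1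
    have i4 : Integrable (fun z => (1 / 2 : ℝ) • φ'' x z z) (F.law r s) := hi2.smul _
    rw [integral_sub i3 i4, integral_sub i2 hi1,
      integral_sub i1 (integrable_const _), e1, integral_smul, e4]
    simp [gen_apply, U, avg_apply]
  rw [e5]
  refine (norm_integral_le_of_norm_le ((integrable_norm_rpow (F.law r s) hα2).const_mul K)
    (.of_forall fun z => taylor_bound h1 h2 hα hK hH x z)).trans ?_
  rw [integral_const_mul]
  exact mul_le_mul_of_nonneg_left hmom hK

lemma hasDerivAt_gen_cov (φ'' : State D →ᵇ Jet D (Jet D W)) (s : ℝ) :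
    HasDerivAt (fun t => gen (F.cov s t) φ'') (gen (F.A s) φ'') s := by
  unfold gen
  have h1 : ∀ i j, HasDerivAt (fun t => F.cov s t i j) (F.A s i j) s := fun i j =>
    intervalIntegral.integral_hasDerivAt_right ((F.cont i j).intervalIntegrable _ _)
      (F.cont i j).stronglyMeasurable.stronglyMeasurableAtFilter (F.cont i j).continuousAt
  exact (HasDerivAt.fun_sum fun i _ => HasDerivAt.fun_sum fun j _ =>
    (h1 i j).smul_const _).const_smul (1 / 2 : ℝ)

/-- The generator of the evolution operators. -/
lemma hasDerivWithinAt_U {φ : State D →ᵇ W} {φ' : State D →ᵇ Jet D W}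
    {φ'' : State D →ᵇ Jet D (Jet D W)}
    (h1 : ∀ x, HasFDerivAt φ (φ' x) x) (h2 : ∀ x, HasFDerivAt φ' (φ'' x) x) {α K : ℝ}
    (hα : 0 < α) (hK : 0 ≤ K) (hH : IsHolder α K φ'') (s : ℝ) :
    HasDerivWithinAt (fun t => F.U s t φ) (gen (F.A s) φ'') (Set.Ici s) s := by
  have e1 : HasDerivWithinAt (fun t => F.U s t φ - φ - gen (F.cov s t) φ'') 0 (Set.Ici s) s := by
    refine hasDerivWithinAt_zero_of_norm_le (β := 1 + α / 2) (C := K * F.mom (2 + α))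
      (by linarith) (eventually_nhdsWithin_of_forall fun t ht => ?_) ?_
    · rw [abs_of_nonneg (sub_nonneg.2 ht), mul_assoc]
      exact F.U_sub_gen_le h1 h2 hα.le hK hH ht
    · have : gen (F.cov s s) φ'' = 0 := by simp [gen, F.cov_self]
      rw [F.U_self, this]; simp
  have e2 := (e1.add (F.hasDerivAt_gen_cov φ'' s).hasDerivWithinAt).add_const φ
  rw [zero_add] at e2
  refine e2.congr_of_mem (fun t _ => ?_) (Set.self_mem_Ici)
  simp

/-- Replacing U(r,t)h(r) by h(r) changes the integral by O((t − s)^(3/2)), since h(r) is Lipschitz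
in space; then the fundamental theorem of calculus applies to h. -/
lemma hasDerivWithinAt_integral_U {M L : ℝ} {h : ℝ → State D →ᵇ W} (hh : IsSource M L h) (s : ℝ) :
    HasDerivWithinAt (fun t => ∫ r in s..t, F.U r t (h r)) (h s) (Set.Ici s) s := by
  have e1 : HasDerivAt (fun t => ∫ r in s..t, h r) (h s) s :=
    intervalIntegral.integral_hasDerivAt_right (hh.continuous.intervalIntegrable _ _)
      hh.continuous.stronglyMeasurable.stronglyMeasurableAtFilter hh.continuous.continuousAt
  have e2 : HasDerivWithinAt (fun t => ∫ r in s..t, (F.U r t (h r) - h r)) 0 (Set.Ici s) s := by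
    refine hasDerivWithinAt_zero_of_norm_le (β := 1 + 1 / 2) (C := L * F.mom 1)
      (by norm_num) (eventually_nhdsWithin_of_forall fun t ht => ?_) (by simp)
    have ht' : s ≤ t := ht
    rw [abs_of_nonneg (sub_nonneg.2 ht')]
    have := intervalIntegral.norm_integral_le_of_norm_le_const (a := s) (b := t)
      (f := fun r => F.U r t (h r) - h r) (C := L * (F.mom 1 * (t - s) ^ (1 / 2 : ℝ)))
      fun r hr => by
        rw [Set.uIoc_of_le ht'] at hr
        refine (F.norm_U_sub_le zero_le_one hh.lip_nonneg (hh.lipschitz r) hr.2).trans ?_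
        have := F.mom_nonneg 1
        have := hh.lip_nonneg
        have : (t - r) ^ (1 / 2 : ℝ) ≤ (t - s) ^ (1 / 2 : ℝ) :=
          Real.rpow_le_rpow (sub_nonneg.2 hr.2) (by linarith [hr.1]) (by norm_num)
        gcongr
    refine this.trans (le_of_eq ?_)
    rw [abs_of_nonneg (sub_nonneg.2 ht'), add_comm (1 : ℝ),
      Real.rpow_add_one' (sub_nonneg.2 ht') (by norm_num)]
    ring
  have e3 := e2.add e1.hasDerivWithinAt
  rw [zero_add] at e3
  refine e3.congr_of_mem (fun t ht => ?_) Set.self_mem_Ici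
  simp only [Pi.add_apply]
  rw [intervalIntegral.integral_sub (F.intervalIntegrable_U hh ht)
    (hh.continuous.intervalIntegrable _ _)]
  simp

end Diffusion

/-! ### Space and time regularity of mild solutions. -/

namespace Diffusion

variable {D : ℕ} (F : Diffusion D) {W : Type*} [NormedAddCommGroup W] [NormedSpace ℝ W]
  [CompleteSpace W] {M L : ℝ} {h : ℝ → State D →ᵇ W}

lemma rpow_half_div (x : ℝ) : x ^ (-(1 / 2) + 1 : ℝ) / (-(1 / 2) + 1) = 2 * x ^ (1 / 2 : ℝ) := by
  norm_num [div_eq_mul_inv, mul_comm]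

lemma norm_integral_G_le (hh : IsSource M L h) {a s : ℝ} (has : a ≤ s) :
    ‖∫ r in a..s, F.G r s (h r)‖ ≤ 2 * F.gradC * M * (s - a) ^ (1 / 2 : ℝ) := by
  have := norm_integral_le_of_singular has (by norm_num : (-1 : ℝ) < -(1 / 2))
    fun r hr => F.norm_G_source_le hh hr.2
  rw [rpow_half_div] at this
  linarith

lemma norm_integral_G₂_le (hh : IsSource M L h) {a s : ℝ} (has : a ≤ s) :
    ‖∫ r in a..s, F.G₂ r s (h r)‖ ≤ 4 * F.gradC * L * (s - a) ^ (1 / 2 : ℝ) := by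
  have := norm_integral_le_of_singular has (by norm_num : (-1 : ℝ) < -(1 / 2))
    fun r hr => F.norm_G₂_le_of_isHolder_one hh.lip_nonneg (hh.lipschitz r) hr.2
  rw [rpow_half_div] at this
  linarith

lemma norm_mildGrad_le (hh : IsSource M L h) (g' : State D →ᵇ Jet D W) {s : ℝ} (hs : 0 ≤ s) :
    ‖F.mildGrad g' h s‖ ≤ ‖g'‖ + 2 * F.gradC * M * s ^ (1 / 2 : ℝ) := by
  refine (norm_add_le _ _).trans (add_le_add (F.norm_U_le _ _ _) ?_)
  simpa using F.norm_integral_G_le hh hs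

/-- The derivative of the Duhamel part is the integral of G₂, of norm at most 4cL√s. Because this is
small for small s, the Lipschitz constraint is stable under the fixed-point map. -/
lemma mildGrad_isHolder_one (hh : IsSource M L h) {g' : State D →ᵇ Jet D W} {K : ℝ}
    (hg : IsHolder 1 K g') {s : ℝ} (hs : 0 ≤ s) :
    IsHolder 1 (K + 4 * F.gradC * L * s ^ (1 / 2 : ℝ)) (F.mildGrad g' h s) := by
  refine (F.U_isHolder hg 0 s).add ?_
  refine isHolder_one_of_hasFDerivAt (hasFDerivAt_intervalIntegral hs (F.intervalIntegrable_G hh hs)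
    (F.intervalIntegrable_G₂ hh hs) (fun r hr => F.hasFDerivAt_G₂ hr.2 (h r))) fun x => ?_
  have := F.norm_integral_G₂_le hh hs
  rw [sub_zero] at this
  exact (BoundedContinuousFunction.norm_coe_le_norm _ x).trans this

lemma norm_mildGrad_sub_le (hh : IsSource M L h) {g' : State D →ᵇ Jet D W} {K : ℝ} (hK : 0 ≤ K)
    {s t : ℝ} (hs : 0 ≤ s) (hst : s ≤ t) (hL : IsHolder 1 K (F.mildGrad g' h s)) :
    ‖F.mildGrad g' h t - F.mildGrad g' h s‖ ≤
      (K * F.mom 1 + 2 * F.gradC * M) * (t - s) ^ (1 / 2 : ℝ) := by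
  rw [F.mildGrad_eq hh g' hs hst, add_sub_right_comm]
  refine (norm_add_le _ _).trans ((add_le_add (F.norm_U_sub_le zero_le_one hK hL hst)
    (F.norm_integral_G_le hh hst)).trans (le_of_eq (by ring)))

lemma norm_mild_sub_le (hh : IsSource M L h) {g : State D →ᵇ W} {K : ℝ} (hK : 0 ≤ K)
    {s t : ℝ} (hs : 0 ≤ s) (hst : s ≤ t) (ht : t ≤ 1) (hL : IsHolder 1 K (F.mild g h s)) :
    ‖F.mild g h t - F.mild g h s‖ ≤ (K * F.mom 1 + M) * (t - s) ^ (1 / 2 : ℝ) := by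
  rw [F.mild_eq hh g hs hst, add_sub_right_comm]
  have h1 := intervalIntegral.norm_integral_le_of_norm_le_const (a := s) (b := t)
    (f := fun r => F.U r t (h r)) (C := M) fun r _ => (F.norm_U_le _ _ _).trans (hh.bound r)
  rw [abs_of_nonneg (sub_nonneg.2 hst)] at h1
  have h2 : t - s ≤ (t - s) ^ (1 / 2 : ℝ) := by
    conv_lhs => rw [← Real.rpow_one (t - s)]
    exact Real.rpow_le_rpow_of_exponent_ge_of_imp (by linarith) (by linarith) (by norm_num)
      (by norm_num)
  refine (norm_add_le _ _).trans ((add_le_add (F.norm_U_sub_le zero_le_one hK hL hst)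
    (h1.trans (mul_le_mul_of_nonneg_left h2 hh.bound_nonneg))).trans (le_of_eq (by ring)))

/-- Integrating (s − r)^(−1/2−α/2) gives the factor 2/(1 − α), with s ≤ 1 used to drop the remaining
power. -/
lemma mildHess_isHolder (hh : IsSource M L h) {g'' : State D →ᵇ Jet D (Jet D W)} {α K : ℝ}
    (hα0 : 0 ≤ α) (hα1 : α < 1) (hg : IsHolder α K g'') {s : ℝ} (hs : 0 ≤ s) (hs1 : s ≤ 1) :
    IsHolder α (K + 16 * (1 + F.gradC) ^ 2 * L / (1 - α)) (F.mildHess g'' h s) := by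
  refine (F.U_isHolder hg 0 s).add ?_
  have h1 := isHolder_intervalIntegral (α := α) hs (by linarith : -1 < -(1 / 2) - α / 2)
    (F.intervalIntegrable_G₂ hh hs)
    (fun r hr => F.G₂_isHolder hα0 hα1.le hh.lip_nonneg (hh.lipschitz r) hr.2)
  refine h1.mono ?_
  have h2 : (s - 0) ^ (-(1 / 2) - α / 2 + 1) ≤ 1 :=
    Real.rpow_le_one (by linarith) (by linarith) (by linarith)
  have h3 : 0 < 1 - α := by linarith
  have hL := hh.lip_nonneg
  calc _ ≤ 8 * (1 + F.gradC) ^ 2 * L * (1 / (-(1 / 2) - α / 2 + 1)) := by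
        have : 0 < -(1 / 2) - α / 2 + 1 := by linarith
        gcongr
    _ = _ := by
        rw [show -(1 / 2) - α / 2 + 1 = (1 - α) / 2 by ring]
        field_simp
        ring

lemma norm_mildHess_sub_le (hh : IsSource M L h) {g'' : State D →ᵇ Jet D (Jet D W)} {α K : ℝ}
    (hα0 : 0 ≤ α) (hα1 : α ≤ 1) (hK : 0 ≤ K) {s t : ℝ} (hs : 0 ≤ s) (hst : s ≤ t) (ht : t ≤ 1)
    (hH : IsHolder α K (F.mildHess g'' h s)) :
    ‖F.mildHess g'' h t - F.mildHess g'' h s‖ ≤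
      (K * F.mom α + 4 * F.gradC * L) * (t - s) ^ (α / 2) := by
  rw [F.mildHess_eq hh g'' hs hst, add_sub_right_comm]
  have h2 : (t - s) ^ (1 / 2 : ℝ) ≤ (t - s) ^ (α / 2) :=
    Real.rpow_le_rpow_of_exponent_ge_of_imp (by linarith) (by linarith) (by linarith)
      (by norm_num)
  have hc := F.gradC_nonneg
  have hL := hh.lip_nonneg
  refine (norm_add_le _ _).trans ((add_le_add (F.norm_U_sub_le hα0 hK hH hst)
    ((F.norm_integral_G₂_le hh hst).trans (mul_le_mul_of_nonneg_left h2 (by positivity)))).trans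
    (le_of_eq (by ring)))

/-! ### Equivalence between mild and classical solutions. -/

section TimeDerivative

variable {g : State D →ᵇ W} {g' : State D →ᵇ Jet D W} {g'' : State D →ᵇ Jet D (Jet D W)}

/-- Restart at time s: the mild solution there has a Hölder Hessian, so the generator acts on it,
and the new Duhamel integral contributes h(s). -/
lemma hasDerivWithinAt_mild_right (hh : IsSource M L h) (hg : ∀ x, HasFDerivAt g (g' x) x)
    (hg' : ∀ x, HasFDerivAt g' (g'' x) x) {α K : ℝ} (hα0 : 0 < α) (hα1 : α < 1)
    (hK : 0 ≤ K) (hH : IsHolder α K g'') {s : ℝ} (hs : 0 ≤ s) (hs1 : s ≤ 1) :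
    HasDerivWithinAt (F.mild g h) (gen (F.A s) (F.mildHess g'' h s) + h s) (Set.Ici s) s := by
  have hL := hh.lip_nonneg
  have h3 : 0 < 1 - α := by linarith
  have e1 := F.hasDerivWithinAt_U (F.hasFDerivAt_mild hh hg hs) (F.hasFDerivAt_mildGrad hh hg' hs)
    hα0 (by positivity) (F.mildHess_isHolder hh hα0.le hα1 hH hs hs1) s
  exact (e1.add (F.hasDerivWithinAt_integral_U hh s)).congr_of_mem
    (fun t ht => F.mild_eq hh g hs ht) Set.self_mem_Ici

lemma continuous_gen {A : ℝ → Matrix (Fin D) (Fin D) ℝ} {q : ℝ → State D →ᵇ Jet D (Jet D W)}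
    {S : Set ℝ} (hA : ∀ i j, Continuous fun t => A t i j) (hq : ContinuousOn q S) :
    ContinuousOn (fun t => gen (A t) (q t)) S := by
  have h1 : ∀ i j, ContinuousOn (fun t => A t i j •
      (evalPair D W i j).compLeftContinuousBounded (State D) (q t)) S := fun i j =>
    (hA i j).continuousOn.smul
      (((evalPair D W i j).compLeftContinuousBounded (State D)).continuous.comp_continuousOn hq)
  exact (continuousOn_finsetSum _ fun i _ =>
    continuousOn_finsetSum _ fun j _ => h1 i j).const_smul (1 / 2 : ℝ)

/-- Restarting gives right derivatives only. Both the solution and the candidate derivative are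
continuous in time, so the right derivative is a derivative. -/
lemma hasDerivWithinAt_mild (hh : IsSource M L h) (hg : ∀ x, HasFDerivAt g (g' x) x)
    (hg' : ∀ x, HasFDerivAt g' (g'' x) x) {α K : ℝ} (hα0 : 0 < α) (hα1 : α < 1)
    (hK : 0 ≤ K) (hH : IsHolder α K g'') {T : ℝ} (hT0 : 0 ≤ T) (hT1 : T ≤ 1) {s : ℝ}
    (hs : s ∈ Set.Icc 0 T) :
    HasDerivWithinAt (F.mild g h) (gen (F.A s) (F.mildHess g'' h s) + h s) (Set.Icc 0 T) s := by
  have hL := hh.lip_nonneg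
  have hM := hh.bound_nonneg
  have hc := F.gradC_nonneg
  have h3 : 0 < 1 - α := by linarith
  have c1 : ContinuousOn (F.mild g h) (Set.Icc 0 T) := by
    refine continuousOn_of_holder_time (β := 1 / 2) (by norm_num)
      (C := (‖g'‖ + 2 * F.gradC * M) * F.mom 1 + M) fun s t hs hst ht => ?_
    refine F.norm_mild_sub_le hh (by positivity) hs hst (ht.trans hT1) ?_
    refine isHolder_one_of_hasFDerivAt (F.hasFDerivAt_mild hh hg hs) fun x => ?_
    refine (BoundedContinuousFunction.norm_coe_le_norm _ x).trans
      ((F.norm_mildGrad_le hh g' hs).trans ?_)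
    have : s ^ (1 / 2 : ℝ) ≤ 1 := Real.rpow_le_one hs (by linarith) (by norm_num)
    have : 2 * F.gradC * M * s ^ (1 / 2 : ℝ) ≤ 2 * F.gradC * M :=
      mul_le_of_le_one_right (by positivity) this
    linarith
  have c2 : ContinuousOn (F.mildHess g'' h) (Set.Icc 0 T) :=
    continuousOn_of_holder_time (β := α / 2) (by linarith) fun s t hs hst ht =>
      F.norm_mildHess_sub_le hh hα0.le hα1.le (by positivity) hs hst (ht.trans hT1)
        (F.mildHess_isHolder hh hα0.le hα1 hH hs (by linarith))
  exact hasDerivWithinAt_Icc_of_right hT0 c1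
    ((continuous_gen F.cont c2).add hh.continuous.continuousOn)
    (fun t ht => F.hasDerivWithinAt_mild_right hh hg hg' hα0 hα1 hK hH ht.1.le
      (ht.2.le.trans hT1)) hs

lemma mild_zero (g : State D →ᵇ W) (h : ℝ → State D →ᵇ W) : F.mild g h 0 = g := by
  simp [mild, F.U_self]

/-- Classical solutions are mild solutions. -/
lemma eq_mild_of_hasDerivWithinAt (hh : IsSource M L h) {w : ℝ → State D →ᵇ W}
    {p : ℝ → State D →ᵇ Jet D W} {q : ℝ → State D →ᵇ Jet D (Jet D W)} {α K P T : ℝ}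
    (hα : 0 < α) (hK : 0 ≤ K) (hP : 0 ≤ P)
    (hw : ∀ t ∈ Set.Icc 0 T, ∀ x, HasFDerivAt (w t) (p t x) x)
    (hp : ∀ t ∈ Set.Icc 0 T, ∀ x, HasFDerivAt (p t) (q t x) x)
    (hq : ∀ t ∈ Set.Icc 0 T, IsHolder α K (q t)) (hpP : ∀ t ∈ Set.Icc 0 T, ‖p t‖ ≤ P)
    (hd : ∀ t ∈ Set.Icc 0 T,
      HasDerivWithinAt w (gen (F.A t) (q t) + h t) (Set.Icc 0 T) t) {s : ℝ}
    (hs : s ∈ Set.Icc 0 T) : w s = F.mild (w 0) h s := by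
  have hlip : ∀ t ∈ Set.Icc 0 T, IsHolder 1 P (w t) := fun t ht =>
    isHolder_one_of_hasFDerivAt (hw t ht) fun x =>
      (BoundedContinuousFunction.norm_coe_le_norm _ x).trans (hpP t ht)
  have hsub : Set.Icc 0 s ⊆ Set.Icc 0 T := Set.Icc_subset_Icc_right hs.2
  have hwc : ContinuousOn w (Set.Icc 0 T) := fun t ht => (hd t ht).continuousWithinAt
  -- The curve r ↦ U(r,s)w(r) joins U(0,s)w(0) to w(s). Its right derivative is U(r,s)h(r), because
  -- the generator terms cancel; integrating it gives the mild formula.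
  have hφc : ContinuousOn (fun r => F.U r s (w r)) (Set.Icc 0 s) := by
    intro r₀ hr₀
    rw [ContinuousWithinAt, tendsto_iff_norm_sub_tendsto_zero]
    refine squeeze_zero' (g := fun r => ‖w r - w r₀‖ + P * (F.mom 1 * |r - r₀| ^ (1 / 2 : ℝ)))
      (.of_forall fun _ => norm_nonneg _) (eventually_nhdsWithin_of_forall fun r hr =>
        F.norm_U_sub_U_le hP (hlip r (hsub hr)) (hlip r₀ (hsub hr₀)) hr.2 hr₀.2) ?_
    have h1 := ((hwc.mono hsub r₀ hr₀).sub (continuousWithinAt_const (b := w r₀))).norm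
    have h2 : Continuous fun r => P * (F.mom 1 * |r - r₀| ^ (1 / 2 : ℝ)) :=
      continuous_const.mul (continuous_const.mul
        ((continuous_abs.comp (continuous_id.sub continuous_const)).rpow_const
          fun _ => Or.inr (by norm_num)))
    have h3 := Tendsto.add h1.tendsto (h2.continuousWithinAt (s := Set.Icc 0 s) (x := r₀)).tendsto
    simpa [Real.zero_rpow] using h3
  have hφd : ∀ r ∈ Set.Ioo 0 s, HasDerivWithinAt (fun r => F.U r s (w r)) (F.U r s (h r))
      (Set.Ioi r) r := fun r hr => by
    have hr0 : r ∈ Set.Icc 0 T := hsub ⟨hr.1.le, hr.2.le⟩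
    have hrT : r < T := hr.2.trans_le hs.2
    have d1 : HasDerivWithinAt w (gen (F.A r) (q r) + h r) (Set.Icc r s) r :=
      (hd r hr0).mono (Set.Icc_subset_Icc hr.1.le hs.2)
    have d2 : HasDerivWithinAt (fun t => F.U r t (w r)) (gen (F.A r) (q r)) (Set.Icc r s) r :=
      (F.hasDerivWithinAt_U (hw r hr0) (hp r hr0) hα hK (hq r hr0) r).mono
        fun t ht => ht.1
    have d3 : HasDerivWithinAt (fun t => w t - F.U r t (w r)) (h r) (Set.Icc r s) r :=
      (d1.sub d2).congr_deriv (by simp)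
    -- The argument is o(t − r), and the operators U(t,s), although varying with t, are
    -- contractions. No derivative of U(t,s) in its initial time is needed.
    have d4 : HasDerivWithinAt (fun t => F.U t s (w t - F.U r t (w r) - (t - r) • h r)) 0
        (Set.Icc r s) r := by
      rw [hasDerivWithinAt_iff_isLittleO] at d3 ⊢
      refine Asymptotics.IsBigO.trans_isLittleO (Asymptotics.IsBigO.of_bound 1 ?_) d3
      refine .of_forall fun t => ?_
      simp only [F.U_self, sub_self, zero_smul, map_zero, sub_zero, smul_zero, one_mul]
      exact F.norm_U_le _ _ _
    have d5 : HasDerivWithinAt (fun t => (t - r) • F.U t s (h r)) (F.U r s (h r))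
        (Set.Icc r s) r := by
      have hc : ContinuousWithinAt (fun t => F.U t s (h r)) (Set.Icc r s) r :=
        (F.continuousOn_U hh.lip_nonneg continuous_const (fun _ => hh.lipschitz r) s r
          hr.2.le).mono fun t ht => ht.2
      rw [hasDerivWithinAt_iff_isLittleO]
      have h1 : (fun t => F.U t s (h r) - F.U r s (h r)) =o[𝓝[Set.Icc r s] r] fun _ => (1 : ℝ) := by
        rw [Asymptotics.isLittleO_one_iff]
        simpa using hc.tendsto.sub_const (F.U r s (h r))
      refine ((Asymptotics.isBigO_refl (fun t => t - r) _).smul_isLittleO h1).congr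
        (fun t => ?_) fun t => by simp
      simp [smul_sub]
    have d6 := (d4.add d5).add_const (F.U r s (w r))
    rw [zero_add] at d6
    have d7 : HasDerivWithinAt (fun r => F.U r s (w r)) (F.U r s (h r)) (Set.Icc r s) r := by
      refine d6.congr_of_mem (fun t ht => ?_) ⟨le_rfl, hr.2.le⟩
      simp only [Pi.add_apply, map_sub, map_smul]
      rw [F.U_comp ht.1 ht.2]
      abel
    exact d7.mono_of_mem_nhdsWithin (mem_of_superset (Ioo_mem_nhdsGT hr.2)
      Set.Ioo_subset_Icc_self)
  have := intervalIntegral.integral_eq_sub_of_hasDeriv_right_of_le hs.1 hφc hφd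
    (F.intervalIntegrable_U hh hs.1)
  rw [mild, this, F.U_self]
  abel

end TimeDerivative

end Diffusion

/-! ### Bilinear nonlinearities in the gradient. -/

section Quadratic

variable {D : ℕ} {W : Type*} [NormedAddCommGroup W] [NormedSpace ℝ W]

variable (D W) in
/-- The space of continuous bilinear maps on first derivatives. -/
def Quad : Type _ := Jet D W →L[ℝ] Jet D W →L[ℝ] W

noncomputable instance : NormedAddCommGroup (Quad D W) :=
  inferInstanceAs (NormedAddCommGroup (Jet D W →L[ℝ] Jet D W →L[ℝ] W))

noncomputable instance : NormedSpace ℝ (Quad D W) :=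
  inferInstanceAs (NormedSpace ℝ (Jet D W →L[ℝ] Jet D W →L[ℝ] W))

noncomputable instance : FunLike (Quad D W) (Jet D W) (Jet D W →L[ℝ] W) :=
  inferInstanceAs (FunLike (Jet D W →L[ℝ] Jet D W →L[ℝ] W) (Jet D W) (Jet D W →L[ℝ] W))

lemma norm_quad_apply_le (B : Quad D W) (a b : Jet D W) : ‖B a b‖ ≤ ‖B‖ * ‖a‖ * ‖b‖ :=
  ContinuousLinearMap.le_opNorm₂ (show Jet D W →L[ℝ] Jet D W →L[ℝ] W from B) a b

lemma quad_sub_left (B : Quad D W) (a b c : Jet D W) : B (a - b) c = B a c - B b c :=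
  congrArg (fun T : Jet D W →L[ℝ] W => T c)
    (map_sub (show Jet D W →L[ℝ] Jet D W →L[ℝ] W from B) a b)

lemma norm_quad_sub_quad_le (B B' : Quad D W) (a b : Jet D W) :
    ‖B a a - B' b b‖ ≤ ‖B - B'‖ * ‖a‖ ^ 2 + ‖B'‖ * (‖a‖ + ‖b‖) * ‖a - b‖ := by
  have e0 : (B - B') a a = B a a - B' a a := rfl
  have e : B a a - B' b b = (B - B') a a + (B' a (a - b) + B' (a - b) b) := by
    rw [e0, quad_sub_left, map_sub]
    abel
  rw [e]
  calc _ ≤ ‖(B - B') a a‖ + (‖B' a (a - b)‖ + ‖B' (a - b) b‖) :=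
        (norm_add_le _ _).trans (add_le_add le_rfl (norm_add_le _ _))
    _ ≤ ‖B - B'‖ * ‖a‖ * ‖a‖ + (‖B'‖ * ‖a‖ * ‖a - b‖ + ‖B'‖ * ‖a - b‖ * ‖b‖) := by
        gcongr <;> exact norm_quad_apply_le _ _ _
    _ = _ := by ring

/-- The function `x ↦ B (p x) (p x)`. -/
noncomputable def quadFun (B : Quad D W) (p : State D →ᵇ Jet D W) :
    State D →ᵇ W :=
  BoundedContinuousFunction.ofNormedAddCommGroup (fun x => B (p x) (p x))
    (((show Jet D W →L[ℝ] Jet D W →L[ℝ] W from B).continuous.comp p.continuous).clm_apply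
      p.continuous) (‖B‖ * ‖p‖ * ‖p‖) fun x =>
    (norm_quad_apply_le B _ _).trans (by gcongr <;> exact p.norm_coe_le_norm x)

lemma quadFun_apply (B : Quad D W) (p : State D →ᵇ Jet D W) (x : State D) :
    quadFun B p x = B (p x) (p x) := rfl

lemma norm_quadFun_le {B : Quad D W} {p : State D →ᵇ Jet D W} {κ R : ℝ}
    (hB : ‖B‖ ≤ κ) (hp : ‖p‖ ≤ R) : ‖quadFun B p‖ ≤ κ * R ^ 2 := by
  have hR : 0 ≤ R := (norm_nonneg _).trans hp
  have hκ : 0 ≤ κ := (norm_nonneg _).trans hB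
  refine (BoundedContinuousFunction.norm_le (by positivity)).2 fun x => ?_
  calc _ ≤ ‖B‖ * ‖p x‖ * ‖p x‖ := norm_quad_apply_le B _ _
    _ ≤ κ * R * R := by gcongr <;> exact (p.norm_coe_le_norm x).trans hp
    _ = _ := by ring

lemma norm_quadFun_sub_le (B B' : Quad D W) (p p' : State D →ᵇ Jet D W) :
    ‖quadFun B p - quadFun B' p'‖ ≤
      ‖B - B'‖ * ‖p‖ ^ 2 + ‖B'‖ * (‖p‖ + ‖p'‖) * ‖p - p'‖ := by
  refine (BoundedContinuousFunction.norm_le (by positivity)).2 fun x => ?_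
  refine (norm_quad_sub_quad_le B B' (p x) (p' x)).trans ?_
  gcongr
  · exact p.norm_coe_le_norm x
  · exact p.norm_coe_le_norm x
  · exact p'.norm_coe_le_norm x
  · exact (p - p').norm_coe_le_norm x

lemma quadFun_isHolder_one {B : Quad D W} {p : State D →ᵇ Jet D W}
    {κ R L : ℝ} (hB : ‖B‖ ≤ κ) (hp : ‖p‖ ≤ R) (hL : IsHolder 1 L p) :
    IsHolder 1 (2 * κ * R * L) (quadFun B p) := isHolder_one_iff.2 fun x y => by
  have hR : 0 ≤ R := (norm_nonneg _).trans hp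
  have hκ : 0 ≤ κ := (norm_nonneg _).trans hB
  have h1 := norm_quad_sub_quad_le B B (p x) (p y)
  rw [sub_self, norm_zero, zero_mul, zero_add] at h1
  calc _ ≤ ‖B‖ * (‖p x‖ + ‖p y‖) * ‖p x - p y‖ := h1
    _ ≤ κ * (R + R) * (L * ‖x - y‖) := by
      gcongr
      · exact (p.norm_coe_le_norm x).trans hp
      · exact (p.norm_coe_le_norm y).trans hp
      · exact isHolder_one_iff.1 hL x y
    _ = _ := by ring

lemma continuous_quadFun {B : ℝ → Quad D W} {p : ℝ → State D →ᵇ Jet D W}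
    (hB : Continuous B) (hp : Continuous p) : Continuous fun t => quadFun (B t) (p t) := by
  refine continuous_iff_continuousAt.2 fun s => ?_
  rw [ContinuousAt, tendsto_iff_norm_sub_tendsto_zero]
  refine squeeze_zero (fun _ => norm_nonneg _)
    (fun t => norm_quadFun_sub_le (B t) (B s) (p t) (p s)) ?_
  have h1 : Continuous fun t => ‖B t - B s‖ * ‖p t‖ ^ 2 +
    ‖B s‖ * (‖p t‖ + ‖p s‖) * ‖p t - p s‖ := by fun_prop
  simpa using h1.tendsto s

end Quadratic

/-! ### The integral equation for the gradient: fixed point and uniqueness. -/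

namespace Diffusion

variable {D : ℕ} (F : Diffusion D) {W : Type*} [NormedAddCommGroup W] [NormedSpace ℝ W]
  [CompleteSpace W]

lemma isSource_quadFun {B : ℝ → Quad D W} {p : ℝ → State D →ᵇ Jet D W}
    {κ R L : ℝ} (hL0 : 0 ≤ L) (hB : Continuous B) (hp : Continuous p) (hBκ : ∀ t, ‖B t‖ ≤ κ)
    (hpR : ∀ t, ‖p t‖ ≤ R) (hpL : ∀ t, IsHolder 1 L (p t)) :
    IsSource (κ * R ^ 2) (2 * κ * R * L) (fun t => quadFun (B t) (p t)) where
  bound_nonneg := by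
    have hκ : 0 ≤ κ := (norm_nonneg _).trans (hBκ 0)
    positivity
  lip_nonneg := by
    have hκ : 0 ≤ κ := (norm_nonneg _).trans (hBκ 0)
    have hR : 0 ≤ R := (norm_nonneg _).trans (hpR 0)
    positivity
  continuous := continuous_quadFun hB hp
  bound := fun t => norm_quadFun_le (hBκ t) (hpR t)
  lipschitz := fun t => quadFun_isHolder_one (hBκ t) (hpR t) (hpL t)

/-- Where the sources agree nothing is contributed, so only the length s − a enters. With a = 0 this
gives the contraction; with a > 0 it lets uniqueness march forward in time. -/
lemma norm_mildGrad_sub_mildGrad_le {M M' L L' : ℝ} {h h' : ℝ → State D →ᵇ W}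
    (hh : IsSource M L h) (hh' : IsSource M' L' h') (g' : State D →ᵇ Jet D W) {a s Δ : ℝ}
    (ha : 0 ≤ a) (has : a ≤ s) (heq : ∀ r ∈ Set.Ioo 0 a, h r = h' r)
    (hΔ : ∀ r ∈ Set.Ioo a s, ‖h r - h' r‖ ≤ Δ) :
    ‖F.mildGrad g' h s - F.mildGrad g' h' s‖ ≤ 2 * F.gradC * Δ * (s - a) ^ (1 / 2 : ℝ) := by
  have hs := ha.trans has
  rw [mildGrad, mildGrad, add_sub_add_left_eq_sub,
    ← intervalIntegral.integral_sub (F.intervalIntegrable_G hh hs) (F.intervalIntegrable_G hh' hs)]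
  simp only [← map_sub]
  have hi : ∀ {a : ℝ}, a ≤ s → IntervalIntegrable (fun r => F.G r s (h r - h' r)) volume a s :=
    fun {a} has => by
      simpa only [map_sub] using
        (F.intervalIntegrable_G hh has).sub (F.intervalIntegrable_G hh' has)
  have h0 : ∫ r in (0 : ℝ)..a, F.G r s (h r - h' r) = 0 := by
    refine intervalIntegral.integral_zero_ae ?_
    filter_upwards [compl_mem_ae_iff.2 (measure_singleton a)] with r hr hr2
    rw [Set.uIoc_of_le ha] at hr2
    rw [heq r ⟨hr2.1, lt_of_le_of_ne hr2.2 hr⟩, sub_self, map_zero]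
  rw [← intervalIntegral.integral_add_adjacent_intervals
    (intervalIntegrable_sub_of_le ha has (hi hs)) (hi has), h0, zero_add]
  have hc := F.gradC_nonneg
  have := norm_integral_le_of_singular (f := fun r => F.G r s (h r - h' r))
    (C := F.gradC * Δ) has (by norm_num : (-1 : ℝ) < -(1 / 2))
    fun r hr => by
      have h1 : 0 ≤ (s - r) ^ (-(1 / 2) : ℝ) := Real.rpow_nonneg (by linarith [hr.2]) _
      calc _ ≤ F.gradC * (s - r) ^ (-(1 / 2) : ℝ) * ‖h r - h' r‖ := F.norm_G_le _ _ _
        _ ≤ F.gradC * (s - r) ^ (-(1 / 2) : ℝ) * Δ := by gcongr; exact hΔ r hr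
        _ = _ := by ring
  rw [rpow_half_div] at this
  linarith

/-- Existence of the gradient of a mild solution of the equation with quadratic source. -/
lemma exists_mildGrad_eq {B : ℝ → Quad D W} (hB : Continuous B) {κ : ℝ}
    (hBκ : ∀ t, ‖B t‖ ≤ κ) {g' : State D →ᵇ Jet D W} {L₀ : ℝ} (hL₀ : 0 ≤ L₀)
    (hg' : IsHolder 1 L₀ g') {T : ℝ} (hT : 0 ≤ T)
    (hsmall : 8 * F.gradC * κ * (‖g'‖ + 1) * (‖g'‖ + L₀ + 3) * T ^ (1 / 2 : ℝ) ≤ 1 / 2) :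
    ∃ p : ℝ → State D →ᵇ Jet D W, Continuous p ∧ (∀ t, ‖p t‖ ≤ ‖g'‖ + 1) ∧
      (∀ t, IsHolder 1 (L₀ + 1) (p t)) ∧
      ∀ s ∈ Set.Icc 0 T, p s = F.mildGrad g' (fun r => quadFun (B r) (p r)) s := by
  have hκ : 0 ≤ κ := (norm_nonneg _).trans (hBκ 0)
  have hc := F.gradC_nonneg
  set R := ‖g'‖ + 1 with hR
  set L := L₀ + 1 with hL
  have hR0 : 0 < R := by positivity
  have hL0 : 0 < L := by positivity
  have hTs : 0 ≤ T ^ (1 / 2 : ℝ) := Real.rpow_nonneg hT _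
  -- The single smallness condition is used three times: to keep the sup norm below R, to keep the
  -- Lipschitz constant below L, and to get the contraction factor 1/2.
  have hsm1 : 2 * F.gradC * (κ * R ^ 2) * T ^ (1 / 2 : ℝ) ≤ 1 := by
    have : 2 * F.gradC * (κ * R ^ 2) * T ^ (1 / 2 : ℝ) ≤
        8 * F.gradC * κ * R * (‖g'‖ + L₀ + 3) * T ^ (1 / 2 : ℝ) := by
      have h1 : R ≤ ‖g'‖ + L₀ + 3 := by rw [hR]; linarith
      calc _ = 2 * F.gradC * κ * R * R * T ^ (1 / 2 : ℝ) := by ring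
        _ ≤ _ := by gcongr; norm_num
    linarith
  have hsm2 : 4 * F.gradC * (2 * κ * R * L) * T ^ (1 / 2 : ℝ) ≤ 1 := by
    have : 4 * F.gradC * (2 * κ * R * L) * T ^ (1 / 2 : ℝ) ≤
        8 * F.gradC * κ * R * (‖g'‖ + L₀ + 3) * T ^ (1 / 2 : ℝ) := by
      have h1 : L ≤ ‖g'‖ + L₀ + 3 := by rw [hL]; linarith [norm_nonneg g']
      calc _ = 8 * F.gradC * κ * R * L * T ^ (1 / 2 : ℝ) := by ring
        _ ≤ _ := by gcongr
    linarith
  have hsm3 : 2 * F.gradC * (2 * κ * R) * T ^ (1 / 2 : ℝ) ≤ 1 / 2 := by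
    refine le_trans ?_ hsmall
    have h1 : 1 ≤ ‖g'‖ + L₀ + 3 := by linarith [norm_nonneg g']
    calc _ = 4 * F.gradC * κ * R * 1 * T ^ (1 / 2 : ℝ) := by ring
      _ ≤ _ := by gcongr; norm_num
  -- The metric is the sup norm alone; the Lipschitz bound is a constraint closed under pointwise
  -- limits. So the contraction estimate never has to compare Lipschitz constants.
  let 𝒦 : Set C(Set.Icc (0 : ℝ) T, State D →ᵇ Jet D W) :=
    {p | ∀ s, ‖p s‖ ≤ R ∧ IsHolder 1 L (p s)}
  have h𝒦 : IsClosed 𝒦 := by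
    have : 𝒦 = ⋂ s, {p | ‖p s‖ ≤ R} ∩ ⋂ x, ⋂ y, {p | ‖p s x - p s y‖ ≤ L * ‖x - y‖ ^ (1 : ℝ)} := by
      ext p
      simp [𝒦, IsHolder]
    rw [this]
    have hev : ∀ s, Continuous fun p : C(Set.Icc (0 : ℝ) T, State D →ᵇ Jet D W) => p s :=
      fun s => continuous_eval_const s
    have hevx : ∀ s x, Continuous fun p : C(Set.Icc (0 : ℝ) T, State D →ᵇ Jet D W) => p s x :=
      fun s x => (BoundedContinuousFunction.evalCLM (β := Jet D W) ℝ x).continuous.comp (hev s)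
    exact isClosed_iInter fun s => (isClosed_le (hev s).norm continuous_const).inter
      (isClosed_iInter fun x => isClosed_iInter fun y =>
        isClosed_le ((hevx s x).sub (hevx s y)).norm continuous_const)
  let ext : C(Set.Icc (0 : ℝ) T, State D →ᵇ Jet D W) → ℝ → State D →ᵇ Jet D W :=
    fun p => Set.IccExtend hT p
  have hext : ∀ p, Continuous (ext p) := fun p => p.continuous.Icc_extend'
  have hextR : ∀ p ∈ 𝒦, ∀ t, ‖ext p t‖ ≤ R := fun p hp t => (hp _).1
  have hextL : ∀ p ∈ 𝒦, ∀ t, IsHolder 1 L (ext p t) := fun p hp t => (hp _).2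
  let src : C(Set.Icc (0 : ℝ) T, State D →ᵇ Jet D W) → ℝ → State D →ᵇ W :=
    fun p r => quadFun (B r) (ext p r)
  have hsrc : ∀ p ∈ 𝒦, IsSource (κ * R ^ 2) (2 * κ * R * L) (src p) := fun p hp =>
    isSource_quadFun hL0.le hB (hext p) hBκ (hextR p hp) (hextL p hp)
  have hTmono : ∀ s ∈ Set.Icc 0 T, s ^ (1 / 2 : ℝ) ≤ T ^ (1 / 2 : ℝ) := fun s hs =>
    Real.rpow_le_rpow hs.1 hs.2 (by norm_num)
  have hbd : ∀ p ∈ 𝒦, ∀ s ∈ Set.Icc 0 T, ‖F.mildGrad g' (src p) s‖ ≤ R := fun p hp s hs => by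
    refine (F.norm_mildGrad_le (hsrc p hp) g' hs.1).trans ?_
    have : 2 * F.gradC * (κ * R ^ 2) * s ^ (1 / 2 : ℝ) ≤
        2 * F.gradC * (κ * R ^ 2) * T ^ (1 / 2 : ℝ) :=
      mul_le_mul_of_nonneg_left (hTmono s hs) (by positivity)
    linarith
  have hlip : ∀ p ∈ 𝒦, ∀ s ∈ Set.Icc 0 T, IsHolder 1 L (F.mildGrad g' (src p) s) :=
    fun p hp s hs => by
      refine (F.mildGrad_isHolder_one (hsrc p hp) hg' hs.1).mono ?_
      have : 4 * F.gradC * (2 * κ * R * L) * s ^ (1 / 2 : ℝ) ≤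
          4 * F.gradC * (2 * κ * R * L) * T ^ (1 / 2 : ℝ) :=
        mul_le_mul_of_nonneg_left (hTmono s hs) (by positivity)
      linarith
  have hcont : ∀ p ∈ 𝒦, ContinuousOn (F.mildGrad g' (src p)) (Set.Icc 0 T) := fun p hp =>
    continuousOn_of_holder_time (β := 1 / 2) (by norm_num) fun s t hs hst ht =>
      F.norm_mildGrad_sub_le (hsrc p hp) hL0.le hs hst (hlip p hp s ⟨hs, hst.trans ht⟩)
  let Ψ : 𝒦 → 𝒦 := fun p =>
    ⟨⟨fun s => F.mildGrad g' (src p) s, continuousOn_iff_continuous_domRestrict.1 (hcont p p.2)⟩,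
      fun s => ⟨hbd p p.2 s s.2, hlip p p.2 s s.2⟩⟩
  have hΨ : ContractingWith (1 / 2) Ψ := by
    refine ⟨by norm_num, LipschitzWith.of_dist_le_mul fun p p' => ?_⟩
    rw [Subtype.dist_eq, Subtype.dist_eq, ContinuousMap.dist_le (by positivity)]
    intro s
    rw [dist_eq_norm]
    have h1 := F.norm_mildGrad_sub_mildGrad_le (hsrc p p.2) (hsrc p' p'.2) g' (a := 0) le_rfl s.2.1
      (fun r hr => absurd (hr.1.trans hr.2) (lt_irrefl _))
      (Δ := 2 * κ * R * dist (p : C(Set.Icc (0 : ℝ) T, State D →ᵇ Jet D W)) p') fun r hr => by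
        have hr' : r ∈ Set.Icc 0 T := ⟨hr.1.le, hr.2.le.trans s.2.2⟩
        have h2 := norm_quadFun_sub_le (B r) (B r) (ext p r) (ext p' r)
        rw [sub_self, norm_zero, zero_mul, zero_add] at h2
        have h3 : ‖ext p r - ext p' r‖ ≤
            dist (p : C(Set.Icc (0 : ℝ) T, State D →ᵇ Jet D W)) p' := by
          rw [← dist_eq_norm]
          exact ContinuousMap.dist_apply_le_dist _
        calc _ ≤ ‖B r‖ * (‖ext p r‖ + ‖ext p' r‖) * ‖ext p r - ext p' r‖ := h2
          _ ≤ κ * (R + R) * dist (p : C(Set.Icc (0 : ℝ) T, State D →ᵇ Jet D W)) p' := by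
            gcongr
            · exact hBκ r
            · exact hextR p p.2 r
            · exact hextR p' p'.2 r
          _ = _ := by ring
    rw [sub_zero] at h1
    refine h1.trans ?_
    have hd : 0 ≤ dist (p : C(Set.Icc (0 : ℝ) T, State D →ᵇ Jet D W)) p' := dist_nonneg
    calc _ = 2 * F.gradC * (2 * κ * R) * (s : ℝ) ^ (1 / 2 : ℝ) *
          dist (p : C(Set.Icc (0 : ℝ) T, State D →ᵇ Jet D W)) p' := by ring
      _ ≤ 2 * F.gradC * (2 * κ * R) * T ^ (1 / 2 : ℝ) *
          dist (p : C(Set.Icc (0 : ℝ) T, State D →ᵇ Jet D W)) p' := by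
        refine mul_le_mul_of_nonneg_right (mul_le_mul_of_nonneg_left (hTmono s s.2) ?_) hd
        positivity
      _ ≤ _ := by
        push_cast
        gcongr
  have : CompleteSpace 𝒦 := h𝒦.completeSpace_coe
  have : Nonempty 𝒦 := ⟨⟨0, fun s => ⟨by simpa using hR0.le, fun x y => by
    simpa using mul_nonneg hL0.le (norm_nonneg _)⟩⟩⟩
  set p := hΨ.fixedPoint Ψ with hp
  have hfix : Ψ p = p := hΨ.fixedPoint_isFixedPt
  refine ⟨ext p, hext p, hextR p p.2, hextL p p.2, fun s hs => ?_⟩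
  have h1 : ext p s = (p : C(Set.Icc (0 : ℝ) T, State D →ᵇ Jet D W)) ⟨s, hs⟩ :=
    Set.IccExtend_of_mem hT _ hs
  rw [h1, ← hfix]
  -- The rewriting replaced p by Ψ p on both sides; the left one unfolds by definition and the right
  -- one is folded back.
  change F.mildGrad g' (src p) s = F.mildGrad g' (src (Ψ p)) s
  rw [hfix]

/-- Uniqueness of the gradient of a mild solution of the equation with quadratic source. -/
lemma mildGrad_unique {B : ℝ → Quad D W} {κ R : ℝ}
    (hBκ : ∀ t, ‖B t‖ ≤ κ) {g' : State D →ᵇ Jet D W} {p p' : ℝ → State D →ᵇ Jet D W}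
    {h h' : ℝ → State D →ᵇ W} {M M' L L' : ℝ} (hh : IsSource M L h) (hh' : IsSource M' L' h')
    {T : ℝ} (hT : 0 ≤ T)
    (hp : ∀ s ∈ Set.Icc 0 T, p s = F.mildGrad g' h s)
    (hp' : ∀ s ∈ Set.Icc 0 T, p' s = F.mildGrad g' h' s)
    (hpR : ∀ s ∈ Set.Icc 0 T, ‖p s‖ ≤ R) (hpR' : ∀ s ∈ Set.Icc 0 T, ‖p' s‖ ≤ R)
    (hhp : ∀ s ∈ Set.Icc 0 T, h s = quadFun (B s) (p s))
    (hhp' : ∀ s ∈ Set.Icc 0 T, h' s = quadFun (B s) (p' s)) :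
    ∀ s ∈ Set.Icc 0 T, p s = p' s := by
  have hκ : 0 ≤ κ := (norm_nonneg _).trans (hBκ 0)
  have hc := F.gradC_nonneg
  have hR0 : 0 ≤ R := (norm_nonneg _).trans (hpR 0 ⟨le_rfl, hT⟩)
  -- A step length depending only on c, κ and R, so finitely many steps cover [0, T] however large T
  -- is.
  obtain ⟨η, hη, hηs⟩ : ∃ η : ℝ, 0 < η ∧ 2 * F.gradC * (2 * κ * R) * η ^ (1 / 2 : ℝ) ≤ 1 / 2 := by
    have h1 : Continuous fun η : ℝ => 2 * F.gradC * (2 * κ * R) * η ^ (1 / 2 : ℝ) :=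
      continuous_const.mul (continuous_id.rpow_const fun _ => Or.inr (by norm_num))
    have h2 := h1.tendsto 0
    rw [Real.zero_rpow (by norm_num), mul_zero] at h2
    have h3 : ∀ᶠ η in 𝓝[>] (0 : ℝ), 2 * F.gradC * (2 * κ * R) * η ^ (1 / 2 : ℝ) ≤ 1 / 2 :=
      (h2.mono_left nhdsWithin_le_nhds).eventually (ge_mem_nhds (by norm_num))
    obtain ⟨η, h4, h5⟩ := (h3.and self_mem_nhdsWithin).exists
    exact ⟨η, h5, h4⟩
  have hdiff : ∀ s ∈ Set.Icc 0 T, ‖h s - h' s‖ ≤ 2 * κ * R * ‖p s - p' s‖ := fun s hs => by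
    rw [hhp s hs, hhp' s hs]
    have h2 := norm_quadFun_sub_le (B s) (B s) (p s) (p' s)
    rw [sub_self, norm_zero, zero_mul, zero_add] at h2
    calc _ ≤ ‖B s‖ * (‖p s‖ + ‖p' s‖) * ‖p s - p' s‖ := h2
      _ ≤ κ * (R + R) * ‖p s - p' s‖ := by
        gcongr
        · exact hBκ s
        · exact hpR s hs
        · exact hpR' s hs
      _ = _ := by ring
  have hstep : ∀ n : ℕ, ∀ s ∈ Set.Icc 0 T, s ≤ n * η → p s = p' s := by
    intro n
    induction n with
    | zero =>
      intro s hs hsn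
      have : s = 0 := le_antisymm (by simpa using hsn) hs.1
      subst this
      rw [hp 0 hs, hp' 0 hs]
      simp [mildGrad]
    | succ n ih =>
      have ha : 0 ≤ n * η := by positivity
      -- On the next interval the integral inequality halves any uniform bound for the difference;
      -- starting from 2R and iterating, the difference is zero.
      have hhalf : ∀ m : ℕ, ∀ s ∈ Set.Icc 0 T, s ≤ (n + 1) * η →
          ‖p s - p' s‖ ≤ 2 * R * (1 / 2) ^ m := by
        intro m
        induction m with
        | zero =>
          intro s hs _
          have := norm_sub_le (p s) (p' s)
          linarith [hpR s hs, hpR' s hs]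
        | succ m ihm =>
          intro s hs hsn
          rcases le_total s (n * η) with hs' | hs'
          · rw [ih s hs hs', sub_self, norm_zero]; positivity
          rw [hp s hs, hp' s hs]
          refine (F.norm_mildGrad_sub_mildGrad_le hh hh' g' ha hs'
            (Δ := 2 * κ * R * (2 * R * (1 / 2) ^ m)) (fun r hr => ?_) fun r hr => ?_).trans ?_
          · have hr' : r ∈ Set.Icc 0 T := ⟨hr.1.le, hr.2.le.trans (hs'.trans hs.2)⟩
            rw [hhp r hr', hhp' r hr', ih r hr' hr.2.le]
          · have hr' : r ∈ Set.Icc 0 T := ⟨ha.trans hr.1.le, hr.2.le.trans hs.2⟩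
            refine (hdiff r hr').trans ?_
            gcongr
            exact ihm r hr' (hr.2.le.trans hsn)
          · have h1 : (s - n * η) ^ (1 / 2 : ℝ) ≤ η ^ (1 / 2 : ℝ) :=
              Real.rpow_le_rpow (sub_nonneg.2 hs') (by linarith) (by norm_num)
            calc _ ≤ 2 * F.gradC * (2 * κ * R * (2 * R * (1 / 2) ^ m)) * η ^ (1 / 2 : ℝ) := by
                  gcongr
              _ = 2 * F.gradC * (2 * κ * R) * η ^ (1 / 2 : ℝ) * (2 * R * (1 / 2) ^ m) := by ring
              _ ≤ 1 / 2 * (2 * R * (1 / 2) ^ m) := by gcongr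
              _ = _ := by ring
      intro s hs hsn
      push_cast at hsn
      rw [← sub_eq_zero, ← norm_le_zero_iff]
      have hlim : Tendsto (fun m : ℕ => 2 * R * (1 / 2 : ℝ) ^ m) atTop (𝓝 (2 * R * 0)) :=
        (tendsto_pow_atTop_nhds_zero_of_lt_one (by norm_num) (by norm_num)).const_mul _
      rw [mul_zero] at hlim
      exact ge_of_tendsto' hlim fun m => hhalf m s hs hsn
  intro s hs
  obtain ⟨n, hn⟩ := exists_nat_ge (s / η)
  exact hstep n s hs ((div_le_iff₀ hη).1 hn)

end Diffusion

/-! ### Hölder continuity in time. -/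

section HolderTime

variable {V : Type*} [NormedAddCommGroup V] [NormedSpace ℝ V]

/-- `f` is `β`-Hölder continuous in time on `[0, T]`. -/
def HolderTime (β T : ℝ) (f : ℝ → V) : Prop :=
  ∃ K, 0 ≤ K ∧ ∀ s ∈ Set.Icc 0 T, ∀ t ∈ Set.Icc 0 T, ‖f s - f t‖ ≤ K * |s - t| ^ β

variable {β T : ℝ} {f k : ℝ → V}

lemma holderTime_const (v : V) : HolderTime β T fun _ => v :=
  ⟨0, le_rfl, fun s _ t _ => by simp⟩

lemma HolderTime.add (hf : HolderTime β T f) (hk : HolderTime β T k) :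
    HolderTime β T fun t => f t + k t := by
  obtain ⟨K, hK, h⟩ := hf
  obtain ⟨K', hK', h'⟩ := hk
  refine ⟨K + K', by positivity, fun s hs t ht => ?_⟩
  rw [add_sub_add_comm, add_mul]
  exact (norm_add_le _ _).trans (add_le_add (h s hs t ht) (h' s hs t ht))

lemma HolderTime.sum {ι : Type*} (S : Finset ι) {f : ι → ℝ → V}
    (hf : ∀ i ∈ S, HolderTime β T (f i)) : HolderTime β T fun t => ∑ i ∈ S, f i t := by
  classical
  induction S using Finset.induction_on with
  | empty => simpa using holderTime_const (0 : V)
  | insert i S hi ih =>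
    simp only [Finset.sum_insert hi]
    exact (hf i (Finset.mem_insert_self i S)).add
      (ih fun j hj => hf j (Finset.mem_insert_of_mem hj))

lemma HolderTime.bounded (hβ : 0 ≤ β) (hf : HolderTime β T f) :
    ∃ R, 0 ≤ R ∧ ∀ t ∈ Set.Icc 0 T, ‖f t‖ ≤ R := by
  obtain ⟨K, hK, h⟩ := hf
  refine ⟨‖f 0‖ + K * |T| ^ β, by positivity, fun t ht => ?_⟩
  calc ‖f t‖ = ‖f 0 + (f t - f 0)‖ := by congr 1; abel
    _ ≤ ‖f 0‖ + K * |t - 0| ^ β := (norm_add_le _ _).trans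
      (add_le_add le_rfl (h t ht 0 ⟨le_rfl, ht.1.trans ht.2⟩))
    _ ≤ _ := by
      have : |t - 0| ≤ |T| := by
        rw [sub_zero, abs_of_nonneg ht.1, abs_of_nonneg (ht.1.trans ht.2)]; exact ht.2
      gcongr

lemma HolderTime.continuousOn (hβ : 0 < β) (hf : HolderTime β T f) :
    ContinuousOn f (Set.Icc 0 T) := by
  obtain ⟨K, hK, h⟩ := hf
  refine continuousOn_of_holder_time (C := K) hβ fun s t hs hst ht => ?_
  have := h t ⟨hs.trans hst, ht⟩ s ⟨hs, hst.trans ht⟩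
  rwa [abs_of_nonneg (sub_nonneg.2 hst)] at this

lemma HolderTime.of_bilin {V₁ V₂ : Type*} [NormedAddCommGroup V₁] [NormedSpace ℝ V₁]
    [NormedAddCommGroup V₂] [NormedSpace ℝ V₂] {f : ℝ → V₁} {k : ℝ → V₂}
    (m : V₁ → V₂ → V) (c : ℝ) (hc : 0 ≤ c)
    (hm : ∀ a b a' b', ‖m a b - m a' b'‖ ≤ c * (‖a - a'‖ * ‖b‖ + ‖a'‖ * ‖b - b'‖))
    (hβ : 0 ≤ β) (hf : HolderTime β T f) (hk : HolderTime β T k) :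
    HolderTime β T fun t => m (f t) (k t) := by
  obtain ⟨R, hR, hb⟩ := hf.bounded hβ
  obtain ⟨R', hR', hb'⟩ := hk.bounded hβ
  obtain ⟨K, hK, h⟩ := hf
  obtain ⟨K', hK', h'⟩ := hk
  refine ⟨c * (K * R' + R * K'), by positivity, fun s hs t ht => (hm _ _ _ _).trans ?_⟩
  calc _ ≤ c * (K * |s - t| ^ β * R' + R * (K' * |s - t| ^ β)) := by
        gcongr
        · exact h s hs t ht
        · exact hb' s hs
        · exact hb t ht
        · exact h' s hs t ht
    _ = _ := by ring

lemma HolderTime.smul {k : ℝ → ℝ} (hβ : 0 ≤ β) (hk : HolderTime β T k) (hf : HolderTime β T f) :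
    HolderTime β T fun t => k t • f t := by
  refine HolderTime.of_bilin (fun a b => a • b) 1 zero_le_one (fun a b a' b' => ?_) hβ hk hf
  rw [one_mul, show a • b - a' • b' = (a - a') • b + a' • (b - b') by
    rw [sub_smul, smul_sub]; abel]
  exact (norm_add_le _ _).trans (by rw [norm_smul, norm_smul])

lemma HolderTime.clm {V' : Type*} [NormedAddCommGroup V'] [NormedSpace ℝ V'] (A : V →L[ℝ] V')
    (hf : HolderTime β T f) : HolderTime β T fun t => A (f t) := by
  obtain ⟨K, hK, h⟩ := hf
  refine ⟨‖A‖ * K, by positivity, fun s hs t ht => ?_⟩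
  rw [← map_sub, mul_assoc]
  exact (A.le_opNorm _).trans (by gcongr; exact h s hs t ht)

lemma HolderTime.of_le {β' : ℝ} (hT : T ≤ 1) (hβ : 0 ≤ β') (hββ' : β' ≤ β)
    (hf : HolderTime β T f) : HolderTime β' T f := by
  obtain ⟨K, hK, h⟩ := hf
  refine ⟨K, hK, fun s hs t ht => (h s hs t ht).trans ?_⟩
  gcongr 1
  refine Real.rpow_le_rpow_of_exponent_ge_of_imp (abs_nonneg _) ?_ hββ' (fun _ h0 => ?_)
  · rw [abs_le]; constructor <;> linarith [hs.1, hs.2, ht.1, ht.2]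
  · linarith

lemma holderTime_of_hasDerivWithinAt {f' : ℝ → V} {R : ℝ}
    (hT : T ≤ 1) (hβ : 0 ≤ β) (hβ1 : β ≤ 1)
    (hd : ∀ t ∈ Set.Icc 0 T, HasDerivWithinAt f (f' t) (Set.Icc 0 T) t) (hR : 0 ≤ R)
    (hb : ∀ t ∈ Set.Icc 0 T, ‖f' t‖ ≤ R) : HolderTime β T f := by
  refine HolderTime.of_le (β := 1) hT hβ hβ1 ⟨R, hR, fun s hs t ht => ?_⟩
  rw [Real.rpow_one]
  exact (convex_Icc 0 T).norm_image_sub_le_of_norm_hasDerivWithin_le hd hb ht hs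

end HolderTime

/-! ### Interpolation of the gradient between the function and its Hessian. -/

section Interpolation

variable {D : ℕ} {W : Type*} [NormedAddCommGroup W] [NormedSpace ℝ W]

lemma norm_jet_le_of_unit {B : Jet D W} {R : ℝ} (hR : 0 ≤ R)
    (h : ∀ v : State D, ‖v‖ = 1 → ‖B v‖ ≤ R) : ‖B‖ ≤ R :=
  ContinuousLinearMap.opNorm_le_of_unit_norm (𝕜 := ℝ) (f := (show State D →L[ℝ] W from B)) hR h

/-- The first derivative is controlled by the function and its second derivative. -/
lemma norm_grad_le {φ : State D →ᵇ W} {φ' : State D →ᵇ Jet D W} {φ'' : State D →ᵇ Jet D (Jet D W)}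
    (h1 : ∀ x, HasFDerivAt φ (φ' x) x) (h2 : ∀ x, HasFDerivAt φ' (φ'' x) x) :
    ‖φ'‖ ≤ 2 * ‖φ‖ + 2 * ‖φ''‖ := by
  refine (BoundedContinuousFunction.norm_le (by positivity)).2 fun x => ?_
  refine norm_jet_le_of_unit (by positivity) fun v hv => ?_
  have h3 := isHolder_one_iff.1 (isHolder_one_of_hasFDerivAt h2 φ''.norm_coe_le_norm)
  -- First-order expansion over a unit step; the ball of radius 2 serves to contain x + v and
  -- accounts for the factor 2.
  have h4 : ‖φ (x + v) - φ x - φ' x v‖ ≤ 2 * ‖φ''‖ := by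
    have := (convex_ball x 2).norm_image_sub_le_of_norm_hasFDerivWithin_le' (f := φ)
      (f' := φ') (φ := φ' x) (C := 2 * ‖φ''‖) (fun y _ => (h1 y).hasFDerivWithinAt)
      (fun y hy => (h3 y x).trans (by
        have : ‖y - x‖ ≤ 2 := by simpa [dist_eq_norm] using (Metric.mem_ball.1 hy).le
        calc _ ≤ ‖φ''‖ * 2 := by gcongr
          _ = _ := by ring))
      (Metric.mem_ball_self (by norm_num)) (y := x + v) (by simp [hv])
    rw [add_sub_cancel_left, hv, mul_one] at this
    exact this
  calc ‖φ' x v‖ = ‖(φ (x + v) - φ x) - (φ (x + v) - φ x - φ' x v)‖ := by congr 1; abel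
    _ ≤ (‖φ (x + v)‖ + ‖φ x‖) + 2 * ‖φ''‖ :=
      (norm_sub_le _ _).trans (add_le_add (norm_sub_le _ _) h4)
    _ ≤ _ := by
      linarith [φ.norm_coe_le_norm x, φ.norm_coe_le_norm (x + v), norm_nonneg φ'']

end Interpolation

/-! ### The semilinear forward equation: regularity, uniqueness, short-time existence. -/

namespace Diffusion

variable {D : ℕ} (F : Diffusion D) {W : Type*} [NormedAddCommGroup W] [NormedSpace ℝ W]

/-- Solutions `w`, with gradient `p` and Hessian `q`, of the evolution equation
`∂ₛ w = ½ tr (A ∂² w) + B (∂ w, ∂ w)` on `[0, T]`. -/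
structure IsForwardSol (B : ℝ → Quad D W) (α T : ℝ) (w : ℝ → State D →ᵇ W)
    (p : ℝ → State D →ᵇ Jet D W) (q : ℝ → State D →ᵇ Jet D (Jet D W)) : Prop where
  grad : ∀ t ∈ Set.Icc 0 T, ∀ x, HasFDerivAt (w t) (p t x) x
  hess : ∀ t ∈ Set.Icc 0 T, ∀ x, HasFDerivAt (p t) (q t x) x
  eqn : ∀ t ∈ Set.Icc 0 T,
    HasDerivWithinAt w (gen (F.A t) (q t) + quadFun (B t) (p t)) (Set.Icc 0 T) t
  holder : ∃ K, 0 ≤ K ∧ ∀ t ∈ Set.Icc 0 T, IsHolder α K (q t)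
  holderTime : HolderTime (α / 2) T q

namespace IsForwardSol

variable {F} {B : ℝ → Quad D W} {α T : ℝ} {w w' : ℝ → State D →ᵇ W}
    {p p' : ℝ → State D →ᵇ Jet D W} {q q' : ℝ → State D →ᵇ Jet D (Jet D W)}

lemma continuousOn (h : F.IsForwardSol B α T w p q) : ContinuousOn w (Set.Icc 0 T) :=
  fun t ht => (h.eqn t ht).continuousWithinAt

lemma norm_grad_sub_le (h : F.IsForwardSol B α T w p q) {s t : ℝ} (hs : s ∈ Set.Icc 0 T)
    (ht : t ∈ Set.Icc 0 T) : ‖p s - p t‖ ≤ 2 * ‖w s - w t‖ + 2 * ‖q s - q t‖ :=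
  norm_grad_le (fun x => (h.grad s hs x).sub (h.grad t ht x))
    (fun x => (h.hess s hs x).sub (h.hess t ht x))

/-- Time regularity of p is not part of the definition; it follows by interpolating between
increments of w and of q. -/
lemma continuousOn_grad (hα : 0 < α) (h : F.IsForwardSol B α T w p q) :
    ContinuousOn p (Set.Icc 0 T) := fun s hs => by
  rw [ContinuousWithinAt, tendsto_iff_norm_sub_tendsto_zero]
  refine squeeze_zero' (.of_forall fun _ => norm_nonneg _)
    (eventually_nhdsWithin_of_forall fun t ht => h.norm_grad_sub_le ht hs) ?_
  have h1 := ((h.continuousOn s hs).sub (continuousWithinAt_const (b := w s))).norm.tendsto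
  have h2 := ((h.holderTime.continuousOn (by linarith) s hs).sub
    (continuousWithinAt_const (b := q s))).norm.tendsto
  simpa using (h1.const_mul 2).add (h2.const_mul 2)

lemma bounded_grad (hα : 0 < α) (h : F.IsForwardSol B α T w p q) :
    ∃ R, 0 ≤ R ∧ ∀ t ∈ Set.Icc 0 T, ‖p t‖ ≤ R := by
  obtain ⟨R, hR⟩ := isCompact_Icc.exists_bound_of_continuousOn (h.continuousOn_grad hα)
  exact ⟨max R 0, le_max_right _ _, fun t ht => (hR t ht).trans (le_max_left _ _)⟩

lemma bounded_hess (hα : 0 < α) (h : F.IsForwardSol B α T w p q) :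
    ∃ R, 0 ≤ R ∧ ∀ t ∈ Set.Icc 0 T, ‖q t‖ ≤ R := h.holderTime.bounded (by linarith)

variable [CompleteSpace W]

/-- The time derivative is continuous on a compact interval, hence bounded; so w is Lipschitz in
time, which for T ≤ 1 is stronger than exponent α/2. -/
lemma holderTime_sol (hα : 0 < α) (hα1 : α < 1) (hT : T ≤ 1) (hB : Continuous B)
    (h : F.IsForwardSol B α T w p q) : HolderTime (α / 2) T w := by
  have h1 : ContinuousOn (fun t => gen (F.A t) (q t) + quadFun (B t) (p t)) (Set.Icc 0 T) := by
    refine (continuous_gen F.cont (h.holderTime.continuousOn (by linarith))).add ?_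
    intro s hs
    rw [ContinuousWithinAt, tendsto_iff_norm_sub_tendsto_zero]
    refine squeeze_zero (fun _ => norm_nonneg _)
      (fun t => norm_quadFun_sub_le (B t) (B s) (p t) (p s)) ?_
    have hp := h.continuousOn_grad hα s hs
    have h1 : ContinuousWithinAt (fun t => ‖B t - B s‖ * ‖p t‖ ^ 2 +
        ‖B s‖ * (‖p t‖ + ‖p s‖) * ‖p t - p s‖) (Set.Icc 0 T) s :=
      (((hB.continuousWithinAt.sub continuousWithinAt_const).norm).mul (hp.norm.pow 2)).add
        ((continuousWithinAt_const.mul (hp.norm.add continuousWithinAt_const)).mul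
          (hp.sub continuousWithinAt_const).norm)
    simpa using h1.tendsto
  obtain ⟨R, hR⟩ := isCompact_Icc.exists_bound_of_continuousOn h1
  exact holderTime_of_hasDerivWithinAt hT (by linarith) (by linarith) h.eqn (le_max_right R 0)
    fun t ht => (hR t ht).trans (le_max_left _ _)

lemma holderTime_grad (hα : 0 < α) (hα1 : α < 1) (hT : T ≤ 1) (hB : Continuous B)
    (h : F.IsForwardSol B α T w p q) : HolderTime (α / 2) T p := by
  obtain ⟨K, hK, h1⟩ := h.holderTime_sol hα hα1 hT hB
  obtain ⟨K', hK', h2⟩ := h.holderTime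
  refine ⟨2 * K + 2 * K', by positivity, fun s hs t ht => (h.norm_grad_sub_le hs ht).trans ?_⟩
  linarith [h1 s hs t ht, h2 s hs t ht]

lemma holderTime_quadFun (hα : 0 < α) (hα1 : α < 1) (hT : T ≤ 1) (hB : Continuous B)
    (hBH : HolderTime (α / 2) T B) (h : F.IsForwardSol B α T w p q) :
    HolderTime (α / 2) T fun t => quadFun (B t) (p t) := by
  obtain ⟨R, hR, hpR⟩ := h.bounded_grad hα
  obtain ⟨κ, hκ, hBκ⟩ := hBH.bounded (by linarith)
  obtain ⟨K, hK, h1⟩ := h.holderTime_grad hα hα1 hT hB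
  obtain ⟨K', hK', h2⟩ := hBH
  refine ⟨K' * R ^ 2 + κ * (R + R) * K, by positivity, fun s hs t ht => ?_⟩
  calc _ ≤ ‖B s - B t‖ * ‖p s‖ ^ 2 + ‖B t‖ * (‖p s‖ + ‖p t‖) * ‖p s - p t‖ :=
        norm_quadFun_sub_le _ _ _ _
    _ ≤ K' * |s - t| ^ (α / 2) * R ^ 2 + κ * (R + R) * (K * |s - t| ^ (α / 2)) := by
        gcongr
        · exact h2 s hs t ht
        · exact hpR s hs
        · exact hBκ t ht
        · exact hpR s hs
        · exact hpR t ht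
        · exact h1 s hs t ht
    _ = _ := by ring

lemma grad_isHolder_one (h : F.IsForwardSol B α T w p q) {R t : ℝ} (ht : t ∈ Set.Icc 0 T)
    (hR : ‖q t‖ ≤ R) : IsHolder 1 R (p t) :=
  isHolder_one_of_hasFDerivAt (h.hess t ht) fun x => ((q t).norm_coe_le_norm x).trans hR

/-- Sources must be controlled at all times, hence the clamping of p to [0, T], where the clamped
source agrees with the original. The bounded Hessian makes it Lipschitz in space, so a classical
solution is mild, and the formula for p is its derivative. -/
lemma exists_source (hα : 0 < α) (hT : 0 ≤ T) (hB : Continuous B) {κ : ℝ} (hBκ : ∀ t, ‖B t‖ ≤ κ)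
    (h : F.IsForwardSol B α T w p q) :
    ∃ M L, IsSource M L (fun r => quadFun (B r) (p (Set.projIcc 0 T hT r))) ∧
      ∀ s ∈ Set.Icc 0 T, w s = F.mild (w 0) (fun r => quadFun (B r) (p (Set.projIcc 0 T hT r))) s ∧
        p s = F.mildGrad (p 0) (fun r => quadFun (B r) (p (Set.projIcc 0 T hT r))) s := by
  obtain ⟨P, hP, hpP⟩ := h.bounded_grad hα
  obtain ⟨R, hR, hqR⟩ := h.bounded_hess hα
  obtain ⟨K, hK, hqK⟩ := h.holder
  have hs : IsSource _ _ (fun r => quadFun (B r) (p (Set.projIcc 0 T hT r))) :=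
    isSource_quadFun (p := fun r => p (Set.projIcc 0 T hT r)) hR hB
      ((continuousOn_iff_continuous_domRestrict.1 (h.continuousOn_grad hα)).comp
        continuous_projIcc) hBκ
      (fun t => hpP _ (Set.projIcc 0 T hT t).2)
      (fun t => h.grad_isHolder_one (Set.projIcc 0 T hT t).2 (hqR _ (Set.projIcc 0 T hT t).2))
  have h1 : ∀ s ∈ Set.Icc 0 T,
      w s = F.mild (w 0) (fun r => quadFun (B r) (p (Set.projIcc 0 T hT r))) s := fun s hsT =>
    F.eq_mild_of_hasDerivWithinAt hs hα hK hP h.grad h.hess hqK hpP (fun t ht => by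
      simpa [Set.projIcc_of_mem hT ht] using h.eqn t ht) hsT
  refine ⟨_, _, hs, fun s hsT => ⟨h1 s hsT, ?_⟩⟩
  ext1 x
  refine (h.grad s hsT x).unique ?_
  rw [h1 s hsT]
  exact F.hasFDerivAt_mild hs (h.grad 0 ⟨le_rfl, hT⟩) hsT.1 x

/-- Solutions of the evolution equation are determined by their initial value. -/
theorem unique (hα : 0 < α) (hT : 0 ≤ T) (hB : Continuous B) {κ : ℝ} (hBκ : ∀ t, ‖B t‖ ≤ κ)
    (h : F.IsForwardSol B α T w p q) (h' : F.IsForwardSol B α T w' p' q') (h0 : w 0 = w' 0) :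
    ∀ s ∈ Set.Icc 0 T, w s = w' s := by
  obtain ⟨M, L, hs, hm⟩ := h.exists_source hα hT hB hBκ
  obtain ⟨M', L', hs', hm'⟩ := h'.exists_source hα hT hB hBκ
  obtain ⟨P, hP, hpP⟩ := h.bounded_grad hα
  obtain ⟨P', hP', hpP'⟩ := h'.bounded_grad hα
  have hp0 : p 0 = p' 0 := by
    ext1 x
    refine (h.grad 0 ⟨le_rfl, hT⟩ x).unique ?_
    rw [h0]
    exact h'.grad 0 ⟨le_rfl, hT⟩ x
  -- Only gradients enter the sources: once the gradients agree, w and w' are the mild solutions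
  -- with the same data and the same source.
  have hpp : ∀ s ∈ Set.Icc 0 T, p s = p' s :=
    F.mildGrad_unique hBκ (g' := p 0) (R := max P P') hs hs' hT (fun s hs => (hm s hs).2)
      (fun s hs => by rw [hp0]; exact (hm' s hs).2)
      (fun s hs => (hpP s hs).trans (le_max_left _ _))
      (fun s hs => (hpP' s hs).trans (le_max_right _ _))
      (fun s hs => by simp [Set.projIcc_of_mem hT hs])
      (fun s hs => by simp [Set.projIcc_of_mem hT hs])
  intro s hsT
  rw [(hm s hsT).1, (hm' s hsT).1, h0]
  congr 1
  ext1 r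
  rw [hpp _ (Set.projIcc 0 T hT r).2]

end IsForwardSol

/-- Short-time existence for the evolution equation. -/
theorem exists_isForwardSol [CompleteSpace W] {B : ℝ → Quad D W} (hB : Continuous B) {κ : ℝ}
    (hBκ : ∀ t, ‖B t‖ ≤ κ) {α K : ℝ} (hα0 : 0 < α) (hα1 : α < 1) (hK : 0 ≤ K)
    {g : State D →ᵇ W} {g' : State D →ᵇ Jet D W} {g'' : State D →ᵇ Jet D (Jet D W)}
    (hg : ∀ x, HasFDerivAt g (g' x) x) (hg' : ∀ x, HasFDerivAt g' (g'' x) x)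
    (hg'' : IsHolder α K g'') {T : ℝ} (hT : 0 ≤ T) (hT1 : T ≤ 1)
    (hsmall : 8 * F.gradC * κ * (‖g'‖ + 1) * (‖g'‖ + ‖g''‖ + 3) * T ^ (1 / 2 : ℝ) ≤ 1 / 2) :
    ∃ w p q, F.IsForwardSol B α T w p q ∧ w 0 = g := by
  -- The initial gradient has Lipschitz constant ‖g''‖, the value used for L₀.
  obtain ⟨p, hpc, hpR, hpL, hp⟩ := F.exists_mildGrad_eq hB hBκ (norm_nonneg g'')
    (isHolder_one_of_hasFDerivAt hg' g''.norm_coe_le_norm) hT hsmall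
  have hs := isSource_quadFun (by positivity) hB hpc hBκ hpR hpL
  have h3 : 0 < 1 - α := by linarith
  have hL := hs.lip_nonneg
  have hH : ∀ t, 0 ≤ t → t ≤ T → IsHolder α _
      (F.mildHess g'' (fun r => quadFun (B r) (p r)) t) := fun t ht0 htT =>
    F.mildHess_isHolder hs hα0.le hα1 hg'' ht0 (htT.trans hT1)
  refine ⟨F.mild g (fun r => quadFun (B r) (p r)), p,
    F.mildHess g'' (fun r => quadFun (B r) (p r)), ⟨fun t ht x => ?_, fun t ht x => ?_,
    fun t ht => F.hasDerivWithinAt_mild hs hg hg' hα0 hα1 hK hg'' hT hT1 ht,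
    ⟨_, by positivity, fun t ht => hH t ht.1 ht.2⟩, ?_⟩, F.mild_zero _ _⟩
  · rw [hp t ht]; exact F.hasFDerivAt_mild hs hg ht.1 x
  · rw [hp t ht]; exact F.hasFDerivAt_mildGrad hs hg' ht.1 x
  · have hm := F.mom_nonneg α
    have hc := F.gradC_nonneg
    have key : ∀ s t, 0 ≤ s → s ≤ t → t ≤ T → _ := fun s t hs0 hst htT =>
      F.norm_mildHess_sub_le hs hα0.le hα1.le (by positivity) hs0 hst (htT.trans hT1)
        (hH s hs0 (hst.trans htT))
    have hκ : 0 ≤ κ := (norm_nonneg _).trans (hBκ 0)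
    refine ⟨(K + 16 * (1 + F.gradC) ^ 2 * (2 * κ * (‖g'‖ + 1) * (‖g''‖ + 1)) / (1 - α)) * F.mom α +
      4 * F.gradC * (2 * κ * (‖g'‖ + 1) * (‖g''‖ + 1)), by positivity, fun s hs t ht => ?_⟩
    rcases le_total s t with h | h
    · rw [norm_sub_rev, abs_sub_comm, abs_of_nonneg (sub_nonneg.2 h)]
      exact key s t hs.1 h ht.2
    · rw [abs_of_nonneg (sub_nonneg.2 h)]
      exact key t s ht.1 h hs.2

end Diffusion

/-! ### The nonlinearity of the system as a bilinear form. -/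

section Coefficients

variable {D I : ℕ}

lemma HolderTime.mul {β T : ℝ} {f k : ℝ → ℝ} (hβ : 0 ≤ β) (hf : HolderTime β T f)
    (hk : HolderTime β T k) : HolderTime β T fun t => f t * k t := hf.smul hβ hk

/-- The partial derivative in direction `d` of the component `i`, as a functional. -/
noncomputable def partialCLM (d : Fin D) (i : Fin I) : Jet D (Fin I → ℝ) →L[ℝ] ℝ :=
  (ContinuousLinearMap.proj i).comp
    (ContinuousLinearMap.apply ℝ (Fin I → ℝ) (EuclideanSpace.single d (1 : ℝ) : State D))

lemma partialCLM_apply (d : Fin D) (i : Fin I) (P : Jet D (Fin I → ℝ)) :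
    partialCLM d i P = P (EuclideanSpace.single d 1) i := rfl

/-- The bilinear map `(P, P') ↦ ℓ P * ℓ' P' • e`. -/
noncomputable def rankOne (ℓ ℓ' : Jet D (Fin I → ℝ) →L[ℝ] ℝ) (e : Fin I → ℝ) :
    Quad D (Fin I → ℝ) :=
  (ℓ.smulRight (ℓ'.smulRight e) : Jet D (Fin I → ℝ) →L[ℝ] Jet D (Fin I → ℝ) →L[ℝ] (Fin I → ℝ))

lemma rankOne_apply (ℓ ℓ' : Jet D (Fin I → ℝ) →L[ℝ] ℝ) (e : Fin I → ℝ)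
    (P P' : Jet D (Fin I → ℝ)) : rankOne ℓ ℓ' e P P' = (ℓ P * ℓ' P') • e := by
  rw [mul_smul]; rfl

lemma quad_add_apply (B B' : Quad D (Fin I → ℝ)) (P P' : Jet D (Fin I → ℝ)) :
    (B + B') P P' = B P P' + B' P P' := rfl

lemma quad_smul_apply (c : ℝ) (B : Quad D (Fin I → ℝ)) (P P' : Jet D (Fin I → ℝ)) :
    (c • B) P P' = c • B P P' := rfl

lemma quad_sum_apply {ι : Type*} (S : Finset ι) (B : ι → Quad D (Fin I → ℝ))
    (P P' : Jet D (Fin I → ℝ)) : (∑ k ∈ S, B k) P P' = ∑ k ∈ S, B k P P' :=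
  map_sum (⟨⟨fun B : Quad D (Fin I → ℝ) => B P P', rfl⟩, fun _ _ => rfl⟩ :
    Quad D (Fin I → ℝ) →+ (Fin I → ℝ)) B S

/-- The quadratic forms multiplying the entries of `C̄ C̄ᵀ`. -/
noncomputable def tradedForm (a : Fin I → ℝ) (d e : Fin D) : Quad D (Fin I → ℝ) :=
  ∑ i, ((1 / (2 * a i) * (1 / totalTolerance a) ^ 2) •
      rankOne (∑ j, partialCLM d j) (∑ j, partialCLM e j) (Pi.single i 1) +
    (-(1 / totalTolerance a)) • rankOne (∑ j, partialCLM d j) (partialCLM e i) (Pi.single i 1) +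
    (a i / 2) • rankOne (partialCLM d i) (partialCLM e i) (Pi.single i 1))

/-- The quadratic forms multiplying the entries of `C Cᵀ`. -/
noncomputable def residualForm (a : Fin I → ℝ) (d e : Fin D) : Quad D (Fin I → ℝ) :=
  ∑ i, (-(a i / 2)) • rankOne (partialCLM d i) (partialCLM e i) (Pi.single i 1)

/-- The quadratic nonlinearity of the system. -/
noncomputable def quadForm {N : ℕ} (hN : N ≤ D) (a : Fin I → ℝ) (M : Matrix (Fin D) (Fin D) ℝ) :
    Quad D (Fin I → ℝ) :=
  ∑ d, ∑ e, ((firstColumns hN M * (firstColumns hN M)ᵀ) d e • tradedForm a d e +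
    (M * Mᵀ) d e • residualForm a d e)

lemma dotProduct_transpose_mulVec {n : ℕ} (M : Matrix (Fin D) (Fin n) ℝ) (v w : Fin D → ℝ) :
    (Mᵀ *ᵥ v) ⬝ᵥ (Mᵀ *ᵥ w) = ∑ d, ∑ e, (M * Mᵀ) d e * (v d * w e) := by
  rw [Matrix.mulVec_transpose, ← Matrix.dotProduct_mulVec, Matrix.mulVec_mulVec]
  simp only [dotProduct, Matrix.mulVec, Finset.mul_sum]
  exact Finset.sum_congr rfl fun d _ => Finset.sum_congr rfl fun e _ => by ring

lemma quadForm_apply {N : ℕ} (hN : N ≤ D) (a : Fin I → ℝ) (M : Matrix (Fin D) (Fin D) ℝ)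
    (P : Jet D (Fin I → ℝ)) {G : Fin I → Fin D → ℝ}
    (hG : ∀ i d, P (EuclideanSpace.single d 1) i = G i d)
    {lam : Fin N → ℝ}
    (hlam : lam = (1 / totalTolerance a) • ((firstColumns hN M)ᵀ *ᵥ ∑ j, G j)) (i : Fin I) :
    quadForm hN a M P P i = 1 / (2 * a i) * (lam ⬝ᵥ lam)
      - lam ⬝ᵥ ((firstColumns hN M)ᵀ *ᵥ G i)
      + a i / 2 * (((firstColumns hN M)ᵀ *ᵥ G i) ⬝ᵥ ((firstColumns hN M)ᵀ *ᵥ G i)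
        - (Mᵀ *ᵥ G i) ⬝ᵥ (Mᵀ *ᵥ G i)) := by
  subst hlam
  have hs : ∀ d, (∑ j : Fin I, partialCLM d j) P = (∑ j, G j) d := fun d => by
    rw [sum_apply, Finset.sum_apply]
    exact Finset.sum_congr rfl fun j _ => hG j d
  -- The aggregate gradient must stay a single symbol, otherwise the sums over agents would be
  -- expanded; both sides are then double sums over d and e that agree term by term.
  generalize ∑ j, G j = L at hs ⊢
  simp only [hs, smul_dotProduct, dotProduct_smul, dotProduct_transpose_mulVec, smul_eq_mul,
    quadForm,
    tradedForm, residualForm, quad_sum_apply, quad_add_apply, quad_smul_apply, rankOne_apply,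
    partialCLM_apply, hG, Finset.sum_apply, Pi.add_apply,
    Pi.smul_apply, Pi.single_apply, mul_ite, mul_one, mul_zero, Finset.sum_ite_eq,
    Finset.mem_univ, if_true, Finset.mul_sum, ← Finset.sum_add_distrib, ← Finset.sum_sub_distrib,
    ite_add_ite, add_zero]
  refine Finset.sum_congr rfl fun d _ => Finset.sum_congr rfl fun e _ => ?_
  ring

end Coefficients

/-! ### Extending the volatility to all times and reversing it. -/

section Volatility

variable {D : ℕ} {α δlo δhi : ℝ} {C : ℝ → Matrix (Fin D) (Fin D) ℝ}

/-- The volatility extended from `[0, 1]` to all times by constants. -/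
noncomputable def clampVol (C : ℝ → Matrix (Fin D) (Fin D) ℝ) (r : ℝ) : Matrix (Fin D) (Fin D) ℝ :=
  C (Set.projIcc 0 1 zero_le_one r)

lemma clampVol_of_mem {r : ℝ} (hr : r ∈ Set.Icc (0 : ℝ) 1) : clampVol C r = C r := by
  rw [clampVol, Set.projIcc_of_mem zero_le_one hr]

lemma IsVolatility.exists_clampVol_holder (hC : IsVolatility α δlo δhi C) (hα : 0 < α) :
    ∃ K, 0 ≤ K ∧ ∀ r s i j, |clampVol C r i j - clampVol C s i j| ≤ K * |r - s| ^ α := by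
  obtain ⟨K, hK⟩ := hC.holder
  refine ⟨max K 0, le_max_right _ _, fun r s i j => ?_⟩
  refine (hK _ (Set.projIcc 0 1 zero_le_one r).2 _ (Set.projIcc 0 1 zero_le_one s).2 i j).trans ?_
  refine mul_le_mul (le_max_left _ _) (Real.rpow_le_rpow (abs_nonneg _) ?_ hα.le)
    (by positivity) (le_max_right _ _)
  exact Set.abs_projIcc_sub_projIcc _

lemma IsVolatility.continuous_clampVol (hC : IsVolatility α δlo δhi C) (hα : 0 < α) (i j : Fin D) :
    Continuous fun r => clampVol C r i j := by
  obtain ⟨K, -, h⟩ := hC.exists_clampVol_holder hα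
  refine continuous_iff_continuousAt.2 fun s => ?_
  rw [ContinuousAt, tendsto_iff_norm_sub_tendsto_zero]
  refine squeeze_zero (fun _ => norm_nonneg _) (fun t => h t s i j) ?_
  have : Continuous fun t => K * |t - s| ^ α :=
    continuous_const.mul ((continuous_abs.comp (continuous_id.sub continuous_const)).rpow_const
      fun _ => Or.inr hα.le)
  simpa [Real.zero_rpow hα.ne'] using this.tendsto s

lemma IsVolatility.holderTime_clampVol (hC : IsVolatility α δlo δhi C) (hα : 0 < α) {T : ℝ}
    (hT : T ≤ 1) (i j : Fin D) :
    HolderTime (α / 2) T fun s => clampVol C (T - s) i j := by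
  obtain ⟨K, hK, h⟩ := hC.exists_clampVol_holder hα
  refine HolderTime.of_le (β := α) hT (by linarith) (by linarith) ⟨K, hK, fun s _ t _ => ?_⟩
  have := h (T - s) (T - t) i j
  rwa [sub_sub_sub_cancel_left, abs_sub_comm t s] at this

/-- The diffusion coefficient of the time-reversed system. -/
noncomputable def IsVolatility.diffusion (hC : IsVolatility α δlo δhi C) (hα : 0 < α)
    (hlo : 0 < δlo) (hhi : 0 < δhi) (T : ℝ) : Diffusion D where
  A s := clampVol C (T - s) * (clampVol C (T - s))ᵀ
  lo := δlo
  hi := δhi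
  lo_pos := hlo
  hi_pos := hhi
  cont i j := by
    simp only [Matrix.mul_apply, Matrix.transpose_apply]
    exact continuous_finsetSum _ fun k _ =>
      ((hC.continuous_clampVol hα i k).comp (continuous_const.sub continuous_id)).mul
        ((hC.continuous_clampVol hα j k).comp (continuous_const.sub continuous_id))
  symm s := by rw [Matrix.transpose_mul, Matrix.transpose_transpose]
  lower s y := hC.lower _ (Set.projIcc 0 1 zero_le_one (T - s)).2 y
  upper s y := hC.upper _ (Set.projIcc 0 1 zero_le_one (T - s)).2 y

variable {I N : ℕ} (hN : N ≤ D) (a : Fin I → ℝ)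

lemma IsVolatility.continuous_quadForm (hC : IsVolatility α δlo δhi C) (hα : 0 < α) :
    Continuous fun r => quadForm hN a (clampVol C r) := by
  simp only [quadForm, Matrix.mul_apply, Matrix.transpose_apply, firstColumns,
    Matrix.submatrix_apply, id]
  have h := hC.continuous_clampVol hα
  exact continuous_finsetSum _ fun d _ => continuous_finsetSum _ fun e _ =>
    ((continuous_finsetSum _ fun k _ => (h d _).mul (h e _)).smul continuous_const).add
      ((continuous_finsetSum _ fun k _ => (h d _).mul (h e _)).smul continuous_const)

lemma IsVolatility.exists_norm_quadForm_le (hC : IsVolatility α δlo δhi C) (hα : 0 < α) :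
    ∃ κ, 0 ≤ κ ∧ ∀ r, ‖quadForm hN a (clampVol C r)‖ ≤ κ := by
  obtain ⟨κ, hκ⟩ := (isCompact_Icc (a := (0 : ℝ)) (b := 1)).exists_bound_of_continuousOn
    (hC.continuous_quadForm hN a hα).continuousOn
  have h : ∀ r, ‖quadForm hN a (clampVol C r)‖ ≤ κ := fun r => by
    have := hκ _ (Set.projIcc 0 1 zero_le_one r).2
    rwa [clampVol_of_mem (Set.projIcc 0 1 zero_le_one r).2] at this
  exact ⟨κ, (norm_nonneg _).trans (h 0), h⟩

lemma IsVolatility.holderTime_quadForm (hC : IsVolatility α δlo δhi C) (hα : 0 < α) {T : ℝ}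
    (hT : T ≤ 1) : HolderTime (α / 2) T fun s => quadForm hN a (clampVol C (T - s)) := by
  simp only [quadForm, Matrix.mul_apply, Matrix.transpose_apply, firstColumns,
    Matrix.submatrix_apply, id]
  have h := hC.holderTime_clampVol hα hT
  have hα2 : 0 ≤ α / 2 := by linarith
  exact HolderTime.sum _ fun d _ => HolderTime.sum _ fun e _ =>
    HolderTime.add
      (HolderTime.smul hα2 (HolderTime.sum _ fun k _ => (h d _).mul hα2 (h e _))
        (holderTime_const _))
      (HolderTime.smul hα2 (HolderTime.sum _ fun k _ => (h d _).mul hα2 (h e _))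
        (holderTime_const _))

lemma IsVolatility.holderTime_diffusion (hC : IsVolatility α δlo δhi C) (hα : 0 < α)
    (hlo : 0 < δlo) (hhi : 0 < δhi) {T : ℝ} (hT : T ≤ 1) (i j : Fin D) :
    HolderTime (α / 2) T fun s => (hC.diffusion hα hlo hhi T).A s i j := by
  simp only [IsVolatility.diffusion, Matrix.mul_apply, Matrix.transpose_apply]
  have h := hC.holderTime_clampVol hα hT
  exact HolderTime.sum _ fun k _ => (h i k).mul (by linarith) (h j k)

end Volatility

/-! ### Finiteness of the extended norms as real bounds. -/

section Norms

variable {D : ℕ} {T α : ℝ}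

lemma ofReal_iSup_bound {ι : Sort*} {f : ι → ℝ≥0∞} (h : ⨆ k, f k < ∞) :
    ∃ M : ℝ, 0 ≤ M ∧ ∀ k, f k ≤ ENNReal.ofReal M :=
  ⟨(⨆ k, f k).toReal, ENNReal.toReal_nonneg, fun k => by
    rw [ENNReal.ofReal_toReal h.ne]; exact le_iSup f k⟩

lemma exists_bound_of_supNorm {g : State D → ℝ} (h : supNorm g < ∞) :
    ∃ M, 0 ≤ M ∧ ∀ x, |g x| ≤ M := by
  obtain ⟨M, hM, hb⟩ := ofReal_iSup_bound h
  exact ⟨M, hM, fun x => (ENNReal.ofReal_le_ofReal_iff hM).1 (hb x)⟩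

lemma exists_bound_of_holderSeminorm (hα : 0 < α) {g : State D → ℝ} (h : holderSeminorm α g < ∞) :
    ∃ M, 0 ≤ M ∧ ∀ x y, |g x - g y| ≤ M * ‖x - y‖ ^ α := by
  obtain ⟨M, hM, hb⟩ := ofReal_iSup_bound h
  refine ⟨M, hM, fun x y => ?_⟩
  rcases eq_or_ne x y with rfl | hxy
  · simp [Real.zero_rpow hα.ne']
  · have h1 : |g x - g y| / ‖x - y‖ ^ α ≤ M := by
      refine (ENNReal.ofReal_le_ofReal_iff hM).1 (le_trans ?_ (hb x))
      exact le_iSup_of_le y (le_iSup_of_le hxy le_rfl)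
    have h2 : 0 < ‖x - y‖ := norm_pos_iff.2 (sub_ne_zero.2 hxy)
    exact (div_le_iff₀ (Real.rpow_pos_of_pos h2 _)).1 h1

lemma parSupNorm_lt_top_iff {h : ℝ → State D → ℝ} :
    parSupNorm T h < ∞ ↔ ∃ M, 0 ≤ M ∧ ∀ t ∈ Set.Icc 0 T, ∀ x, |h t x| ≤ M := by
  constructor
  · intro hh
    obtain ⟨M, hM, hb⟩ := ofReal_iSup_bound hh
    refine ⟨M, hM, fun t ht x => (ENNReal.ofReal_le_ofReal_iff hM).1
      ((le_iSup_of_le ht ?_).trans (hb t))⟩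
    exact le_iSup (fun x => ENNReal.ofReal |h t x|) x
  · rintro ⟨M, hM, hb⟩
    refine lt_of_le_of_lt ?_ (ENNReal.ofReal_lt_top (r := M))
    exact iSup_le fun t => iSup_le fun ht => iSup_le fun x => ENNReal.ofReal_le_ofReal (hb t ht x)

/-- Distinct points have positive parabolic distance, so one may divide; for equal points both sides
vanish, by α > 0. -/
lemma parHolderSeminorm_lt_top_iff (hα : 0 < α) {h : ℝ → State D → ℝ} :
    parHolderSeminorm T α h < ∞ ↔ ∃ M, 0 ≤ M ∧ ∀ t ∈ Set.Icc 0 T, ∀ s ∈ Set.Icc 0 T, ∀ x y,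
      |h t x - h s y| ≤ M * (√|t - s| + ‖x - y‖) ^ α := by
  have hpos : ∀ {t s : ℝ} {x y : State D}, (t, x) ≠ (s, y) → 0 < √|t - s| + ‖x - y‖ := by
    intro t s x y hne
    by_cases hxy : x = y
    · have : t ≠ s := fun h => hne (by rw [h, hxy])
      have h1 : 0 < √|t - s| := Real.sqrt_pos.2 (abs_pos.2 (sub_ne_zero.2 this))
      linarith [norm_nonneg (x - y)]
    · have h1 : 0 < ‖x - y‖ := norm_pos_iff.2 (sub_ne_zero.2 hxy)
      linarith [Real.sqrt_nonneg |t - s|]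
  constructor
  · intro hh
    obtain ⟨M, hM, hb⟩ := ofReal_iSup_bound hh
    refine ⟨M, hM, fun t ht s hs x y => ?_⟩
    by_cases hne : (t, x) = (s, y)
    · obtain ⟨rfl, rfl⟩ := Prod.mk.inj hne
      simp [Real.zero_rpow hα.ne']
    · refine (div_le_iff₀ (Real.rpow_pos_of_pos (hpos hne) _)).1
        ((ENNReal.ofReal_le_ofReal_iff hM).1 (le_trans ?_ (hb t)))
      exact le_iSup_of_le ht (le_iSup_of_le s (le_iSup_of_le hs (le_iSup_of_le x
        (le_iSup_of_le y (le_iSup_of_le hne le_rfl)))))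
  · rintro ⟨M, hM, hb⟩
    refine lt_of_le_of_lt ?_ (ENNReal.ofReal_lt_top (r := M))
    exact iSup_le fun t => iSup_le fun ht => iSup_le fun s => iSup_le fun hs => iSup_le fun x =>
      iSup_le fun y => iSup_le fun hne => ENNReal.ofReal_le_ofReal
        ((div_le_iff₀ (Real.rpow_pos_of_pos (hpos hne) _)).2 (hb t ht s hs x y))

lemma exists_uniform_bound {ι : Type*} [Finite ι] {P : ι → ℝ → Prop}
    (hP : ∀ k a b, a ≤ b → P k a → P k b) (h : ∀ k, ∃ M, 0 ≤ M ∧ P k M) :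
    ∃ M, 0 ≤ M ∧ ∀ k, P k M := by
  cases nonempty_fintype ι
  choose M hM hPM using h
  exact ⟨∑ k, M k, Finset.sum_nonneg fun k _ => hM k, fun k =>
    hP k _ _ (Finset.single_le_sum (fun k _ => hM k) (Finset.mem_univ k)) (hPM k)⟩

end Norms

/-! ### From families of scalar functions to vector-valued bounded functions. -/

section Jets

variable {D I : ℕ}

lemma norm_jet_le_sum {V : Type*} [NormedAddCommGroup V] [NormedSpace ℝ V] (B : Jet D V) :
    ‖B‖ ≤ ∑ d, ‖B (EuclideanSpace.single d 1)‖ := by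
  refine norm_jet_le_of_unit (Finset.sum_nonneg fun d _ => norm_nonneg _) fun v hv => ?_
  have hz : v = ∑ i, v i • (EuclideanSpace.single i (1 : ℝ) : State D) := by
    conv_lhs => rw [← (EuclideanSpace.basisFun (Fin D) ℝ).sum_repr v]
    simp
  have h1 : B v = ∑ i, v i • B (EuclideanSpace.single i 1) := by
    conv_lhs => rw [hz]
    exact (map_sum (show State D →L[ℝ] V from B) _ _).trans
      (Finset.sum_congr rfl fun i _ => map_smul (show State D →L[ℝ] V from B) _ _)
  rw [h1]
  refine (norm_sum_le _ _).trans (Finset.sum_le_sum fun i _ => ?_)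
  rw [norm_smul]
  exact mul_le_of_le_one_left (norm_nonneg _) ((PiLp.norm_apply_le v i).trans hv.le)

lemma norm_jet_le_of_component {B : Jet D (Fin I → ℝ)} {R : ℝ} (hR : 0 ≤ R)
    (h : ∀ d i, |B (EuclideanSpace.single d 1) i| ≤ R) : ‖B‖ ≤ D * R := by
  refine (norm_jet_le_sum B).trans ((Finset.sum_le_card_nsmul _ _ R fun d _ => ?_).trans ?_)
  · exact (pi_norm_le_iff_of_nonneg hR).2 fun i => h d i
  · simp

lemma norm_jet_jet_le_of_component {B : Jet D (Jet D (Fin I → ℝ))} {R : ℝ} (hR : 0 ≤ R)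
    (h : ∀ d e i, |B (EuclideanSpace.single e 1) (EuclideanSpace.single d 1) i| ≤ R) :
    ‖B‖ ≤ D * (D * R) := by
  refine (norm_jet_le_sum B).trans ((Finset.sum_le_card_nsmul _ _ (D * R) fun d _ => ?_).trans ?_)
  · exact norm_jet_le_of_component hR fun e i => h e d i
  · simp

open Classical in
/-- A bounded continuous function as an element of the space of such functions. -/
noncomputable def toBCF {V : Type*} [NormedAddCommGroup V] (f : State D → V) : State D →ᵇ V :=
  if h : Continuous f ∧ ∃ M, ∀ x, ‖f x‖ ≤ M then
    BoundedContinuousFunction.ofNormedAddCommGroup f h.1 h.2.choose h.2.choose_spec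
  else 0

lemma toBCF_apply {V : Type*} [NormedAddCommGroup V] {f : State D → V} (hf : Continuous f) {M : ℝ}
    (hM : ∀ x, ‖f x‖ ≤ M) (x : State D) : toBCF f x = f x := by
  rw [toBCF, dif_pos ⟨hf, M, hM⟩]; rfl

/-- A family of functions of class `C²`, bounded with their derivatives by `M`. -/
structure BddJets (M : ℝ) (f : Fin I → State D → ℝ) : Prop where
  contDiff : ∀ i, ContDiff ℝ 2 (f i)
  nonneg : 0 ≤ M
  bound : ∀ i x, |f i x| ≤ M
  bound_grad : ∀ i d x, |partialDeriv d (f i) x| ≤ M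
  bound_hess : ∀ i d e x, |hess (f i) x d e| ≤ M

/-- The family `f` as a bounded vector-valued function. -/
noncomputable def vecBCF (f : Fin I → State D → ℝ) : State D →ᵇ (Fin I → ℝ) :=
  toBCF fun x i => f i x

/-- The first derivative of a family of functions. -/
noncomputable def gradBCF (f : Fin I → State D → ℝ) : State D →ᵇ Jet D (Fin I → ℝ) :=
  toBCF (V := Jet D (Fin I → ℝ)) (fderiv ℝ fun x i => f i x)

/-- The second derivative of a family of functions. -/
noncomputable def hessBCF (f : Fin I → State D → ℝ) : State D →ᵇ Jet D (Jet D (Fin I → ℝ)) :=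
  toBCF (V := Jet D (Jet D (Fin I → ℝ))) (fderiv ℝ (fderiv ℝ fun x i => f i x))

namespace BddJets

variable {M : ℝ} {f : Fin I → State D → ℝ}

lemma contDiff_vec (h : BddJets M f) : ContDiff ℝ 2 fun x i => f i x := contDiff_pi.2 h.contDiff

lemma differentiable_fderiv (h : BddJets M f) :
    Differentiable ℝ (fderiv ℝ fun x i => f i x) :=
  (h.contDiff_vec.fderiv_right (m := 1) (by norm_num)).differentiable (by norm_num)

lemma fderiv_vec (h : BddJets M f) (x v : State D) (i : Fin I) :
    fderiv ℝ (fun x i => f i x) x v i = fderiv ℝ (f i) x v := by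
  have h1 := (h.contDiff_vec.differentiable (by norm_num) x).hasFDerivAt
  have h2 := (hasFDerivAt_pi'.1 h1 i).fderiv
  rw [h2]; rfl

lemma fderiv_fderiv_vec (h : BddJets M f) (x : State D) (i : Fin I) (d e : Fin D) :
    fderiv ℝ (fderiv ℝ fun x i => f i x) x (EuclideanSpace.single e 1)
      (EuclideanSpace.single d 1) i = RadnerPDE.hess (f i) x d e := by
  have h1 := (h.differentiable_fderiv x).hasFDerivAt
  have h2 := ((ContinuousLinearMap.proj (R := ℝ) (φ := fun _ : Fin I => ℝ) i).comp
    (ContinuousLinearMap.apply ℝ (Fin I → ℝ)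
      (EuclideanSpace.single d (1 : ℝ) : State D))).hasFDerivAt.comp x h1
  have h3 : partialDeriv d (f i) =
    ((ContinuousLinearMap.proj (R := ℝ) (φ := fun _ : Fin I => ℝ) i).comp
    (ContinuousLinearMap.apply ℝ (Fin I → ℝ)
      (EuclideanSpace.single d (1 : ℝ) : State D))) ∘ fderiv ℝ fun x i => f i x := by
    ext y
    exact (h.fderiv_vec y _ i).symm
  rw [RadnerPDE.hess, Matrix.of_apply, h3, partialDeriv, h2.fderiv]
  rfl

lemma vecBCF_apply (h : BddJets M f) (x : State D) (i : Fin I) : vecBCF f x i = f i x := by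
  rw [vecBCF, toBCF_apply h.contDiff_vec.continuous (M := M)]
  exact fun x => (pi_norm_le_iff_of_nonneg h.nonneg).2 fun i => h.bound i x

lemma gradBCF_eq (h : BddJets M f) (x : State D) :
    gradBCF f x = fderiv ℝ (fun x i => f i x) x := by
  have h1 : ∀ x, ‖(show Jet D (Fin I → ℝ) from fderiv ℝ (fun x i => f i x) x)‖ ≤ D * M := fun x =>
    norm_jet_le_of_component h.nonneg fun d i => by
      have := h.bound_grad i d x
      rwa [partialDeriv, ← h.fderiv_vec] at this
  exact toBCF_apply (V := Jet D (Fin I → ℝ)) h.differentiable_fderiv.continuous h1 x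

lemma hessBCF_eq (h : BddJets M f) (x : State D) :
    hessBCF f x = fderiv ℝ (fderiv ℝ fun x i => f i x) x := by
  have h1 : ∀ x, ‖(show Jet D (Jet D (Fin I → ℝ)) from fderiv ℝ (fderiv ℝ fun x i => f i x) x)‖ ≤
      D * (D * M) := fun x =>
    norm_jet_jet_le_of_component h.nonneg fun d e i => by
      have := h.bound_hess i d e x
      rwa [← h.fderiv_fderiv_vec] at this
  refine toBCF_apply (V := Jet D (Jet D (Fin I → ℝ))) ?_ h1 x
  exact (h.contDiff_vec.fderiv_right (m := 1) (by norm_num)).continuous_fderiv (by norm_num)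

lemma hasFDerivAt_vecBCF (h : BddJets M f) (x : State D) :
    HasFDerivAt (vecBCF f) (gradBCF f x) x := by
  have h1 : (vecBCF f : State D → Fin I → ℝ) = fun x i => f i x := by
    ext x i; exact h.vecBCF_apply x i
  rw [h.gradBCF_eq, h1]
  exact (h.contDiff_vec.differentiable (by norm_num) x).hasFDerivAt

lemma hasFDerivAt_gradBCF (h : BddJets M f) (x : State D) :
    HasFDerivAt (gradBCF f) (hessBCF f x) x := by
  have h1 : (gradBCF f : State D → Jet D (Fin I → ℝ)) = fderiv ℝ fun x i => f i x := by
    funext x; exact h.gradBCF_eq x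
  rw [h.hessBCF_eq, h1]
  exact (h.differentiable_fderiv x).hasFDerivAt

lemma gradBCF_apply (h : BddJets M f) (x : State D) (d : Fin D) (i : Fin I) :
    gradBCF f x (EuclideanSpace.single d 1) i = partialDeriv d (f i) x := by
  rw [h.gradBCF_eq]; exact h.fderiv_vec x _ i

lemma hessBCF_apply (h : BddJets M f) (x : State D) (d e : Fin D) (i : Fin I) :
    hessBCF f x (EuclideanSpace.single e 1) (EuclideanSpace.single d 1) i =
      RadnerPDE.hess (f i) x d e := by
  rw [h.hessBCF_eq]; exact h.fderiv_fderiv_vec x i d e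

/-- Passes from entrywise bounds to the operator norm, in the form needed for Hölder estimates both
in space (same family) and in time (two families). -/
lemma norm_hessBCF_sub_le {M' : ℝ} {f' : Fin I → State D → ℝ} (h : BddJets M f)
    (h' : BddJets M' f') {x y : State D} {R : ℝ} (hR : 0 ≤ R)
    (hb : ∀ i d e, |RadnerPDE.hess (f i) x d e - RadnerPDE.hess (f' i) y d e| ≤ R) :
    ‖hessBCF f x - hessBCF f' y‖ ≤ D * (D * R) :=
  norm_jet_jet_le_of_component hR fun d e i => by
    have := hb i d e
    rwa [← h.hessBCF_apply, ← h'.hessBCF_apply] at this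

end BddJets

lemma MemHolder₂.exists_bddJets {α : ℝ} (hα : 0 < α) {g : Fin I → State D → ℝ}
    (hg : ∀ i, MemHolder₂ α (g i)) :
    ∃ M K, BddJets M g ∧ 0 ≤ K ∧ IsHolder α K (hessBCF g) := by
  have hfin := fun i => (hg i).2
  simp only [holderNorm₂, ENNReal.add_lt_top, ENNReal.sum_lt_top, Finset.mem_univ,
    true_implies] at hfin
  obtain ⟨M₀, hM₀, h0⟩ := exists_uniform_bound (ι := Fin I)
    (P := fun i M => ∀ x, |g i x| ≤ M) (fun _ _ _ h hb x => (hb x).trans h)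
    fun i => exists_bound_of_supNorm (hfin i).1.1.1
  obtain ⟨M₁, hM₁, h1⟩ := exists_uniform_bound (ι := Fin I × Fin D)
    (P := fun k M => ∀ x, |partialDeriv k.2 (g k.1) x| ≤ M) (fun _ _ _ h hb x => (hb x).trans h)
    fun k => exists_bound_of_supNorm ((hfin k.1).1.1.2 k.2)
  obtain ⟨M₂, hM₂, h2⟩ := exists_uniform_bound (ι := Fin I × Fin D × Fin D)
    (P := fun k M => ∀ x, |hess (g k.1) x k.2.1 k.2.2| ≤ M) (fun _ _ _ h hb x => (hb x).trans h)
    fun k => exists_bound_of_supNorm ((hfin k.1).1.2 k.2.1 k.2.2)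
  obtain ⟨K, hK, h3⟩ := exists_uniform_bound (ι := Fin I × Fin D × Fin D)
    (P := fun k M => ∀ x y, |hess (g k.1) x k.2.1 k.2.2 - hess (g k.1) y k.2.1 k.2.2| ≤
      M * ‖x - y‖ ^ α)
    (fun _ _ _ h hb x y => (hb x y).trans (by gcongr))
    fun k => exists_bound_of_holderSeminorm hα ((hfin k.1).2 k.2.1 k.2.2)
  have hj : BddJets (M₀ + M₁ + M₂) g :=
    ⟨fun i => (hg i).1, by positivity, fun i x => (h0 i x).trans (by linarith),
      fun i d x => (h1 (i, d) x).trans (by linarith),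
      fun i d e x => (h2 (i, d, e) x).trans (by linarith)⟩
  refine ⟨_, D * (D * K), hj, by positivity, fun x y => ?_⟩
  refine (hj.norm_hessBCF_sub_le hj (by positivity) fun i d e => h3 (i, d, e) x y).trans
    (le_of_eq (by ring))

end Jets

/-! ### The system as a semilinear equation, and parabolic Hölder bounds after time reversal. -/

section System

variable {D N I : ℕ}

/-- The bridge between the two formulations. Nothing is assumed of P and Q beyond their components,
so it serves both directions of the time reversal. -/
lemma pdeOperator_eq (hN : N ≤ D) {T : ℝ} (a : Fin I → ℝ) (C : ℝ → Matrix (Fin D) (Fin D) ℝ)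
    {u : Fin I → ℝ → State D → ℝ} {t : ℝ} {y : State D} {P : Jet D (Fin I → ℝ)}
    {Q : Jet D (Jet D (Fin I → ℝ))}
    (hP : ∀ i d, P (EuclideanSpace.single d 1) i = grad (u i t) y d)
    (hQ : ∀ i d e, Q (EuclideanSpace.single e 1) (EuclideanSpace.single d 1) i =
      hess (u i t) y d e) (i : Fin I) :
    pdeOperator hN T a C u i t y = timeDeriv T (u i) t y +
      (((1 / 2 : ℝ) • ∑ d, ∑ e, (C t * (C t)ᵀ) d e • evalPair D (Fin I → ℝ) d e Q) i +
        quadForm hN a (C t) P P i) := by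
  rw [quadForm_apply hN a (C t) P hP (lam := marketPriceOfRisk hN a C u t y) rfl]
  have h1 : ((1 / 2 : ℝ) • ∑ d, ∑ e, (C t * (C t)ᵀ) d e • evalPair D (Fin I → ℝ) d e Q) i =
      1 / 2 * (hess (u i t) y * (C t * (C t)ᵀ)).trace := by
    simp only [Pi.smul_apply, Finset.sum_apply, evalPair_apply, hQ, smul_eq_mul, Matrix.trace,
      Matrix.diag_apply, Matrix.mul_apply (M := hess (u i t) y)]
    rw [Finset.sum_comm]
    congr 1
    exact Finset.sum_congr rfl fun d _ => Finset.sum_congr rfl fun e _ => mul_comm _ _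
  rw [h1, pdeOperator]
  ring

lemma contDiff_two_of_hasFDerivAt {V : Type*} [NormedAddCommGroup V] [NormedSpace ℝ V]
    {f : State D → V} {f' : State D → State D →L[ℝ] V}
    {f'' : State D → State D →L[ℝ] State D →L[ℝ] V} (h1 : ∀ x, HasFDerivAt f (f' x) x)
    (h2 : ∀ x, HasFDerivAt f' (f'' x) x) (hc : Continuous f'') : ContDiff ℝ 2 f := by
  have e1 : fderiv ℝ f = f' := funext fun x => (h1 x).fderiv
  have e2 : fderiv ℝ f' = f'' := funext fun x => (h2 x).fderiv
  rw [show (2 : WithTop ℕ∞) = 1 + 1 by norm_num, contDiff_succ_iff_fderiv]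
  refine ⟨fun x => (h1 x).differentiableAt, by simp, ?_⟩
  rw [e1, contDiff_one_iff_fderiv, e2]
  exact ⟨fun x => (h2 x).differentiableAt, hc⟩

lemma continuousOn_eval_reversed {V : Type*} [NormedAddCommGroup V] {T : ℝ}
    {φ : ℝ → State D →ᵇ V} (hφ : ContinuousOn φ (Set.Icc 0 T)) :
    ContinuousOn (fun p : ℝ × State D => φ (T - p.1) p.2) (Set.Icc 0 T ×ˢ Set.univ) := by
  have h1 : ContinuousOn (fun p : ℝ × State D => φ (T - p.1)) (Set.Icc 0 T ×ˢ Set.univ) :=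
    hφ.comp (by fun_prop) fun p hp => ⟨by linarith [hp.1.2], by linarith [hp.1.1]⟩
  exact continuous_eval.comp_continuousOn (h1.prodMk continuousOn_snd)

/-- Change time first and space second; |t − s|^(α/2) = √|t − s|^α, so each increment is bounded by
the parabolic distance. -/
lemma exists_holder_reversed {V : Type*} [NormedAddCommGroup V] [NormedSpace ℝ V] {T α : ℝ}
    (hα : 0 ≤ α) {φ : ℝ → State D →ᵇ V} (ht : HolderTime (α / 2) T φ)
    (hx : ∃ K, 0 ≤ K ∧ ∀ t ∈ Set.Icc 0 T, IsHolder α K (φ t)) :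
    ∃ M, 0 ≤ M ∧ ∀ t ∈ Set.Icc 0 T, ∀ s ∈ Set.Icc 0 T, ∀ x y,
      ‖φ (T - t) x - φ (T - s) y‖ ≤ M * (√|t - s| + ‖x - y‖) ^ α := by
  obtain ⟨K, hK, h1⟩ := ht
  obtain ⟨K', hK', h2⟩ := hx
  have hmem : ∀ {t}, t ∈ Set.Icc 0 T → T - t ∈ Set.Icc 0 T := fun ht =>
    ⟨by linarith [ht.2], by linarith [ht.1]⟩
  refine ⟨K + K', by positivity, fun t ht s hs x y => ?_⟩
  have e1 : ‖φ (T - t) x - φ (T - s) x‖ ≤ K * (√|t - s| + ‖x - y‖) ^ α := by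
    refine ((φ (T - t) - φ (T - s)).norm_coe_le_norm x).trans
      ((h1 _ (hmem ht) _ (hmem hs)).trans ?_)
    rw [sub_sub_sub_cancel_left, abs_sub_comm, show α / 2 = 1 / 2 * α by ring,
      Real.rpow_mul (abs_nonneg _), ← Real.sqrt_eq_rpow]
    gcongr
    exact le_add_of_nonneg_right (norm_nonneg _)
  have e2 : ‖φ (T - s) x - φ (T - s) y‖ ≤ K' * (√|t - s| + ‖x - y‖) ^ α := by
    refine (h2 _ (hmem hs) x y).trans ?_
    gcongr
    exact le_add_of_nonneg_left (Real.sqrt_nonneg _)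
  calc _ ≤ ‖φ (T - t) x - φ (T - s) x‖ + ‖φ (T - s) x - φ (T - s) y‖ :=
        norm_sub_le_norm_sub_add_norm_sub _ _ _
    _ ≤ _ := by rw [add_mul]; exact add_le_add e1 e2

lemma holderTime_gen {T β : ℝ} (hβ : 0 ≤ β) {A : ℝ → Matrix (Fin D) (Fin D) ℝ}
    (hA : ∀ i j, HolderTime β T fun t => A t i j) {q : ℝ → State D →ᵇ Jet D (Jet D (Fin I → ℝ))}
    (hq : HolderTime β T q) : HolderTime β T fun t => gen (A t) (q t) :=
  (holderTime_const (1 / 2 : ℝ)).smul hβ (HolderTime.sum _ fun i _ => HolderTime.sum _ fun j _ =>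
    (hA i j).smul hβ (hq.clm _))

lemma exists_gen_isHolder {T β α : ℝ} (hβ : 0 ≤ β) {A : ℝ → Matrix (Fin D) (Fin D) ℝ}
    (hA : ∀ i j, HolderTime β T fun t => A t i j) {q : ℝ → State D →ᵇ Jet D (Jet D (Fin I → ℝ))}
    (hq : ∃ K, 0 ≤ K ∧ ∀ t ∈ Set.Icc 0 T, IsHolder α K (q t)) :
    ∃ K, 0 ≤ K ∧ ∀ t ∈ Set.Icc 0 T, IsHolder α K (gen (A t) (q t)) := by
  obtain ⟨K, hK, hq⟩ := hq
  choose R hR hAR using fun i j => (hA i j).bounded hβ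
  refine ⟨‖(1 / 2 : ℝ)‖ * ∑ i, ∑ j, R i j * (‖evalPair D (Fin I → ℝ) i j‖ * K), ?_,
    fun t ht x y => ?_⟩
  · exact mul_nonneg (norm_nonneg _) (Finset.sum_nonneg fun i _ => Finset.sum_nonneg fun j _ =>
      mul_nonneg (hR i j) (by positivity))
  · rw [gen_apply, gen_apply, ← smul_sub, norm_smul, mul_assoc]
    refine mul_le_mul_of_nonneg_left ?_ (norm_nonneg _)
    simp only [← Finset.sum_sub_distrib, ← smul_sub, ← map_sub, Finset.sum_mul]
    refine norm_sum_le_of_le _ fun i _ => norm_sum_le_of_le _ fun j _ => ?_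
    rw [norm_smul, mul_assoc, mul_assoc]
    refine mul_le_mul (hAR i j t ht) ?_ (norm_nonneg _) (hR i j)
    exact (ContinuousLinearMap.le_opNorm _ _).trans (by gcongr; exact hq t ht x y)

end System

/-! ### Regularity of the reversed forward solution. -/

namespace Diffusion.IsForwardSol

variable {D N I : ℕ} {F : Diffusion D} {B : ℝ → Quad D (Fin I → ℝ)} {α T : ℝ}
  {w : ℝ → State D →ᵇ (Fin I → ℝ)} {p : ℝ → State D →ᵇ Jet D (Fin I → ℝ)}
  {q : ℝ → State D →ᵇ Jet D (Jet D (Fin I → ℝ))}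

lemma exists_quadFun_isHolder (hα : 0 < α) (hα1 : α < 1) {κ : ℝ} (hBκ : ∀ t, ‖B t‖ ≤ κ)
    (h : F.IsForwardSol B α T w p q) :
    ∃ K, 0 ≤ K ∧ ∀ t ∈ Set.Icc 0 T, IsHolder α K (quadFun (B t) (p t)) := by
  obtain ⟨P, hP, hpP⟩ := h.bounded_grad hα
  obtain ⟨R, hR, hqR⟩ := h.bounded_hess hα
  have hκ : 0 ≤ κ := (norm_nonneg _).trans (hBκ 0)
  refine ⟨_, ?_, fun t ht => isHolder_of_bound_of_lipschitz hα.le hα1.le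
    (M := κ * P ^ 2) (L := 2 * κ * P * R) (by positivity) (by positivity)
    (fun x => ((quadFun (B t) (p t)).norm_coe_le_norm x).trans (norm_quadFun_le (hBκ t) (hpP t ht)))
    (quadFun_isHolder_one (hBκ t) (hpP t ht) (h.grad_isHolder_one ht (hqR t ht)))⟩
  positivity

section Reversed

lemma partialDeriv_apply (h : F.IsForwardSol B α T w p q) {s : ℝ} (hs : s ∈ Set.Icc 0 T) (i : Fin I)
    (d : Fin D) (x : State D) :
    partialDeriv d (fun x => w s x i) x = p s x (EuclideanSpace.single d 1) i := by
  have h1 : HasFDerivAt (fun x => w s x i) _ x := hasFDerivAt_pi'.1 (h.grad s hs x) i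
  rw [partialDeriv, h1.fderiv]; rfl

lemma hess_apply (h : F.IsForwardSol B α T w p q) {s : ℝ} (hs : s ∈ Set.Icc 0 T) (i : Fin I)
    (d e : Fin D) (x : State D) :
    RadnerPDE.hess (fun x => w s x i) x d e =
      q s x (EuclideanSpace.single e 1) (EuclideanSpace.single d 1) i := by
  have h1 : partialDeriv d (fun x => w s x i) =
      (partialCLM d i : Jet D (Fin I → ℝ) → ℝ) ∘ (p s : State D → Jet D (Fin I → ℝ)) :=
    funext fun x => h.partialDeriv_apply hs i d x
  have h2 := (partialCLM d i).hasFDerivAt.comp x (h.hess s hs x)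
  rw [RadnerPDE.hess, Matrix.of_apply, h1, partialDeriv, h2.fderiv]
  rfl

lemma contDiff (h : F.IsForwardSol B α T w p q) {s : ℝ} (hs : s ∈ Set.Icc 0 T) (i : Fin I) :
    ContDiff ℝ 2 fun x => w s x i :=
  contDiff_pi.1 (contDiff_two_of_hasFDerivAt (h.grad s hs) (h.hess s hs) (q s).continuous) i

lemma hasDerivWithinAt_reversed (h : F.IsForwardSol B α T w p q) {t : ℝ} (ht : t ∈ Set.Icc 0 T)
    (i : Fin I) (x : State D) :
    HasDerivWithinAt (fun t => w (T - t) x i)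
      (-((gen (F.A (T - t)) (q (T - t)) + quadFun (B (T - t)) (p (T - t))) x i))
      (Set.Icc 0 T) t := by
  have h1 := h.eqn (T - t) ⟨by linarith [ht.2], by linarith [ht.1]⟩
  have h2 : HasDerivWithinAt (fun s => w s x i) _ (Set.Icc 0 T) (T - t) :=
    ((ContinuousLinearMap.proj (R := ℝ) (φ := fun _ : Fin I => ℝ) i).comp
      (BoundedContinuousFunction.evalCLM (β := Fin I → ℝ) ℝ x)).hasFDerivAt.comp_hasDerivWithinAt
        (T - t) h1
  have hm : Set.MapsTo (fun r => T - r) (Set.Icc 0 T) (Set.Icc 0 T) := fun r hr =>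
    ⟨by linarith [hr.2], by linarith [hr.1]⟩
  have h3 := HasDerivWithinAt.comp t h2 ((hasDerivAt_id t).const_sub T).hasDerivWithinAt hm
  exact h3.congr_deriv (by simp)

lemma timeDeriv_reversed (hT : 0 < T) (h : F.IsForwardSol B α T w p q) {t : ℝ}
    (ht : t ∈ Set.Icc 0 T) (i : Fin I) (x : State D) :
    timeDeriv T (fun t x => w (T - t) x i) t x =
      -((gen (F.A (T - t)) (q (T - t)) + quadFun (B (T - t)) (p (T - t))) x i) :=
  (h.hasDerivWithinAt_reversed ht i x).derivWithin (uniqueDiffOn_Icc hT t ht)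

end Reversed

/-- The bounds for ∂ₜ are read off the equation: up to sign it is the generator of the Hessian plus
the quadratic term, both Hölder in time and in space. Continuity in time for the sup norm supplies
joint continuity. -/
lemma memParHolder₂_reversed (hα : 0 < α) (hα1 : α < 1) (hT : 0 < T) (hT1 : T ≤ 1)
    (hA : ∀ i j, HolderTime (α / 2) T fun t => F.A t i j) (hB : Continuous B) {κ : ℝ}
    (hBκ : ∀ t, ‖B t‖ ≤ κ) (hBH : HolderTime (α / 2) T B) (h : F.IsForwardSol B α T w p q)
    (i : Fin I) : MemParHolder₂ T α fun t x => w (T - t) x i := by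
  have hα2 : 0 < α / 2 := by linarith
  have hmem : ∀ {t}, t ∈ Set.Icc 0 T → T - t ∈ Set.Icc 0 T := fun ht =>
    ⟨by linarith [ht.2], by linarith [ht.1]⟩
  set f : ℝ → State D →ᵇ (Fin I → ℝ) := fun t => gen (F.A t) (q t) + quadFun (B t) (p t) with hf
  have hft : HolderTime (α / 2) T f :=
    (holderTime_gen hα2.le hA h.holderTime).add (h.holderTime_quadFun hα hα1 hT1 hB hBH)
  have hfx : ∃ K, 0 ≤ K ∧ ∀ t ∈ Set.Icc 0 T, IsHolder α K (f t) := by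
    obtain ⟨K, hK, h1⟩ := exists_gen_isHolder hα2.le hA h.holder
    obtain ⟨K', hK', h2⟩ := h.exists_quadFun_isHolder hα hα1 hBκ
    exact ⟨K + K', by positivity, fun t ht => (h1 t ht).add (h2 t ht)⟩
  have hbdd : ∀ {V : Type} [NormedAddCommGroup V] {φ : ℝ → State D →ᵇ V},
      (∃ R, 0 ≤ R ∧ ∀ t ∈ Set.Icc 0 T, ‖φ t‖ ≤ R) →
      ∃ R, 0 ≤ R ∧ ∀ t ∈ Set.Icc 0 T, ∀ x, ‖φ (T - t) x‖ ≤ R := by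
    rintro V _ φ ⟨R, hR, hb⟩
    exact ⟨R, hR, fun t ht x => ((φ (T - t)).norm_coe_le_norm x).trans (hb _ (hmem ht))⟩
  have hunit : ∀ d : Fin D, ‖(EuclideanSpace.single d 1 : State D)‖ = 1 := fun d => by simp
  have hc1 : ∀ (P : Jet D (Fin I → ℝ)) (d : Fin D), |P (EuclideanSpace.single d 1) i| ≤ ‖P‖ :=
    fun P d => (norm_le_pi_norm (P (EuclideanSpace.single d 1)) i).trans
      ((norm_jet_apply_le P _).trans (by rw [hunit, mul_one]))
  have hc2 : ∀ (Q : Jet D (Jet D (Fin I → ℝ))) (d e : Fin D),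
      |Q (EuclideanSpace.single e 1) (EuclideanSpace.single d 1) i| ≤ ‖Q‖ := fun Q d e =>
    (hc1 _ d).trans ((norm_jet_apply_le Q _).trans (by rw [hunit, mul_one]))
  have hgrad : ∀ t ∈ Set.Icc 0 T, ∀ d x, partialDeriv d (fun x => w (T - t) x i) x =
      p (T - t) x (EuclideanSpace.single d 1) i := fun t ht d x =>
    h.partialDeriv_apply (hmem ht) i d x
  have hhess : ∀ t ∈ Set.Icc 0 T, ∀ d e x, RadnerPDE.hess (fun x => w (T - t) x i) x d e =
      q (T - t) x (EuclideanSpace.single e 1) (EuclideanSpace.single d 1) i := fun t ht d e x =>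
    h.hess_apply (hmem ht) i d e x
  have htime : ∀ t ∈ Set.Icc 0 T, ∀ x, timeDeriv T (fun t x => w (T - t) x i) t x =
      -(f (T - t) x i) := fun t ht x => h.timeDeriv_reversed hT ht i x
  refine ⟨⟨fun t ht x => (h.hasDerivWithinAt_reversed ht i x).differentiableWithinAt,
    fun t ht => h.contDiff (hmem ht) i,
    continuousOn_pi.1 (continuousOn_eval_reversed h.continuousOn) i, ?_, ?_, ?_⟩, ?_⟩
  · exact (continuousOn_pi.1 (continuousOn_eval_reversed (hft.continuousOn hα2)) i).neg.congr
      fun p hp => htime p.1 hp.1 p.2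
  · refine continuousOn_pi.2 fun d => ?_
    exact ((partialCLM d i).continuous.comp_continuousOn
      (continuousOn_eval_reversed (h.continuousOn_grad hα))).congr
        fun p hp => hgrad p.1 hp.1 d p.2
  · refine continuousOn_pi.2 fun d => continuousOn_pi.2 fun e => ?_
    exact (((ContinuousLinearMap.proj (R := ℝ) (φ := fun _ : Fin I => ℝ) i).comp
      (evalPair D (Fin I → ℝ) e d)).continuous.comp_continuousOn
        (continuousOn_eval_reversed (h.holderTime.continuousOn hα2))).congr
          fun p hp => hhess p.1 hp.1 d e p.2
  · obtain ⟨Rf, hRf, hbf⟩ := hbdd (hft.bounded hα2.le)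
    obtain ⟨Rw, hRw, hbw⟩ := hbdd ((h.holderTime_sol hα hα1 hT1 hB).bounded hα2.le)
    obtain ⟨Rp, hRp, hbp⟩ := hbdd (h.bounded_grad hα)
    obtain ⟨Rq, hRq, hbq⟩ := hbdd (h.bounded_hess hα)
    obtain ⟨Kf, hKf, hHf⟩ := exists_holder_reversed hα.le hft hfx
    obtain ⟨Kq, hKq, hHq⟩ := exists_holder_reversed hα.le h.holderTime h.holder
    simp only [parHolderNorm₂, ENNReal.add_lt_top, ENNReal.sum_lt_top, Finset.mem_univ,
      true_implies, parSupNorm_lt_top_iff, parHolderSeminorm_lt_top_iff hα]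
    refine ⟨⟨⟨⟨⟨⟨Rf, hRf, fun t ht x => ?_⟩, ⟨Kf, hKf, fun t ht s hs x y => ?_⟩⟩,
      ⟨Rw, hRw, fun t ht x => ?_⟩⟩, fun d => ⟨Rp, hRp, fun t ht x => ?_⟩⟩,
      fun d e => ⟨Rq, hRq, fun t ht x => ?_⟩⟩, fun d e => ⟨Kq, hKq, fun t ht s hs x y => ?_⟩⟩
    · rw [htime t ht, abs_neg]
      exact (norm_le_pi_norm (f (T - t) x) i).trans (hbf t ht x)
    · rw [htime t ht, htime s hs, neg_sub_neg, abs_sub_comm]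
      exact (norm_le_pi_norm (f (T - t) x - f (T - s) y) i).trans (hHf t ht s hs x y)
    · exact (norm_le_pi_norm (w (T - t) x) i).trans (hbw t ht x)
    · rw [hgrad t ht]
      exact (hc1 _ d).trans (hbp t ht x)
    · rw [hhess t ht]
      exact (hc2 _ d e).trans (hbq t ht x)
    · rw [hhess t ht, hhess s hs]
      exact (hc2 (q (T - t) x - q (T - s) y) d e).trans (hHq t ht s hs x y)

end Diffusion.IsForwardSol

variable {D N I : ℕ} {α δlo δhi : ℝ} {C : ℝ → Matrix (Fin D) (Fin D) ℝ}

/-! ### Passing between the backward system and the forward equation. -/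

section Backward

variable {hN : N ≤ D} {T : ℝ} {a : Fin I → ℝ} {g : Fin I → State D → ℝ}
  {v : Fin I → ℝ → State D → ℝ}

/-- Time reversal of a solution of the forward equation. -/
lemma Diffusion.IsForwardSol.isSolution_reversed (hα : 0 < α) (hα1 : α < 1)
    (hC : IsVolatility α δlo δhi C) (hlo : 0 < δlo) (hhi : 0 < δhi) (hT : 0 < T) (hT1 : T ≤ 1)
    {w : ℝ → State D →ᵇ (Fin I → ℝ)} {p : ℝ → State D →ᵇ Jet D (Fin I → ℝ)}
    {q : ℝ → State D →ᵇ Jet D (Jet D (Fin I → ℝ))}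
    (h : (hC.diffusion hα hlo hhi T).IsForwardSol (fun s => quadForm hN a (clampVol C (T - s)))
      α T w p q) (h0 : ∀ i y, w 0 y i = g i y) :
    IsSolution hN T α a C g fun i t x => w (T - t) x i := by
  obtain ⟨κ, -, hBκ⟩ := hC.exists_norm_quadForm_le hN a hα
  have hmem : ∀ {t}, t ∈ Set.Icc 0 T → T - t ∈ Set.Icc 0 T := fun ht =>
    ⟨by linarith [ht.2], by linarith [ht.1]⟩
  refine ⟨fun i => h.memParHolder₂_reversed hα hα1 hT hT1
    (hC.holderTime_diffusion hα hlo hhi hT1)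
    ((hC.continuous_quadForm hN a hα).comp (continuous_const.sub continuous_id))
    (fun s => hBκ (T - s)) (hC.holderTime_quadForm hN a hα hT1) i, fun i t ht y => ?_,
    fun i y => by simpa using h0 i y⟩
  rw [pdeOperator_eq hN a C (u := fun i t x => w (T - t) x i) (P := p (T - t) y)
    (Q := q (T - t) y)
    (fun i d => (h.partialDeriv_apply (hmem ht) i d y).symm)
    (fun i d e => (h.hess_apply (hmem ht) i d e y).symm), h.timeDeriv_reversed hT ht]
  have hCt : clampVol C (T - (T - t)) = C t := by
    rw [sub_sub_cancel]; exact clampVol_of_mem ⟨ht.1, ht.2.trans hT1⟩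
  simp only [IsVolatility.diffusion, hCt, BoundedContinuousFunction.add_apply, gen_apply,
    quadFun_apply, Pi.add_apply]
  ring

lemma IsSolution.exists_bddJets (hα : 0 < α) (hv : IsSolution hN T α a C g v) :
    ∃ M K, 0 ≤ K ∧ (∀ t ∈ Set.Icc 0 T, BddJets M fun i => v i t) ∧
      (∀ i d e, ∀ t ∈ Set.Icc 0 T, ∀ s ∈ Set.Icc 0 T, ∀ x y,
        |hess (v i t) x d e - hess (v i s) y d e| ≤ K * (√|t - s| + ‖x - y‖) ^ α) ∧
      ∀ i, ∀ t ∈ Set.Icc 0 T, ∀ s ∈ Set.Icc 0 T, ∀ x y,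
        |timeDeriv T (v i) t x - timeDeriv T (v i) s y| ≤ K * (√|t - s| + ‖x - y‖) ^ α := by
  have hfin := fun i => (hv.mem i).2
  simp only [parHolderNorm₂, ENNReal.add_lt_top, ENNReal.sum_lt_top, Finset.mem_univ,
    true_implies, parSupNorm_lt_top_iff, parHolderSeminorm_lt_top_iff hα] at hfin
  obtain ⟨M₀, hM₀, h0⟩ := exists_uniform_bound (ι := Fin I)
    (P := fun i M => ∀ t ∈ Set.Icc 0 T, ∀ x, |v i t x| ≤ M)
    (fun _ _ _ h hb t ht x => (hb t ht x).trans h) fun i => (hfin i).1.1.1.2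
  obtain ⟨M₁, hM₁, h1⟩ := exists_uniform_bound (ι := Fin I × Fin D)
    (P := fun k M => ∀ t ∈ Set.Icc 0 T, ∀ x, |partialDeriv k.2 (v k.1 t) x| ≤ M)
    (fun _ _ _ h hb t ht x => (hb t ht x).trans h) fun k => (hfin k.1).1.1.2 k.2
  obtain ⟨M₂, hM₂, h2⟩ := exists_uniform_bound (ι := Fin I × Fin D × Fin D)
    (P := fun k M => ∀ t ∈ Set.Icc 0 T, ∀ x, |hess (v k.1 t) x k.2.1 k.2.2| ≤ M)
    (fun _ _ _ h hb t ht x => (hb t ht x).trans h) fun k => (hfin k.1).1.2 k.2.1 k.2.2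
  obtain ⟨K, hK, h3⟩ := exists_uniform_bound (ι := Fin I × Fin D × Fin D)
    (P := fun k M => ∀ t ∈ Set.Icc 0 T, ∀ s ∈ Set.Icc 0 T, ∀ x y,
      |hess (v k.1 t) x k.2.1 k.2.2 - hess (v k.1 s) y k.2.1 k.2.2| ≤
        M * (√|t - s| + ‖x - y‖) ^ α)
    (fun _ _ _ h hb t ht s hs x y => (hb t ht s hs x y).trans (by gcongr))
    fun k => (hfin k.1).2 k.2.1 k.2.2
  obtain ⟨K', hK', h4⟩ := exists_uniform_bound (ι := Fin I)
    (P := fun i M => ∀ t ∈ Set.Icc 0 T, ∀ s ∈ Set.Icc 0 T, ∀ x y,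
      |timeDeriv T (v i) t x - timeDeriv T (v i) s y| ≤ M * (√|t - s| + ‖x - y‖) ^ α)
    (fun _ _ _ h hb t ht s hs x y => (hb t ht s hs x y).trans (by gcongr))
    fun i => (hfin i).1.1.1.1.2
  exact ⟨M₀ + M₁ + M₂, K + K', by positivity, fun t ht =>
    ⟨fun i => (hv.mem i).1.contDiff_space t ht, by positivity,
      fun i x => (h0 i t ht x).trans (by linarith),
      fun i d x => (h1 (i, d) t ht x).trans (by linarith),
      fun i d e x => (h2 (i, d, e) t ht x).trans (by linarith)⟩,
    fun i d e t ht s hs x y => (h3 (i, d, e) t ht s hs x y).trans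
      (mul_le_mul_of_nonneg_right (by linarith) (by positivity)),
    fun i t ht s hs x y => (h4 i t ht s hs x y).trans
      (mul_le_mul_of_nonneg_right (by linarith) (by positivity))⟩

/-- A remainder estimate for functions with Hölder continuous derivative. -/
lemma abs_sub_sub_le_of_holder {f f' : ℝ → ℝ} {β K : ℝ} (hβ : 0 ≤ β) (hK : 0 ≤ K)
    (hd : ∀ t ∈ Set.Icc 0 T, HasDerivWithinAt f (f' t) (Set.Icc 0 T) t)
    (hf' : ∀ s ∈ Set.Icc 0 T, ∀ t ∈ Set.Icc 0 T, |f' s - f' t| ≤ K * |s - t| ^ β) {s t : ℝ}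
    (hs : s ∈ Set.Icc 0 T) (ht : t ∈ Set.Icc 0 T) :
    |f t - f s - (t - s) * f' s| ≤ K * |t - s| ^ (1 + β) := by
  have hsub : Set.uIcc s t ⊆ Set.Icc 0 T := Set.uIcc_subset_Icc hs ht
  have h1 : ∀ r ∈ Set.uIcc s t,
      HasDerivWithinAt (fun r => f r - r * f' s) (f' r - f' s) (Set.uIcc s t) r := fun r hr =>
    (((hd r (hsub hr)).mono hsub).sub
      ((hasDerivAt_id r).mul_const (f' s)).hasDerivWithinAt).congr_deriv (by simp)
  have h2 : ∀ r ∈ Set.uIcc s t, ‖f' r - f' s‖ ≤ K * |t - s| ^ β := fun r hr =>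
    (hf' r (hsub hr) s hs).trans (by
      have := Set.abs_sub_left_of_mem_uIcc hr
      gcongr)
  have h3 := (convex_uIcc s t).norm_image_sub_le_of_norm_hasDerivWithin_le h1 h2
    Set.left_mem_uIcc Set.right_mem_uIcc
  rw [show f t - f s - (t - s) * f' s = f t - t * f' s - (f s - s * f' s) by ring,
    Real.rpow_add_of_nonneg (abs_nonneg _) zero_le_one hβ, Real.rpow_one]
  exact h3.trans (le_of_eq (by rw [Real.norm_eq_abs]; ring))

/-- Time reversal of a solution of the system. -/
lemma IsSolution.isForwardSol (hα : 0 < α)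
    (hC : IsVolatility α δlo δhi C) (hlo : 0 < δlo) (hhi : 0 < δhi) (hT1 : T ≤ 1)
    (hv : IsSolution hN T α a C g v) :
    (hC.diffusion hα hlo hhi T).IsForwardSol (fun s => quadForm hN a (clampVol C (T - s))) α T
      (fun s => vecBCF fun i => v i (T - s)) (fun s => gradBCF fun i => v i (T - s))
      (fun s => hessBCF fun i => v i (T - s)) := by
  obtain ⟨M, K, hK, hj, hH, hτ⟩ := hv.exists_bddJets hα
  have hmem : ∀ {t}, t ∈ Set.Icc 0 T → T - t ∈ Set.Icc 0 T := fun ht =>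
    ⟨by linarith [ht.2], by linarith [ht.1]⟩
  have hpow : ∀ s t : ℝ, (√|(T - s) - (T - t)| + ‖(0 : State D)‖) ^ α = |s - t| ^ (α / 2) :=
    fun s t => by
      rw [norm_zero, add_zero, sub_sub_sub_cancel_left, abs_sub_comm, Real.sqrt_eq_rpow,
        ← Real.rpow_mul (abs_nonneg _), show 1 / 2 * α = α / 2 by ring]
  refine ⟨fun t ht => (hj _ (hmem ht)).hasFDerivAt_vecBCF,
    fun t ht => (hj _ (hmem ht)).hasFDerivAt_gradBCF, fun s hs => ?_,
    ⟨D * (D * K), by positivity, fun t ht x y => ?_⟩,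
    ⟨D * (D * K), by positivity, fun s hs t ht => ?_⟩⟩
  · set f : State D →ᵇ (Fin I → ℝ) :=
      gen ((hC.diffusion hα hlo hhi T).A s) (hessBCF fun i => v i (T - s)) +
        quadFun (quadForm hN a (clampVol C (T - s))) (gradBCF fun i => v i (T - s)) with hf
    -- The system says that the forward right-hand side is −∂ₜv; on [0, 1] the clamped volatility is
    -- the original one.
    have hfτ : ∀ x i, f x i = -timeDeriv T (v i) (T - s) x := fun x i => by
      have h1 := hv.equation i (T - s) (hmem hs) x
      rw [pdeOperator_eq hN a C (u := v) (P := gradBCF (fun i => v i (T - s)) x)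
        (Q := hessBCF (fun i => v i (T - s)) x)
        (fun i d => (hj _ (hmem hs)).gradBCF_apply x d i)
        (fun i d e => (hj _ (hmem hs)).hessBCF_apply x d e i)] at h1
      have hCt : clampVol C (T - s) = C (T - s) :=
        clampVol_of_mem ⟨(hmem hs).1, (hmem hs).2.trans hT1⟩
      simp only [hf, IsVolatility.diffusion, hCt, BoundedContinuousFunction.add_apply, gen_apply,
        quadFun_apply, Pi.add_apply]
      linarith
    have hd : ∀ x i, ∀ r ∈ Set.Icc 0 T, HasDerivWithinAt (fun r => v i (T - r) x)
        (-timeDeriv T (v i) (T - r) x) (Set.Icc 0 T) r := fun x i r hr => by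
      have h1 : HasDerivWithinAt (fun t => v i t x) (timeDeriv T (v i) (T - r) x) (Set.Icc 0 T)
          (T - r) := ((hv.mem i).1.differentiable_time _ (hmem hr) x).hasDerivWithinAt
      have hm : Set.MapsTo (fun r => T - r) (Set.Icc 0 T) (Set.Icc 0 T) := fun r hr => hmem hr
      exact (HasDerivWithinAt.comp r h1 ((hasDerivAt_id r).const_sub T).hasDerivWithinAt
        hm).congr_deriv (by simp)
    -- Pointwise differentiability in time becomes differentiability for the sup norm: Hölder
    -- continuity of ∂ₜv with exponent α/2 in time bounds the remainder by K|t − s|^(1+α/2),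
    -- uniformly in x and i.
    have e1 : HasDerivWithinAt (fun t => vecBCF (fun i => v i (T - t)) -
        vecBCF (fun i => v i (T - s)) - (t - s) • f) 0 (Set.Icc 0 T) s := by
      refine hasDerivWithinAt_zero_of_norm_le (β := 1 + α / 2) (C := K) (by linarith)
        (eventually_nhdsWithin_of_forall fun t ht => ?_) (by ext x i; simp)
      have hR : 0 ≤ K * |t - s| ^ (1 + α / 2) := by positivity
      refine (BoundedContinuousFunction.norm_le hR).2 fun x =>
        (pi_norm_le_iff_of_nonneg hR).2 fun i => ?_
      have h2 := abs_sub_sub_le_of_holder (β := α / 2) (by linarith) hK (hd x i)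
        (fun r hr t ht => by
          rw [neg_sub_neg, abs_sub_comm, ← hpow, ← sub_self x]
          exact hτ i _ (hmem hr) _ (hmem ht) x x) hs ht
      rw [← hfτ, ← (hj _ (hmem hs)).vecBCF_apply, ← (hj _ (hmem ht)).vecBCF_apply] at h2
      exact h2
    have e2 := ((e1.add (((hasDerivAt_id s).sub_const s).smul_const f).hasDerivWithinAt).add_const
      (vecBCF fun i => v i (T - s)))
    refine (e2.congr_of_mem (fun t _ => ?_) hs).congr_deriv (by simp)
    simp
  · refine ((hj _ (hmem ht)).norm_hessBCF_sub_le (hj _ (hmem ht)) (R := K * ‖x - y‖ ^ α)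
      (by positivity) fun i d e => ?_).trans (le_of_eq (by ring))
    simpa using hH i d e _ (hmem ht) _ (hmem ht) x y
  · have hR : 0 ≤ D * (D * K) * |s - t| ^ (α / 2) := by positivity
    refine (BoundedContinuousFunction.norm_le hR).2 fun x => ?_
    refine ((hj _ (hmem hs)).norm_hessBCF_sub_le (hj _ (hmem ht)) (R := K * |s - t| ^ (α / 2))
      (by positivity) fun i d e => ?_).trans (le_of_eq (by ring))
    rw [← hpow, ← sub_self x]
    exact hH i d e _ (hmem hs) _ (hmem ht) x x

end Backward

/-- The choice √T₀ = 1/(2(c + 1)) works; the summand 1 covers c = 0 and keeps T₀ ≤ 1. -/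
lemma exists_pos_le_one_mul_rpow_half_le {c : ℝ} (hc : 0 ≤ c) :
    ∃ T₀ ∈ Set.Ioc (0 : ℝ) 1, ∀ T, 0 < T → T < T₀ → c * T ^ (1 / 2 : ℝ) ≤ 1 / 2 := by
  have h0 : 0 < 1 / (2 * (c + 1)) := by positivity
  have h1 : 1 / (2 * (c + 1)) ≤ 1 := by rw [div_le_one (by positivity)]; linarith
  refine ⟨(1 / (2 * (c + 1))) ^ 2, ⟨by positivity, pow_le_one₀ h0.le h1⟩, fun T hT hTT => ?_⟩
  rw [← Real.sqrt_eq_rpow]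
  have h2 : √T ≤ 1 / (2 * (c + 1)) := (Real.sqrt_le_left h0.le).2 hTT.le
  calc c * √T ≤ c * (1 / (2 * (c + 1))) := by gcongr
    _ ≤ 1 / 2 := by
      rw [mul_one_div, div_le_div_iff₀ (by positivity) (by norm_num)]
      linarith

end RadnerPDE

theorem theoremA5 (D N I : ℕ) (hN : N ≤ D)
    (α δlo δhi : ℝ) (hα : α ∈ Set.Ioo (0 : ℝ) 1) (hδlo : 0 < δlo) (hδ : δlo < δhi)
    (C : ℝ → Matrix (Fin D) (Fin D) ℝ) (hC : RadnerPDE.IsVolatility α δlo δhi C)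
    (a : Fin I → ℝ) (ha : ∀ i, 0 < a i)
    (g : Fin I → RadnerPDE.State D → ℝ) (hg : ∀ i, RadnerPDE.MemHolder₂ α (g i)) :
    ∃ T₀ ∈ Set.Ioc (0 : ℝ) 1, ∀ T : ℝ, 0 < T → T < T₀ →
      ∃ u : Fin I → ℝ → RadnerPDE.State D → ℝ,
        RadnerPDE.IsSolution hN T α a C g u ∧
        ∀ v : Fin I → ℝ → RadnerPDE.State D → ℝ, RadnerPDE.IsSolution hN T α a C g v →
          ∀ i, ∀ t ∈ Set.Icc 0 T, ∀ y, v i t y = u i t y := by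
  have hδhi : 0 < δhi := hδlo.trans hδ
  obtain ⟨κ, hκ, hBκ⟩ := hC.exists_norm_quadForm_le hN a hα.1
  obtain ⟨M, K, hj, hK, hgK⟩ := RadnerPDE.MemHolder₂.exists_bddJets hα.1 hg
  -- The reversed diffusion depends on T, but its gradient constant depends only on `δlo`. Taking T
  -- = 0 names it before T is chosen, so T₀ is independent of T.
  have hc := (hC.diffusion hα.1 hδlo hδhi 0).gradC_nonneg
  obtain ⟨T₀, hT₀, hsmall⟩ := RadnerPDE.exists_pos_le_one_mul_rpow_half_le
    (c := 8 * (hC.diffusion hα.1 hδlo hδhi 0).gradC * κ * (‖RadnerPDE.gradBCF g‖ + 1) *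
      (‖RadnerPDE.gradBCF g‖ + ‖RadnerPDE.hessBCF g‖ + 3)) (by positivity)
  refine ⟨T₀, hT₀, fun T hT hTT => ?_⟩
  have hT1 : T ≤ 1 := hTT.le.trans hT₀.2
  have hB : Continuous fun s => RadnerPDE.quadForm hN a (RadnerPDE.clampVol C (T - s)) :=
    (hC.continuous_quadForm hN a hα.1).comp (continuous_const.sub continuous_id)
  obtain ⟨w, p, q, hw, hw0⟩ := (hC.diffusion hα.1 hδlo hδhi T).exists_isForwardSol hB
    (fun s => hBκ (T - s)) hα.1 hα.2 hK hj.hasFDerivAt_vecBCF hj.hasFDerivAt_gradBCF hgK hT.le hT1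
    (hsmall T hT hTT)
  refine ⟨_, hw.isSolution_reversed hα.1 hα.2 hC hδlo hδhi hT hT1
    (fun i y => by rw [hw0, hj.vecBCF_apply]), fun v hv i t ht y => ?_⟩
  have hmem : T - t ∈ Set.Icc 0 T := ⟨by linarith [ht.2], by linarith [ht.1]⟩
  have hv' := hv.isForwardSol hα.1 hC hδlo hδhi hT1
  obtain ⟨M', K', -, hj', -⟩ := hv.exists_bddJets hα.1
  -- Under time reversal the terminal condition becomes the common initial value on which forward
  -- uniqueness rests.
  have h0 : (RadnerPDE.vecBCF fun i => v i (T - 0)) = w 0 := by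
    rw [hw0, sub_zero]
    congr 1
    ext i y
    exact hv.terminal i y
  have h1 := hv'.unique hα.1 hT.le hB (fun s => hBκ (T - s)) hw h0 (T - t) hmem
  have h2 := (hj' _ ht).vecBCF_apply y i
  rw [sub_sub_cancel] at h1
  rw [← h2, h1]
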